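/- Let $N\ge 1$ and let $V$ be a real symmetric positive definite $N\times N$ matrix such that the vectors $V^k e_1$, $k=0,1,2,\dots$, span $\mathbb{R}^N$ (where $e_1$ is the first standard basis vector) and such that the eigenvalues of $V$, listed with multiplicity, are linearly independent over $\mathbb{Q}$. On $\mathbb{R}^{2N}$, with points $\psi=(q,p)$ and the standard scalar product, let $H(\psi)=\frac12\sum_{k=1}^N p_k^2+\frac12 (q,Vq)$, and for $h>0$ let $\mathcal{M}_h=\{\psi: H(\psi)=h\}$. Let $A=\begin{pmatrix}0&E\\-V&0\end{pmatrix}$ be the matrix of the Hamiltonian system $\dot q=p$, $\dot p=-Vq$, and let $I$ be the linear map which replaces $p_1$ by $-p_1$ and leaves all other coordinates unchanged. Let $\tau_1,\tau_2,\dots$ be independent identically distributed positive random variables whose law has a density $\rho$ with respect to Lebesgue measure on $(0,\infty)$, with $\rho(s)>0$ for every $s>0$, and with $E\tau_1<\infty$. Put $t_0=0$, $t_m=\tau_1+\dots+\tau_m$, and for $\psi(0)\in\mathcal{M}_h$ let $$\psi(t)=e^{A(t-t_m)}\,I e^{A\tau_m}\,I e^{A\tau_{m-1}}\cdots I e^{A\tau_1}\psi(0),\qquad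 t_m\le t<t_{m+1}.$$ Let $\pi$ be the Liouville measure on $\mathcal{M}_h$, i.e. the surface measure $d\sigma$ divided by $|\nabla H|$, normalized to be a probability measure. Then for every $h>0$, every initial state $\psi(0)\in\mathcal{M}_h$ and every bounded measurable function $f:\mathcal{M}_h\to\mathbb{R}$, almost surely $$\frac1T\int_0^T f(\psi(t))\,dt\;\longrightarrow\;\int_{\mathcal{M}_h} f\,d\pi\qquad (T\to\infty).$$ -/

import Mathlib

open MeasureTheory ProbabilityTheory Filter Topology Matrix

noncomputable section

namespace FlipDynamics

/-- The phase space `ℝ^{2N}` with its standard scalar product; the coordinates `Sum.inl i` are the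
positions `q_i` and the coordinates `Sum.inr i` the momenta `p_i`. -/
abbrev PhaseSpace (N : ℕ) : Type := EuclideanSpace ℝ (Fin N ⊕ Fin N)

variable {N : ℕ}

/-- The vector `q` of positions of a state. -/
def pos (ψ : PhaseSpace N) : Fin N → ℝ := fun i => ψ (Sum.inl i)

/-- The vector `p` of momenta of a state. -/
def mom (ψ : PhaseSpace N) : Fin N → ℝ := fun i => ψ (Sum.inr i)

/-- The quadratic Hamiltonian `H(ψ) = ∑ p_k² / 2 + (q, V q) / 2`. -/
def hamiltonian (V : Matrix (Fin N) (Fin N) ℝ) (ψ : PhaseSpace N) : ℝ :=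
  (∑ k, mom ψ k ^ 2 / 2) + (1 / 2) * (pos ψ ⬝ᵥ V *ᵥ pos ψ)

/-- The energy surface `{H = h}`. -/
def energySurface (V : Matrix (Fin N) (Fin N) ℝ) (h : ℝ) : Set (PhaseSpace N) :=
  {ψ | hamiltonian V ψ = h}

/-- The span of the vectors `V^k e_1`, `k = 0, 1, 2, …`. The first particle has index `0`. -/
def cyclicSubspace [NeZero N] (V : Matrix (Fin N) (Fin N) ℝ) : Submodule ℝ (Fin N → ℝ) :=
  Submodule.span ℝ (Set.range fun k : ℕ => (V ^ k) *ᵥ (Pi.single 0 1 : Fin N → ℝ))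

/-- The mixing subspace: states whose positions and momenta both lie in the cyclic subspace. -/
def mixingSubspace [NeZero N] (V : Matrix (Fin N) (Fin N) ℝ) : Set (PhaseSpace N) :=
  {ψ | pos ψ ∈ cyclicSubspace V ∧ mom ψ ∈ cyclicSubspace V}

/-- The positive definite real symmetric matrices whose mixing subspace is the whole space. -/
def VPlus (N : ℕ) [NeZero N] : Set (Matrix (Fin N) (Fin N) ℝ) :=
  {V | V.PosDef ∧ mixingSubspace V = Set.univ}

/-- The positive definite real symmetric matrices whose eigenvalues (listed with multiplicity)
are linearly independent over `ℚ`. -/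
def VInd (N : ℕ) : Set (Matrix (Fin N) (Fin N) ℝ) :=
  {V | ∃ hV : V.PosDef, LinearIndependent ℚ hV.isHermitian.eigenvalues}

/-- The matrix `A` of the linear Hamiltonian system `q' = p`, `p' = -V q`. -/
def generator (V : Matrix (Fin N) (Fin N) ℝ) : Matrix (Fin N ⊕ Fin N) (Fin N ⊕ Fin N) ℝ :=
  Matrix.fromBlocks 0 1 (-V) 0

/-- The Hamiltonian flow `ψ ↦ e^{tA} ψ`. -/
def flow (V : Matrix (Fin N) (Fin N) ℝ) (t : ℝ) (ψ : PhaseSpace N) : PhaseSpace N :=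
  WithLp.toLp 2 (NormedSpace.exp (t • generator V) *ᵥ WithLp.ofLp ψ)

/-- The velocity flip `I`: the sign of `p_1` is inverted, all other coordinates are unchanged. -/
def velocityFlip [NeZero N] (ψ : PhaseSpace N) : PhaseSpace N :=
  WithLp.toLp 2 (Function.update (WithLp.ofLp ψ) (Sum.inr 0) (-ψ (Sum.inr 0)))

/-- The flip times `t_m = τ_1 + … + τ_m` (with `t_0 = 0`); the gap `τ_{n+1}` is `τ n`. -/
def flipTime (τ : ℕ → ℝ) (m : ℕ) : ℝ := ∑ i ∈ Finset.range m, τ i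

/-- The state just after the `m`-th flip: `I e^{A τ_m} … I e^{A τ_1} ψ₀`. -/
def flipState [NeZero N] (V : Matrix (Fin N) (Fin N) ℝ) (τ : ℕ → ℝ) (ψ₀ : PhaseSpace N) :
    ℕ → PhaseSpace N
  | 0 => ψ₀
  | m + 1 => velocityFlip (flow V (τ m) (flipState V τ ψ₀ m))

/-- The number of flips up to and including time `t`. -/
def numFlips (τ : ℕ → ℝ) (t : ℝ) : ℕ := sSup {m | flipTime τ m ≤ t}

/-- The piecewise deterministic trajectory `ψ(t)`, `t ≥ 0`, started at `ψ₀`, with gaps `τ`. -/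
def trajectory [NeZero N] (V : Matrix (Fin N) (Fin N) ℝ) (τ : ℕ → ℝ) (ψ₀ : PhaseSpace N)
    (t : ℝ) : PhaseSpace N :=
  flow V (t - flipTime τ (numFlips τ t)) (flipState V τ ψ₀ (numFlips τ t))

/-- For positive gaps, the trajectory is `e^{A (t - t_m)} I e^{A τ_m} … I e^{A τ_1} ψ₀` on
`t_m ≤ t < t_{m+1}`. -/
theorem trajectory_eq [NeZero N] (V : Matrix (Fin N) (Fin N) ℝ) (τ : ℕ → ℝ)
    (hτ : ∀ n, 0 < τ n) (ψ₀ : PhaseSpace N) (m : ℕ) (t : ℝ)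
    (h₁ : flipTime τ m ≤ t) (h₂ : t < flipTime τ (m + 1)) :
    trajectory V τ ψ₀ t = flow V (t - flipTime τ m) (flipState V τ ψ₀ m) := by
  have hmono : StrictMono (flipTime τ) := strictMono_nat_of_lt_succ fun n => by
    simp only [flipTime, Finset.sum_range_succ]
    linarith [hτ n]
  have hn : numFlips τ t = m := by
    have hset : {k | flipTime τ k ≤ t} = Set.Iic m := by
      ext k
      constructor
      · intro hk
        exact Nat.lt_succ_iff.mp (hmono.lt_iff_lt.mp (lt_of_le_of_lt hk h₂))
      · intro hk
        exact (hmono.monotone hk).trans h₁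
    rw [numFlips, hset, csSup_Iic]
  rw [trajectory, hn]

/-- The Liouville measure `dσ / |∇H|` on the energy surface, as a measure on the phase space;
`dσ` is the `(2N-1)`-dimensional surface measure. -/
def liouville (V : Matrix (Fin N) (Fin N) ℝ) (h : ℝ) : Measure (PhaseSpace N) :=
  ((μHE[2 * N - 1] : Measure (PhaseSpace N)).restrict (energySurface V h)).withDensity
    fun ψ => ENNReal.ofReal ‖gradient (hamiltonian V) ψ‖⁻¹

/-- The Liouville measure normalized to total mass one. -/
def liouvilleProb (V : Matrix (Fin N) (Fin N) ℝ) (h : ℝ) : Measure (PhaseSpace N) :=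
  (liouville V h Set.univ)⁻¹ • liouville V h

end FlipDynamics

end

/-!
Let `V = Bᵀ B`. In the energy coordinates `(q, p) ↦ (B q, p)` the energy surface becomes a sphere,
the Hamiltonian flow becomes a group `e^{sA}` of rotations with `A` skew, and the velocity flip
becomes the reflection that inverts the unit vector `v = (0, e₁)`. The hypothesis on the vectors
`V^k e₁` says that `v` is cyclic for `A`. The structure `FlipSystem` records this situation; the
normalized Liouville measure becomes the uniform measure `rayProb` on the sphere.

The states just after the flips form a Markov chain on the sphere, one step being `x ↦ I e^{sA} x`
with a random time `s`. Two facts about compositions of such steps carry the argument, and both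
come from `FlipSystem.exists_tangent_eq_top`: some composition, as a function of its times, is a
submersion onto the sphere. Indeed, if `w` is orthogonal to the image of the differential at some
stage and to the current state `x`, then either `⟪A x, w⟫ ≠ 0`, so that one more step raises the
rank, or this pairing becomes nonzero after a further step; otherwise `⟪v, e^{sA} x⟫` and
`⟪v, e^{sA} w⟫` would have Wronskian zero for all `s > 0`, hence be proportional, and `w` would be a
multiple of `x` by cyclicity.

* Ergodicity (`FlipSystem.ae_eq_const_of_invariant`): the averages over balls of a function that is
  invariant under all steps are invariant everywhere, not only almost everywhere; they are locally
  constant by the submersion property, hence constant. With von Neumann's theorem the Cesàro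
  averages of the transition operator converge in measure (`tendsto_measure_cesaro`).
* A Doeblin condition (`FlipSystem.exists_doeblin`): from every point, after boundedly many steps,
  the chain avoids sets of small measure with probability bounded below.

The Doeblin condition turns convergence in measure into uniform convergence
(`exists_cesaro_uniform`), and with the strong law for martingale differences this gives the strong
law for the chain from every starting point (`FlipSystem.ae_tendsto_average`). Time averages follow
by summing over the cycles between flips, with a truncation of the gaps, since these have only a
first moment (`FlipSystem.ae_tendsto_timeAverage`).

Finally the surface measure divided by `‖∇H‖` has to be identified with the image of `rayProb`. For
a function `H` homogeneous of degree two it is a multiple of the cone measure, which assigns to a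
set the volume of the cone over it (`QuadraticEnergy.coneMeasure_eq`). Locally the surface is
compared with its tangent plane through the radial projection, whose differential at the point of
tangency is the identity; for subsets of a plane the volume of a cone is given by Fubini's theorem.
Cone measures behave well under linear maps, because Lebesgue measure does.
-/

/-! ### Markov chains driven by independent variables -/

namespace FlipDynamics

/-- A bounded sequence of pairwise orthogonal random variables obeys the strong law of large
numbers. Second moments give convergence along the squares; boundedness fills the gaps. -/
theorem ae_tendsto_average_zero_of_orthogonal {Ω : Type*} [MeasurableSpace Ω] {P : Measure Ω}
    [IsProbabilityMeasure P] (Z : ℕ → Ω → ℝ) (hZ : ∀ n, Measurable (Z n)) {C : ℝ}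
    (hC : ∀ n ω, |Z n ω| ≤ C) (horth : ∀ i j, i < j → ∫ ω, Z i ω * Z j ω ∂P = 0) :
    ∀ᵐ ω ∂P, Tendsto (fun n : ℕ => (∑ i ∈ Finset.range n, Z i ω) / n) atTop (𝓝 0) := by
  have hC0 : 0 ≤ C := by
    obtain ⟨ω⟩ : Nonempty Ω := P.nonempty_of_neZero
    exact (abs_nonneg _).trans (hC 0 ω)
  set S : ℕ → Ω → ℝ := fun n ω => ∑ i ∈ Finset.range n, Z i ω with hS
  have hSm : ∀ n, Measurable (S n) := fun n => by fun_prop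
  have hSb : ∀ n ω, |S n ω| ≤ n * C := fun n ω => by
    refine (Finset.abs_sum_le_sum_abs _ _).trans ?_
    refine (Finset.sum_le_sum fun i _ => hC i ω).trans ?_
    simp
  have hbint : ∀ (f : Ω → ℝ), Measurable f → (∃ D, ∀ ω, |f ω| ≤ D) → Integrable f P := by
    rintro f hf ⟨D, hD⟩
    exact Integrable.of_bound hf.aestronglyMeasurable D (Eventually.of_forall hD)
  have hZi : ∀ i j, Integrable (fun ω => Z i ω * Z j ω) P := fun i j =>
    hbint _ (by fun_prop) ⟨C * C, fun ω => by
      rw [abs_mul]; exact mul_le_mul (hC i ω) (hC j ω) (abs_nonneg _) hC0⟩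
  have hSZ : ∀ n, ∫ ω, S n ω * Z n ω ∂P = 0 := fun n => by
    simp only [hS, Finset.sum_mul]
    rw [integral_finsetSum _ fun i _ => hZi i n]
    exact Finset.sum_eq_zero fun i hi => horth i n (Finset.mem_range.1 hi)
  have hSS : ∀ n, ∫ ω, S n ω ^ 2 ∂P ≤ n * C ^ 2 := by
    intro n
    induction n with
    | zero => simp [hS]
    | succ n ih =>
      have e : ∀ ω, S (n + 1) ω ^ 2 = S n ω ^ 2 + 2 * (S n ω * Z n ω) + Z n ω * Z n ω := by
        intro ω; simp only [hS, Finset.sum_range_succ]; ring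
      have i1 : Integrable (fun ω => S n ω ^ 2) P := hbint _ (by fun_prop) ⟨(n * C) ^ 2, fun ω => by
        rw [abs_pow]; exact pow_le_pow_left₀ (abs_nonneg _) (hSb n ω) 2⟩
      have i2 : Integrable (fun ω => 2 * (S n ω * Z n ω)) P :=
        (hbint _ (by fun_prop) ⟨(n * C) * C, fun ω => by
          rw [abs_mul]
          exact mul_le_mul (hSb n ω) (hC n ω) (abs_nonneg _) (by positivity)⟩).const_mul 2
      simp_rw [e]
      have i12 : Integrable (fun ω => S n ω ^ 2 + 2 * (S n ω * Z n ω)) P := i1.add i2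
      rw [integral_add i12 (hZi n n), integral_add i1 i2, integral_const_mul, hSZ]
      have : ∫ ω, Z n ω * Z n ω ∂P ≤ C ^ 2 := by
        calc ∫ ω, Z n ω * Z n ω ∂P ≤ ∫ ω, C ^ 2 ∂P :=
              integral_mono (hZi n n) (integrable_const _) fun ω => by
                have := abs_le.1 (hC n ω); nlinarith
          _ = C ^ 2 := by simp
      push_cast
      linarith
  -- along the squares
  have hsq : ∀ᵐ ω ∂P, Tendsto (fun n : ℕ => S ((n + 1) ^ 2) ω / ((n : ℝ) + 1) ^ 2) atTop (𝓝 0) := by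
    set q : ℕ → Ω → ENNReal := fun n ω => ENNReal.ofReal ((S ((n + 1) ^ 2) ω / ((n : ℝ) + 1) ^ 2) ^ 2)
      with hq
    have hqm : ∀ n, Measurable (q n) := fun n => by
      have := hSm ((n + 1) ^ 2)
      simp only [hq]; fun_prop
    have hfin : ∫⁻ ω, ∑' n, q n ω ∂P ≠ ⊤ := by
      rw [lintegral_tsum fun n => (hqm n).aemeasurable]
      have hle : ∀ n, ∫⁻ ω, q n ω ∂P ≤ ENNReal.ofReal (C ^ 2 * (1 / ((n : ℝ) + 1) ^ 2)) := by
        intro n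
        rw [← ofReal_integral_eq_lintegral_ofReal]
        · apply ENNReal.ofReal_le_ofReal
          simp_rw [div_pow]
          rw [integral_div, div_le_iff₀ (by positivity)]
          refine (hSS _).trans (le_of_eq ?_)
          push_cast
          field_simp
        · refine hbint _ ?_ ⟨((((n + 1) ^ 2 : ℕ) : ℝ) * C / ((n : ℝ) + 1) ^ 2) ^ 2, fun ω => ?_⟩
          · have := hSm ((n + 1) ^ 2); fun_prop
          · rw [abs_pow, abs_div, abs_of_pos (show (0 : ℝ) < ((n : ℝ) + 1) ^ 2 by positivity)]
            gcongr
            exact hSb _ ω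
        · exact Eventually.of_forall fun ω => sq_nonneg _
      refine ne_top_of_le_ne_top ?_ (ENNReal.tsum_le_tsum hle)
      have hs : Summable fun n : ℕ => C ^ 2 * (1 / ((n : ℝ) + 1) ^ 2) := by
        have := (summable_nat_add_iff 1).2 (Real.summable_one_div_nat_pow.2 (one_lt_two))
        exact (by simpa using this : Summable fun n : ℕ => 1 / ((n : ℝ) + 1) ^ 2).mul_left _
      exact hs.tsum_ofReal_ne_top
    filter_upwards [ae_lt_top (Measurable.tsum hqm) hfin] with ω hω
    have h0 := ENNReal.tendsto_atTop_zero_of_tsum_ne_top hω.ne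
    have h1 := (ENNReal.tendsto_toReal ENNReal.zero_ne_top).comp h0
    simp only [Function.comp_def, hq, ENNReal.toReal_zero] at h1
    simp_rw [ENNReal.toReal_ofReal (sq_nonneg _)] at h1
    have h2 := h1.sqrt
    simp only [Real.sqrt_sq_eq_abs, Real.sqrt_zero] at h2
    exact (tendsto_zero_iff_abs_tendsto_zero _).2 h2
  filter_upwards [hsq] with ω hω
  -- a number `n ≥ 1` lies between two consecutive squares
  have hsqrt : Tendsto (fun n : ℕ => Nat.sqrt n - 1) atTop atTop := by
    refine tendsto_atTop.2 fun b => ?_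
    filter_upwards [eventually_ge_atTop ((b + 1) ^ 2)] with n hn
    have : b + 1 ≤ Nat.sqrt n := Nat.le_sqrt'.2 hn
    omega
  have h3 := (hω.comp hsqrt).abs
  have h4 : Tendsto (fun n : ℕ => 2 * C / ((Nat.sqrt n - 1 : ℕ) + 1 : ℝ)) atTop (𝓝 0) := by
    have := (tendsto_const_div_atTop_nhds_zero_nat (2 * C)).comp
      ((tendsto_add_atTop_nat 1).comp hsqrt)
    refine this.congr fun n => ?_
    simp
  rw [tendsto_zero_iff_abs_tendsto_zero]
  have h5 := h3.add h4
  simp only [abs_zero, add_zero] at h5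
  refine tendsto_of_tendsto_of_tendsto_of_le_of_le' tendsto_const_nhds h5
    (Eventually.of_forall fun n => abs_nonneg _) ?_
  filter_upwards [eventually_ge_atTop 1] with n hn
  have hk : 1 ≤ Nat.sqrt n := Nat.le_sqrt'.2 (by simpa using hn)
  obtain ⟨k, hk'⟩ : ∃ k, Nat.sqrt n = k + 1 := ⟨Nat.sqrt n - 1, by omega⟩
  simp only [Function.comp_def, hk', Nat.add_sub_cancel]
  have hle : (k + 1) ^ 2 ≤ n := hk' ▸ Nat.sqrt_le' n
  have hlt : n < (k + 2) ^ 2 := by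
    have := Nat.sqrt_lt'.1 (show Nat.sqrt n < k + 2 by omega)
    exact this
  have hdiff : |S n ω - S ((k + 1) ^ 2) ω| ≤ (2 * (k + 1)) * C := by
    have e : S n ω - S ((k + 1) ^ 2) ω = ∑ i ∈ Finset.Ico ((k + 1) ^ 2) n, Z i ω := by
      simp only [hS]
      rw [Finset.sum_Ico_eq_sub _ hle]
    rw [e]
    refine (Finset.abs_sum_le_sum_abs _ _).trans ?_
    refine (Finset.sum_le_sum fun i _ => hC i ω).trans ?_
    rw [Finset.sum_const, nsmul_eq_mul, Nat.card_Ico]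
    refine mul_le_mul_of_nonneg_right ?_ hC0
    have : n - (k + 1) ^ 2 ≤ 2 * (k + 1) := by
      have : (k + 2) ^ 2 = (k + 1) ^ 2 + 2 * (k + 1) + 1 := by ring
      omega
    exact_mod_cast this
  have hn0 : (0 : ℝ) < n := by exact_mod_cast hn
  have hleR : ((k : ℝ) + 1) ^ 2 ≤ n := by exact_mod_cast hle
  rw [abs_div, abs_div, abs_of_pos hn0, abs_of_pos (show (0 : ℝ) < ((k : ℝ) + 1) ^ 2 by positivity)]
  have hb : |S n ω| ≤ |S ((k + 1) ^ 2) ω| + 2 * (k + 1) * C := by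
    have := abs_sub_abs_le_abs_sub (S n ω) (S ((k + 1) ^ 2) ω)
    linarith
  calc |S n ω| / n ≤ (|S ((k + 1) ^ 2) ω| + 2 * (k + 1) * C) / ((k : ℝ) + 1) ^ 2 := by
        gcongr
    _ = _ := by field_simp

section Chain

variable {E : Type*}

/-- The random dynamical system `X_{n+1} = φ(τ_n, X_n)`, `X_0 = x`, driven by the sequence `τ`. -/
def chain (φ : ℝ → E → E) (τ : ℕ → ℝ) (x : E) : ℕ → E
  | 0 => x
  | n + 1 => φ (τ n) (chain φ τ x n)

/-- The `n`-fold composition `φ(s_{n-1}, ·) ∘ ⋯ ∘ φ(s_0, ·)`. -/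
def wordMap (φ : ℝ → E → E) : (n : ℕ) → (Fin n → ℝ) → E → E
  | 0, _, x => x
  | n + 1, s, x => φ (s (Fin.last n)) (wordMap φ n (fun i => s i.castSucc) x)

theorem chain_eq_wordMap (φ : ℝ → E → E) (τ : ℕ → ℝ) (x : E) (n : ℕ) :
    chain φ τ x n = wordMap φ n (fun i => τ i) x := by
  induction n with
  | zero => rfl
  | succ n ih => simp [chain, wordMap, ih]

variable [MeasurableSpace E]

/-- The transition operator `(P g)(x) = ∫ g(φ(s, x)) dν(s)` of the chain. -/
noncomputable def transition (φ : ℝ → E → E) (ν : Measure ℝ) (g : E → ℝ) (x : E) : ℝ :=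
  ∫ s, g (φ s x) ∂ν

theorem measurable_wordMap {φ : ℝ → E → E} (hφ : Measurable fun p : ℝ × E => φ p.1 p.2) (n : ℕ) :
    Measurable fun p : (Fin n → ℝ) × E => wordMap φ n p.1 p.2 := by
  induction n with
  | zero => exact measurable_snd
  | succ n ih =>
    have h1 : Measurable fun p : (Fin (n + 1) → ℝ) × E =>
        wordMap φ n (fun i => p.1 i.castSucc) p.2 :=
      ih.comp (Measurable.prodMk (by fun_prop) measurable_snd)
    exact hφ.comp (Measurable.prodMk (by fun_prop) h1)

omit [MeasurableSpace E] in
theorem wordMap_mem {φ : ℝ → E → E} {K : Set E} (hK : ∀ s, ∀ x ∈ K, φ s x ∈ K) (n : ℕ)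
    (s : Fin n → ℝ) {x : E} (hx : x ∈ K) : wordMap φ n s x ∈ K := by
  induction n with
  | zero => exact hx
  | succ n ih => exact hK _ _ (ih _)

variable {φ : ℝ → E → E} {ν : Measure ℝ} [IsProbabilityMeasure ν]

theorem abs_integral_le_of_bound {α : Type*} [MeasurableSpace α] {μ : Measure α}
    [IsProbabilityMeasure μ] {f : α → ℝ} {C : ℝ} (hC : ∀ x, |f x| ≤ C) : |∫ x, f x ∂μ| ≤ C := by
  have := norm_integral_le_of_norm_le_const (μ := μ) (f := f) (C := C) (Eventually.of_forall hC)
  simpa using this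

theorem measurable_transition (hφ : Measurable fun p : ℝ × E => φ p.1 p.2) {g : E → ℝ}
    (hg : Measurable g) : Measurable (transition φ ν g) := by
  have : StronglyMeasurable fun p : E × ℝ => g (φ p.2 p.1) :=
    (hg.comp (hφ.comp measurable_swap)).stronglyMeasurable
  exact this.integral_prod_right.measurable

omit [MeasurableSpace E] in
theorem abs_transition_le {g : E → ℝ} {C : ℝ} (hC : ∀ x, |g x| ≤ C) (x : E) :
    |transition φ ν g x| ≤ C :=
  abs_integral_le_of_bound fun _ => hC _

theorem measurable_iterate_transition (hφ : Measurable fun p : ℝ × E => φ p.1 p.2) {g : E → ℝ}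
    (hg : Measurable g) (n : ℕ) : Measurable ((transition φ ν)^[n] g) := by
  induction n with
  | zero => exact hg
  | succ n ih => rw [Function.iterate_succ_apply']; exact measurable_transition hφ ih

omit [MeasurableSpace E] in
theorem abs_iterate_transition_le {g : E → ℝ} {C : ℝ} (hC : ∀ x, |g x| ≤ C) (n : ℕ) (x : E) :
    |(transition φ ν)^[n] g x| ≤ C := by
  induction n generalizing x with
  | zero => exact hC x
  | succ n ih => rw [Function.iterate_succ_apply']; exact abs_transition_le ih x

variable {Ω : Type*} [MeasurableSpace Ω] {P : Measure Ω} [IsProbabilityMeasure P]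
  {τ : ℕ → Ω → ℝ}

omit [IsProbabilityMeasure ν] in
/-- The first `k` gaps are independent of the gap with index `k`. -/
theorem map_gaps_prod (hτ : ∀ n, Measurable (τ n)) (hind : iIndepFun τ P)
    (hlaw : ∀ n, P.map (τ n) = ν) (k : ℕ) :
    P.map (fun ω => ((fun i : Fin k => τ i ω), τ k ω)) =
      (P.map fun ω => fun i : Fin k => τ i ω).prod ν := by
  have h := hind.indepFun_finset (Finset.range k) {k} (by simp) hτ
  have h2 : IndepFun (fun ω => fun i : Fin k => τ i ω) (τ k) P := by
    have hψ : Measurable fun u : (({k} : Finset ℕ) → ℝ) => u ⟨k, Finset.mem_singleton_self k⟩ :=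
      measurable_pi_apply _
    have := h.comp (φ := fun u : (Finset.range k → ℝ) => fun i : Fin k =>
        u ⟨i, Finset.mem_range.2 i.2⟩)
      (by fun_prop) hψ
    exact this
  rw [(indepFun_iff_map_prod_eq_prod_map_map (by fun_prop) (hτ k).aemeasurable).1 h2, hlaw]

omit [IsProbabilityMeasure ν] in
theorem map_gaps_eq_pi (hτ : ∀ n, Measurable (τ n)) (hind : iIndepFun τ P)
    (hlaw : ∀ n, P.map (τ n) = ν) (k : ℕ) :
    (P.map fun ω => fun i : Fin k => τ i ω) = Measure.pi fun _ => ν := by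
  have h := hind.precomp (g := fun i : Fin k => (i : ℕ)) Fin.val_injective
  rw [(iIndepFun_iff_map_fun_eq_pi_map fun i => (hτ _).aemeasurable).1 h]
  simp [hlaw]

/-- Conditioning on the first `k` gaps: the gap with index `k` may be integrated out. -/
theorem integral_gaps (hτ : ∀ n, Measurable (τ n)) (hind : iIndepFun τ P)
    (hlaw : ∀ n, P.map (τ n) = ν) (k : ℕ) {Φ : (Fin k → ℝ) × ℝ → ℝ} (hΦ : Measurable Φ) {C : ℝ}
    (hC : ∀ p, |Φ p| ≤ C) :
    ∫ ω, Φ ((fun i : Fin k => τ i ω), τ k ω) ∂P =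
      ∫ ω, (∫ s, Φ ((fun i : Fin k => τ i ω), s) ∂ν) ∂P := by
  have hm1 : Measurable fun ω => ((fun i : Fin k => τ i ω), τ k ω) := by fun_prop
  have hm2 : Measurable fun ω => (fun i : Fin k => τ i ω) := by fun_prop
  have : IsProbabilityMeasure (P.map fun ω => fun i : Fin k => τ i ω) :=
    Measure.isProbabilityMeasure_map hm2.aemeasurable
  rw [← integral_map hm1.aemeasurable hΦ.aestronglyMeasurable, map_gaps_prod hτ hind hlaw,
    integral_prod _ (Integrable.of_bound hΦ.aestronglyMeasurable C (Eventually.of_forall hC)),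
    integral_map hm2.aemeasurable]
  exact (StronglyMeasurable.integral_prod_right (f := fun u s => Φ (u, s))
    hΦ.stronglyMeasurable).aestronglyMeasurable

/-- Markov property in expectation. -/
theorem integral_chain (hφ : Measurable fun p : ℝ × E => φ p.1 p.2) (hτ : ∀ n, Measurable (τ n))
    (hind : iIndepFun τ P) (hlaw : ∀ n, P.map (τ n) = ν) (x : E) (n : ℕ) {g : E → ℝ}
    (hg : Measurable g) {C : ℝ} (hC : ∀ x, |g x| ≤ C) :
    ∫ ω, g (chain φ (fun i => τ i ω) x n) ∂P = (transition φ ν)^[n] g x := by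
  induction n generalizing g with
  | zero => simp [chain]
  | succ n ih =>
    rw [Function.iterate_succ_apply, ← ih (measurable_transition hφ hg) (abs_transition_le hC)]
    have hw : Measurable fun s : Fin n → ℝ => wordMap φ n s x :=
      (measurable_wordMap hφ n).comp (Measurable.prodMk measurable_id measurable_const)
    have := integral_gaps hτ hind hlaw n (Φ := fun p => g (φ p.2 (wordMap φ n p.1 x)))
      (hg.comp (hφ.comp (Measurable.prodMk measurable_snd (hw.comp measurable_fst))))
      (fun p => hC _)
    simpa only [chain, chain_eq_wordMap, transition] using this

theorem measurable_chain (hφ : Measurable fun p : ℝ × E => φ p.1 p.2) (hτ : ∀ n, Measurable (τ n))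
    (x : E) (n : ℕ) : Measurable fun ω => chain φ (fun i => τ i ω) x n := by
  simp only [chain_eq_wordMap]
  exact (measurable_wordMap hφ n).comp (Measurable.prodMk (by fun_prop) measurable_const)

/-- The strong law for the martingale differences `G(X_n, τ_n)`, where `G` has mean zero in its
second variable. -/
theorem ae_tendsto_average_zero_of_centred (hφ : Measurable fun p : ℝ × E => φ p.1 p.2)
    (hτ : ∀ n, Measurable (τ n)) (hind : iIndepFun τ P) (hlaw : ∀ n, P.map (τ n) = ν) (x : E)
    {G : E × ℝ → ℝ} (hG : Measurable G) {C : ℝ} (hC : ∀ p, |G p| ≤ C)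
    (h0 : ∀ y, ∫ s, G (y, s) ∂ν = 0) :
    ∀ᵐ ω ∂P, Tendsto (fun n : ℕ =>
      (∑ i ∈ Finset.range n, G (chain φ (fun i => τ i ω) x i, τ i ω)) / n) atTop (𝓝 0) := by
  have hC0 : 0 ≤ C := (abs_nonneg _).trans (hC (x, 0))
  refine ae_tendsto_average_zero_of_orthogonal
    (fun i ω => G (chain φ (fun i => τ i ω) x i, τ i ω))
    (fun n => hG.comp ((measurable_chain hφ hτ x n).prodMk (hτ n))) (fun n ω => hC _) ?_
  intro i j hij
  simp only [chain_eq_wordMap]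
  have hw : ∀ n, Measurable fun s : Fin n → ℝ => wordMap φ n s x := fun n =>
    (measurable_wordMap hφ n).comp (Measurable.prodMk measurable_id measurable_const)
  have h1 : Measurable fun u : Fin j → ℝ =>
      G (wordMap φ i (fun a => u ⟨a, a.2.trans hij⟩) x, u ⟨i, hij⟩) :=
    hG.comp (((hw i).comp (by fun_prop)).prodMk (by fun_prop))
  have h2 : Measurable fun p : (Fin j → ℝ) × ℝ => G (wordMap φ j p.1 x, p.2) :=
    hG.comp (((hw j).comp measurable_fst).prodMk measurable_snd)
  have := integral_gaps hτ hind hlaw j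
    (Φ := fun p => G (wordMap φ i (fun a => p.1 ⟨a, a.2.trans hij⟩) x, p.1 ⟨i, hij⟩) *
      G (wordMap φ j p.1 x, p.2)) ((h1.comp measurable_fst).mul h2) (C := C * C) (fun p => by
        rw [abs_mul]; exact mul_le_mul (hC _) (hC _) (abs_nonneg _) hC0)
  rw [this]
  simp only [integral_const_mul, h0, mul_zero, integral_zero]

end Chain

end FlipDynamics

/-! ### Uniform convergence from a local Doeblin condition -/

namespace FlipDynamics

section Averages

variable {E : Type*} [MeasurableSpace E] {φ : ℝ → E → E} {ν : Measure ℝ} [IsProbabilityMeasure ν]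

theorem iterate_transition_eq_integral (hφ : Measurable fun p : ℝ × E => φ p.1 p.2) (n : ℕ)
    {g : E → ℝ} (hg : Measurable g) {C : ℝ} (hC : ∀ x, |g x| ≤ C) (x : E) :
    (transition φ ν)^[n] g x = ∫ s, g (wordMap φ n s x) ∂(Measure.pi fun _ : Fin n => ν) := by
  have hm : ∀ n : ℕ, Measurable fun ω : ℕ → ℝ => ω n := fun n => measurable_pi_apply n
  have hind : iIndepFun (fun (n : ℕ) (ω : ℕ → ℝ) => ω n) (Measure.infinitePi fun _ : ℕ => ν) :=
    iIndepFun_infinitePi (P := fun _ : ℕ => ν) (X := fun _ (t : ℝ) => t) fun _ => measurable_id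
  have hlaw : ∀ n : ℕ, (Measure.infinitePi fun _ : ℕ => ν).map (fun ω : ℕ → ℝ => ω n) = ν :=
    fun n => Measure.infinitePi_map_eval (fun _ : ℕ => ν) n
  have hw : Measurable fun s : Fin n → ℝ => wordMap φ n s x :=
    (measurable_wordMap hφ n).comp (Measurable.prodMk measurable_id measurable_const)
  rw [← integral_chain hφ hm hind hlaw x n hg hC, ← map_gaps_eq_pi hm hind hlaw,
    integral_map (measurable_pi_lambda _ fun i : Fin n => hm i).aemeasurable
      (show AEStronglyMeasurable (fun s => g (wordMap φ n s x)) _ from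
        (hg.comp hw).aestronglyMeasurable)]
  simp only [chain_eq_wordMap]

/-- The Cesàro averages of the iterates of the transition operator. -/
noncomputable def cesaro (φ : ℝ → E → E) (ν : Measure ℝ) (g : E → ℝ) (L : ℕ) (x : E) : ℝ :=
  (∑ k ∈ Finset.range L, (transition φ ν)^[k] g x) / L

theorem measurable_cesaro (hφ : Measurable fun p : ℝ × E => φ p.1 p.2) {g : E → ℝ}
    (hg : Measurable g) (L : ℕ) : Measurable (cesaro φ ν g L) :=
  (Finset.measurable_sum _ fun k _ => measurable_iterate_transition hφ hg k).div_const _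

omit [MeasurableSpace E] in
theorem abs_cesaro_le {g : E → ℝ} {C : ℝ} (hC : ∀ x, |g x| ≤ C) (L : ℕ) (x : E) :
    |cesaro φ ν g L x| ≤ C := by
  have hC0 : 0 ≤ C := (abs_nonneg _).trans (hC x)
  rcases Nat.eq_zero_or_pos L with rfl | hL
  · simpa [cesaro] using hC0
  · have hL' : (0 : ℝ) < L := by exact_mod_cast hL
    rw [cesaro, abs_div, abs_of_pos hL', div_le_iff₀ hL']
    refine (Finset.abs_sum_le_sum_abs _ _).trans ?_
    refine (Finset.sum_le_sum fun i _ => abs_iterate_transition_le hC i x).trans ?_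
    simp [mul_comm]

theorem iterate_transition_cesaro (hφ : Measurable fun p : ℝ × E => φ p.1 p.2) {g : E → ℝ}
    (hg : Measurable g) {C : ℝ} (hC : ∀ x, |g x| ≤ C) (n L : ℕ) (x : E) :
    (transition φ ν)^[n] (cesaro φ ν g L) x =
      (∑ k ∈ Finset.range L, (transition φ ν)^[k + n] g x) / L := by
  have hw : Measurable fun s : Fin n → ℝ => wordMap φ n s x :=
    (measurable_wordMap hφ n).comp (Measurable.prodMk measurable_id measurable_const)
  rw [iterate_transition_eq_integral hφ n (measurable_cesaro hφ hg L) (abs_cesaro_le hC L)]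
  simp only [cesaro]
  rw [integral_div, integral_finsetSum]
  · congr 1
    refine Finset.sum_congr rfl fun k _ => ?_
    rw [add_comm, Function.iterate_add_apply, iterate_transition_eq_integral hφ n
      (measurable_iterate_transition hφ hg k) (abs_iterate_transition_le hC k)]
  · intro k _
    exact Integrable.of_bound
      ((measurable_iterate_transition hφ hg k).comp hw).aestronglyMeasurable C
      (Eventually.of_forall fun s => abs_iterate_transition_le hC k _)

/-- Cesàro averages are almost invariant under the transition operator, by telescoping. -/
theorem abs_cesaro_sub_iterate_le (hφ : Measurable fun p : ℝ × E => φ p.1 p.2) {g : E → ℝ}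
    (hg : Measurable g) {C : ℝ} (hC : ∀ x, |g x| ≤ C) (n L : ℕ) (x : E) :
    |cesaro φ ν g L x - (transition φ ν)^[n] (cesaro φ ν g L) x| ≤ 2 * n * C / L := by
  rw [iterate_transition_cesaro hφ hg hC, cesaro, ← sub_div, abs_div, Nat.abs_cast]
  refine div_le_div_of_nonneg_right ?_ (Nat.cast_nonneg L)
  set f : ℕ → ℝ := fun k => (transition φ ν)^[k] g x
  have e : ∑ k ∈ Finset.range L, f k - ∑ k ∈ Finset.range L, f (k + n) =
      ∑ k ∈ Finset.range n, f k - ∑ k ∈ Finset.range n, f (L + k) := by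
    have h1 := Finset.sum_range_add f L n
    have h2 := Finset.sum_range_add f n L
    rw [add_comm n L] at h2
    simp only [add_comm _ n]
    linarith
  have hb : ∀ k, |f k| ≤ C := fun k => abs_iterate_transition_le hC k x
  have hs : ∀ h : ℕ → ℝ, (∀ k, |h k| ≤ C) → |∑ k ∈ Finset.range n, h k| ≤ n * C := fun h hh => by
    refine (Finset.abs_sum_le_sum_abs _ _).trans ?_
    refine (Finset.sum_le_sum fun i _ => hh i).trans ?_
    simp
  rw [e]
  have h1 := hs f hb
  have h2 := hs (fun k => f (L + k)) fun k => hb _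
  have := abs_sub (∑ k ∈ Finset.range n, f k) (∑ k ∈ Finset.range n, f (L + k))
  linarith

/-- Doeblin's argument. Suppose that from every point of the invariant set `K`, after a bounded
number of steps, the chain avoids each `π`-small set with a probability bounded below. Then
convergence of the Cesàro averages in `π`-measure upgrades to uniform convergence on `K`. -/
theorem exists_cesaro_uniform (hφ : Measurable fun p : ℝ × E => φ p.1 p.2) {K : Set E}
    (hK : ∀ s, ∀ x ∈ K, φ s x ∈ K) {π : Measure E} {ε : ℝ} (hε : 0 < ε) {δ : ENNReal}
    (hδ : 0 < δ) {nmax : ℕ}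
    (hD : ∀ y ∈ K, ∃ n ≤ nmax, ∀ B : Set E, MeasurableSet B → π B ≤ δ →
      (Measure.pi fun _ : Fin n => ν).real {s | wordMap φ n s y ∈ B} ≤ 1 - ε)
    {g : E → ℝ} (hg : Measurable g) {C : ℝ} (hC : ∀ x, |g x| ≤ C) {c : ℝ}
    (hconv : ∀ η > 0, Tendsto (fun L => π {x | η < |cesaro φ ν g L x - c|}) atTop (𝓝 0))
    {η : ℝ} (hη : 0 < η) : ∃ L, 0 < L ∧ ∀ y ∈ K, |cesaro φ ν g L y - c| ≤ η := by
  have h1 : ∀ᶠ L : ℕ in atTop, π {x | ε * η / 2 < |cesaro φ ν g L x - c|} ≤ δ :=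
    (hconv (ε * η / 2) (by positivity)).eventually_le_const hδ
  have h2 : ∀ᶠ L : ℕ in atTop, 2 * nmax * C / (L : ℝ) ≤ ε * η / 2 :=
    (tendsto_const_div_atTop_nhds_zero_nat (2 * nmax * C)).eventually_le_const (by positivity)
  obtain ⟨L, hL1, hL2, hL0⟩ := (h1.and (h2.and (eventually_gt_atTop 0))).exists
  refine ⟨L, hL0, ?_⟩
  set a : E → ℝ := fun x => cesaro φ ν g L x - c with ha
  have ham : Measurable a := (measurable_cesaro hφ hg L).sub_const c
  have hab : ∀ x, |a x| ≤ C + |c| := fun x =>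
    (abs_sub _ _).trans (add_le_add_left (abs_cesaro_le hC L x) _)
  set B : Set E := {x | ε * η / 2 < |a x|} with hB
  have hBm : MeasurableSet B := measurableSet_lt measurable_const ham.abs
  -- a uniform bound `s` improves to `(1 - ε) s + ε η`
  have key : ∀ s : ℝ, (∀ y ∈ K, |a y| ≤ s) → ∀ y ∈ K, |a y| ≤ ε * η + (1 - ε) * s := by
    intro s hs y hy
    have hs0 : 0 ≤ s := (abs_nonneg _).trans (hs y hy)
    obtain ⟨n, hn, hDn⟩ := hD y hy
    set m := Measure.pi fun _ : Fin n => ν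
    have hw : Measurable fun s : Fin n → ℝ => wordMap φ n s y :=
      (measurable_wordMap hφ n).comp (Measurable.prodMk measurable_id measurable_const)
    have hWB : MeasurableSet {s | wordMap φ n s y ∈ B} := hw hBm
    have hint : Integrable (fun s => a (wordMap φ n s y)) m :=
      Integrable.of_bound (ham.comp hw).aestronglyMeasurable _ (Eventually.of_forall fun s => hab _)
    have hint' : Integrable (fun s => cesaro φ ν g L (wordMap φ n s y)) m :=
      Integrable.of_bound ((measurable_cesaro hφ hg L).comp hw).aestronglyMeasurable C
        (Eventually.of_forall fun s => abs_cesaro_le hC L _)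
    have e1 : a y = (cesaro φ ν g L y - (transition φ ν)^[n] (cesaro φ ν g L) y) +
        ∫ s, a (wordMap φ n s y) ∂m := by
      rw [iterate_transition_eq_integral hφ n (measurable_cesaro hφ hg L) (abs_cesaro_le hC L)]
      simp only [ha]
      rw [integral_sub hint' (integrable_const _), integral_const, probReal_univ, one_smul]
      ring
    have e2 : |cesaro φ ν g L y - (transition φ ν)^[n] (cesaro φ ν g L) y| ≤ ε * η / 2 := by
      have hC0 : 0 ≤ C := (abs_nonneg _).trans (hC y)
      refine (abs_cesaro_sub_iterate_le hφ hg hC n L y).trans (le_trans ?_ hL2)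
      gcongr
    have e3 : |∫ s, a (wordMap φ n s y) ∂m| ≤ ε * η / 2 + s * (1 - ε) := by
      calc |∫ s, a (wordMap φ n s y) ∂m| ≤ ∫ s, |a (wordMap φ n s y)| ∂m :=
            abs_integral_le_integral_abs
        _ ≤ ∫ t, (ε * η / 2 + {t | wordMap φ n t y ∈ B}.indicator (fun _ => s) t) ∂m := by
            refine integral_mono hint.abs ((integrable_const _).add
              ((integrable_const s).indicator hWB)) fun t => ?_
            by_cases ht : wordMap φ n t y ∈ B
            · have := hs _ (wordMap_mem hK n t hy)
              simp only [Set.indicator, Set.mem_ofPred_eq, ht, if_true]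
              have : 0 < ε * η / 2 := by positivity
              linarith
            · simp only [Set.indicator, Set.mem_ofPred_eq, ht, if_false, add_zero]
              exact not_lt.1 ht
        _ = ε * η / 2 + m.real {t | wordMap φ n t y ∈ B} * s := by
            rw [integral_add (integrable_const _) ((integrable_const s).indicator hWB),
              integral_indicator_const s hWB]
            simp
        _ ≤ ε * η / 2 + s * (1 - ε) := by
            have := mul_le_mul_of_nonneg_right (hDn B hBm hL1) hs0
            linarith
    rw [e1]
    have := abs_add_le (cesaro φ ν g L y - (transition φ ν)^[n] (cesaro φ ν g L) y)
      (∫ s, a (wordMap φ n s y) ∂m)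
    linarith
  intro y hy
  have hbdd : BddAbove ((fun x => |a x|) '' K) := ⟨C + |c|, by rintro _ ⟨x, _, rfl⟩; exact hab x⟩
  have hle : ∀ y ∈ K, |a y| ≤ sSup ((fun x => |a x|) '' K) := fun y hy =>
    le_csSup hbdd ⟨y, hy, rfl⟩
  have hsup : sSup ((fun x => |a x|) '' K) ≤ ε * η + (1 - ε) * sSup ((fun x => |a x|) '' K) :=
    csSup_le ⟨_, y, hy, rfl⟩ (by rintro _ ⟨x, hx, rfl⟩; exact key _ hle x hx)
  have : ε * sSup ((fun x => |a x|) '' K) ≤ ε * η := by linarith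
  exact (hle y hy).trans (le_of_mul_le_mul_left this hε)

variable {Ω : Type*} [MeasurableSpace Ω] {P : Measure Ω} [IsProbabilityMeasure P]
  {τ : ℕ → Ω → ℝ}

/-- The averages of `u` and of its image under the transition operator along the chain are
asymptotically equal: the increments `u(X_{i+1}) - (P u)(X_i)` are martingale differences, and the
remaining terms telescope. -/
theorem ae_tendsto_average_sub_transition (hφ : Measurable fun p : ℝ × E => φ p.1 p.2)
    (hτ : ∀ n, Measurable (τ n)) (hind : iIndepFun τ P) (hlaw : ∀ n, P.map (τ n) = ν) (x : E)
    {u : E → ℝ} (hu : Measurable u) {C : ℝ} (hC : ∀ y, |u y| ≤ C) :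
    ∀ᵐ ω ∂P, Tendsto (fun n : ℕ => (∑ i ∈ Finset.range n,
      (u (chain φ (fun i => τ i ω) x i) - transition φ ν u (chain φ (fun i => τ i ω) x i))) / n)
      atTop (𝓝 0) := by
  have hG : Measurable fun p : E × ℝ => u (φ p.2 p.1) - transition φ ν u p.1 :=
    (hu.comp (hφ.comp measurable_swap)).sub ((measurable_transition hφ hu).comp measurable_fst)
  have h := ae_tendsto_average_zero_of_centred hφ hτ hind hlaw x hG (C := C + C)
    (fun p => (abs_sub _ _).trans (add_le_add (hC _) (abs_transition_le hC _))) (fun y => by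
      have : Measurable fun s => φ s y := hφ.comp (Measurable.prodMk measurable_id measurable_const)
      have hi : Integrable (fun s => u (φ s y)) ν := Integrable.of_bound
        (hu.comp this).aestronglyMeasurable C (Eventually.of_forall fun s => hC _)
      change ∫ s, (u (φ s y) - transition φ ν u y) ∂ν = 0
      rw [integral_sub hi (integrable_const _)]
      simp [transition])
  filter_upwards [h] with ω hω
  set X := chain φ (fun i => τ i ω) x with hX
  have hb : Tendsto (fun n : ℕ => (u (X 0) - u (X n)) / n) atTop (𝓝 0) := by
    refine squeeze_zero_norm (fun n => ?_) (tendsto_const_div_atTop_nhds_zero_nat (C + C))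
    rw [norm_div, Real.norm_natCast]
    exact div_le_div_of_nonneg_right ((abs_sub _ _).trans (add_le_add (hC _) (hC _)))
      (Nat.cast_nonneg n)
  have := hω.add hb
  rw [add_zero] at this
  refine this.congr fun n => ?_
  rw [← add_div]
  congr 1
  rw [← Finset.sum_range_sub' (fun i => u (X i)), ← Finset.sum_add_distrib]
  refine Finset.sum_congr rfl fun i _ => ?_
  simp only [hX, chain]
  ring

theorem ae_tendsto_average_sub_iterate (hφ : Measurable fun p : ℝ × E => φ p.1 p.2)
    (hτ : ∀ n, Measurable (τ n)) (hind : iIndepFun τ P) (hlaw : ∀ n, P.map (τ n) = ν) (x : E)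
    {u : E → ℝ} (hu : Measurable u) {C : ℝ} (hC : ∀ y, |u y| ≤ C) (k : ℕ) :
    ∀ᵐ ω ∂P, Tendsto (fun n : ℕ => (∑ i ∈ Finset.range n,
      (u (chain φ (fun i => τ i ω) x i) -
        (transition φ ν)^[k] u (chain φ (fun i => τ i ω) x i))) / n) atTop (𝓝 0) := by
  induction k with
  | zero => simp
  | succ k ih =>
    filter_upwards [ih, ae_tendsto_average_sub_transition hφ hτ hind hlaw x
      (measurable_iterate_transition (ν := ν) hφ hu k)
      (abs_iterate_transition_le (ν := ν) hC k)] with ω h1 h2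
    have := h1.add h2
    rw [add_zero] at this
    refine this.congr fun n => ?_
    rw [← add_div, ← Finset.sum_add_distrib]
    congr 1
    refine Finset.sum_congr rfl fun i _ => ?_
    rw [Function.iterate_succ_apply']
    ring

/-- If the Cesàro averages of `g` come uniformly close to the constant `c` on the invariant set
`K`, then the averages of `g` along the chain converge to `c` from every starting point in `K`.
For a fixed length `L`, the averages of `g` and of its Cesàro average are asymptotically equal. -/
theorem ae_tendsto_average_of_cesaro (hφ : Measurable fun p : ℝ × E => φ p.1 p.2) {K : Set E}
    (hK : ∀ s, ∀ x ∈ K, φ s x ∈ K)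
    (hτ : ∀ n, Measurable (τ n)) (hind : iIndepFun τ P) (hlaw : ∀ n, P.map (τ n) = ν) {x : E}
    (hx : x ∈ K) {g : E → ℝ} (hg : Measurable g) {C : ℝ} (hC : ∀ y, |g y| ≤ C) {c : ℝ}
    (hces : ∀ η > 0, ∃ L, 0 < L ∧ ∀ y ∈ K, |cesaro φ ν g L y - c| ≤ η) :
    ∀ᵐ ω ∂P, Tendsto (fun n : ℕ =>
      (∑ i ∈ Finset.range n, g (chain φ (fun i => τ i ω) x i)) / n) atTop (𝓝 c) := by
  have h := fun k : ℕ => ae_tendsto_average_sub_iterate (ν := ν) (P := P) hφ hτ hind hlaw x hg hC k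
  filter_upwards [ae_all_iff.2 h] with ω hω
  set X := chain φ (fun i => τ i ω) x with hX
  have hXK : ∀ i, X i ∈ K := fun i => by
    rw [hX, chain_eq_wordMap]; exact wordMap_mem hK i _ hx
  rw [Metric.tendsto_atTop]
  intro η hη
  obtain ⟨L, hL, hLK⟩ := hces (η / 2) (by positivity)
  have hL' : (L : ℝ) ≠ 0 := by exact_mod_cast hL.ne'
  have hsum : Tendsto (fun n : ℕ => (∑ k ∈ Finset.range L, (∑ i ∈ Finset.range n,
      (g (X i) - (transition φ ν)^[k] g (X i))) / n) / L) atTop (𝓝 0) := by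
    have := (tendsto_finsetSum (Finset.range L) fun k _ => hω k).div_const (L : ℝ)
    simpa using this
  obtain ⟨n₀, hn₀⟩ := Metric.tendsto_atTop.1 hsum (η / 2) (by positivity)
  refine ⟨n₀ + 1, fun n hn => ?_⟩
  have hn' : (0 : ℝ) < n := by exact_mod_cast (show 0 < n by omega)
  have h1 := hn₀ n (by omega)
  have e : (∑ k ∈ Finset.range L, (∑ i ∈ Finset.range n,
      (g (X i) - (transition φ ν)^[k] g (X i))) / n) / L =
      (∑ i ∈ Finset.range n, (g (X i) - cesaro φ ν g L (X i))) / n := by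
    rw [← Finset.sum_div, Finset.sum_comm, div_right_comm, Finset.sum_div]
    congr 1
    refine Finset.sum_congr rfl fun i _ => ?_
    rw [Finset.sum_sub_distrib, cesaro, sub_div]
    simp [hL']
  have h2 : |(∑ i ∈ Finset.range n, (cesaro φ ν g L (X i) - c)) / n| ≤ η / 2 := by
    rw [abs_div, abs_of_pos hn', div_le_iff₀ hn']
    refine (Finset.abs_sum_le_sum_abs _ _).trans ?_
    refine (Finset.sum_le_sum fun i _ => hLK _ (hXK i)).trans ?_
    simp [mul_comm]
  have e2 : (∑ i ∈ Finset.range n, g (X i)) / n - c =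
      (∑ i ∈ Finset.range n, (g (X i) - cesaro φ ν g L (X i))) / n +
      (∑ i ∈ Finset.range n, (cesaro φ ν g L (X i) - c)) / n := by
    rw [← add_div, ← Finset.sum_add_distrib, eq_div_iff hn'.ne', sub_mul,
      div_mul_cancel₀ _ hn'.ne']
    simp only [sub_add_sub_cancel, Finset.sum_sub_distrib, Finset.sum_const, Finset.card_range,
      nsmul_eq_mul]
    ring
  rw [e, Real.dist_eq, sub_zero] at h1
  rw [Real.dist_eq, e2]
  have := abs_add_le ((∑ i ∈ Finset.range n, (g (X i) - cesaro φ ν g L (X i))) / n)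
    ((∑ i ∈ Finset.range n, (cesaro φ ν g L (X i) - c)) / n)
  linarith

/-- The averages of `G(X_i, τ_i)`, where the gap `τ_i` is independent of the state `X_i`: integrating
out the gap changes `G` by a martingale difference. -/
theorem ae_tendsto_average_pair_of_cesaro (hφ : Measurable fun p : ℝ × E => φ p.1 p.2) {K : Set E}
    (hK : ∀ s, ∀ x ∈ K, φ s x ∈ K)
    (hτ : ∀ n, Measurable (τ n)) (hind : iIndepFun τ P) (hlaw : ∀ n, P.map (τ n) = ν) {x : E}
    (hx : x ∈ K) {G : E × ℝ → ℝ} (hG : Measurable G) {C : ℝ} (hC : ∀ p, |G p| ≤ C) {c : ℝ}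
    (hces : ∀ η > 0, ∃ L, 0 < L ∧ ∀ y ∈ K,
      |cesaro φ ν (fun y => ∫ s, G (y, s) ∂ν) L y - c| ≤ η) :
    ∀ᵐ ω ∂P, Tendsto (fun n : ℕ =>
      (∑ i ∈ Finset.range n, G (chain φ (fun i => τ i ω) x i, τ i ω)) / n) atTop (𝓝 c) := by
  have hgm : Measurable fun y => ∫ s, G (y, s) ∂ν :=
    (StronglyMeasurable.integral_prod_right (f := fun y s => G (y, s)) hG.stronglyMeasurable).measurable
  have hgb : ∀ y, |∫ s, G (y, s) ∂ν| ≤ C := fun y => abs_integral_le_of_bound fun s => hC _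
  have h1 := ae_tendsto_average_of_cesaro hφ hK hτ hind hlaw hx hgm hgb hces
  have h2 := ae_tendsto_average_zero_of_centred hφ hτ hind hlaw x
    (G := fun p => G p - ∫ s, G (p.1, s) ∂ν) (hG.sub (hgm.comp measurable_fst)) (C := C + C)
    (fun p => (abs_sub _ _).trans (add_le_add (hC _) (hgb _))) (fun y => by
      have hi : Integrable (fun s => G (y, s)) ν := Integrable.of_bound
        (hG.comp (Measurable.prodMk measurable_const measurable_id)).aestronglyMeasurable C
        (Eventually.of_forall fun s => hC _)
      change ∫ s, (G (y, s) - ∫ s', G (y, s') ∂ν) ∂ν = 0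
      rw [integral_sub hi (integrable_const _)]
      simp)
  filter_upwards [h1, h2] with ω hω1 hω2
  have := hω1.add hω2
  rw [add_zero] at this
  refine this.congr fun n => ?_
  rw [← add_div, ← Finset.sum_add_distrib]
  simp

end Averages

end FlipDynamics

/-! ### The mean ergodic theorem for the averaged Koopman operator -/

namespace FlipDynamics

section MeanErgodic

variable {E : Type*} [MetricSpace E] [SecondCountableTopology E] [CompleteSpace E]
  [LocallyCompactSpace E]
  [MeasurableSpace E] [BorelSpace E] {φ : ℝ → E → E} {π : Measure E} [IsProbabilityMeasure π]

/-- The Koopman operator `u ↦ u ∘ φ_s` on `L²(π)`. -/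
noncomputable def koopman (hπ : ∀ s, MeasurePreserving (φ s) π π) (s : ℝ) :
    Lp ℝ 2 π →ₗᵢ[ℝ] Lp ℝ 2 π :=
  Lp.compMeasurePreservingₗᵢ ℝ (φ s) (hπ s)

theorem continuous_koopman (hφ : Continuous fun p : ℝ × E => φ p.1 p.2)
    (hπ : ∀ s, MeasurePreserving (φ s) π π) (u : Lp ℝ 2 π) :
    Continuous fun s => koopman hπ s u := by
  let F : C(ℝ, C(E, E)) := ContinuousMap.curry ⟨fun p : ℝ × E => φ p.1 p.2, hφ⟩
  exact Continuous.compMeasurePreservingLp (f := fun _ : ℝ => u) (g := fun s => F s)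
    continuous_const F.continuous hπ (by simp)

omit [MetricSpace E] [SecondCountableTopology E] [CompleteSpace E]
  [LocallyCompactSpace E] [BorelSpace E] [IsProbabilityMeasure π] in
theorem koopman_coeFn (hπ : ∀ s, MeasurePreserving (φ s) π π) (s : ℝ) (u : Lp ℝ 2 π) :
    koopman hπ s u =ᵐ[π] u ∘ φ s :=
  Lp.coeFn_compMeasurePreserving u (hπ s)

variable (ν : Measure ℝ) [IsProbabilityMeasure ν]

theorem integrable_koopman (hφ : Continuous fun p : ℝ × E => φ p.1 p.2)
    (hπ : ∀ s, MeasurePreserving (φ s) π π) (u : Lp ℝ 2 π) :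
    Integrable (fun s => koopman hπ s u) ν :=
  Integrable.of_bound (continuous_koopman hφ hπ u).aestronglyMeasurable ‖u‖
    (Eventually.of_forall fun s => by simp)

/-- The transition operator as a contraction of `L²(π)`, the average of the Koopman operators. -/
noncomputable def averagedKoopman (hφ : Continuous fun p : ℝ × E => φ p.1 p.2)
    (hπ : ∀ s, MeasurePreserving (φ s) π π) : Lp ℝ 2 π →L[ℝ] Lp ℝ 2 π :=
  LinearMap.mkContinuous
    { toFun := fun u => ∫ s, koopman hπ s u ∂ν
      map_add' := fun u v => by
        simp only [map_add]
        exact integral_add (integrable_koopman ν hφ hπ u) (integrable_koopman ν hφ hπ v)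
      map_smul' := fun c u => by
        simp only [map_smul, RingHom.id_apply]
        exact integral_smul c _ } 1 fun u => by
      have := norm_integral_le_of_norm_le_const (μ := ν) (f := fun s => koopman hπ s u)
        (C := ‖u‖) (Eventually.of_forall fun s => by simp)
      simpa using this

theorem averagedKoopman_apply (hφ : Continuous fun p : ℝ × E => φ p.1 p.2)
    (hπ : ∀ s, MeasurePreserving (φ s) π π) (u : Lp ℝ 2 π) :
    averagedKoopman ν hφ hπ u = ∫ s, koopman hπ s u ∂ν := rfl

theorem norm_averagedKoopman_le (hφ : Continuous fun p : ℝ × E => φ p.1 p.2)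
    (hπ : ∀ s, MeasurePreserving (φ s) π π) : ‖averagedKoopman ν hφ hπ‖ ≤ 1 :=
  LinearMap.mkContinuous_norm_le _ zero_le_one _

/-- A vector fixed by an average of isometries is fixed by almost all of them, by strict
convexity; here by all `s > 0`, by continuity. -/
theorem koopman_eq_of_averagedKoopman_eq (hφ : Continuous fun p : ℝ × E => φ p.1 p.2)
    (hπ : ∀ s, MeasurePreserving (φ s) π π) (hν : volume.restrict (Set.Ioi 0) ≪ ν)
    {u : Lp ℝ 2 π} (hu : averagedKoopman ν hφ hπ u = u) {s : ℝ} (hs : 0 < s) :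
    koopman hπ s u = u := by
  have hsq : ∀ s, ‖koopman hπ s u - u‖ ^ 2 = 2 * ‖u‖ ^ 2 - 2 * inner ℝ u (koopman hπ s u) := by
    intro s
    rw [norm_sub_sq_real, LinearIsometry.norm_map, real_inner_comm]
    ring
  have hint : Integrable (fun s => inner ℝ u (koopman hπ s u)) ν :=
    (integrable_koopman ν hφ hπ u).const_inner u
  have h0 : ∫ s, ‖koopman hπ s u - u‖ ^ 2 ∂ν = 0 := by
    have hI : ∫ s, inner ℝ u (koopman hπ s u) ∂ν = ‖u‖ ^ 2 := by
      rw [integral_inner (integrable_koopman ν hφ hπ u), ← averagedKoopman_apply ν hφ hπ, hu,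
        real_inner_self_eq_norm_sq]
    simp_rw [hsq]
    rw [integral_sub (integrable_const _) (hint.const_mul 2),
      integral_const_mul 2 fun s => inner ℝ u (koopman hπ s u), hI]
    simp
  have hc := continuous_koopman hφ hπ u
  have hae : ∀ᵐ s ∂ν, koopman hπ s u = u := by
    have hi : Integrable (fun s => ‖koopman hπ s u - u‖ ^ 2) ν := by
      simp_rw [hsq]
      exact (integrable_const _).sub (hint.const_mul 2)
    have := (integral_eq_zero_iff_of_nonneg (fun s => sq_nonneg _) hi).1 h0
    filter_upwards [this] with s hs
    simpa [sub_eq_zero] using hs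
  have := Measure.eqOn_open_of_ae_eq (μ := volume) (hν.ae_le hae) isOpen_Ioi hc.continuousOn
    continuousOn_const
  exact this hs

variable {ν}

omit [MetricSpace E] [SecondCountableTopology E]
  [CompleteSpace E] [LocallyCompactSpace E] [BorelSpace E] in
theorem memLp_of_bound {g : E → ℝ} (hg : Measurable g) {C : ℝ} (hC : ∀ x, |g x| ≤ C) :
    MemLp g 2 π :=
  MemLp.of_bound hg.aestronglyMeasurable C (Eventually.of_forall hC)

/-- The operator on `L²(π)` is the transition operator. -/
theorem averagedKoopman_toLp (hφ : Continuous fun p : ℝ × E => φ p.1 p.2)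
    (hπ : ∀ s, MeasurePreserving (φ s) π π) {g : E → ℝ} (hg : Measurable g) {C : ℝ}
    (hC : ∀ x, |g x| ≤ C) :
    averagedKoopman ν hφ hπ (memLp_of_bound hg hC).toLp =
      (memLp_of_bound (measurable_transition (ν := ν) hφ.measurable hg)
        (abs_transition_le hC)).toLp := by
  refine ext_inner_left ℝ fun h => ?_
  rw [averagedKoopman_apply, ← integral_inner (integrable_koopman ν hφ hπ _)]
  have h1 : ∀ s, inner ℝ h (koopman hπ s (memLp_of_bound hg hC).toLp) =
      ∫ x, h x * g (φ s x) ∂π := by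
    intro s
    rw [L2.inner_def]
    refine integral_congr_ae ?_
    have hq := (hπ s).quasiMeasurePreserving.ae_eq_comp (memLp_of_bound (π := π) hg hC).coeFn_toLp
    filter_upwards [koopman_coeFn hπ s (memLp_of_bound hg hC).toLp, hq] with x hx hx'
    rw [hx, hx']
    simp [mul_comm]
  have h2 : inner ℝ h (memLp_of_bound (π := π) (measurable_transition (ν := ν) hφ.measurable hg)
      (abs_transition_le hC)).toLp = ∫ x, ∫ s, h x * g (φ s x) ∂ν ∂π := by
    rw [L2.inner_def]
    refine integral_congr_ae ?_
    filter_upwards [(memLp_of_bound (π := π) (measurable_transition (ν := ν) hφ.measurable hg)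
      (abs_transition_le hC)).coeFn_toLp] with x hx
    rw [hx, integral_const_mul]
    simp [transition, mul_comm]
  simp_rw [h1]
  rw [h2, integral_integral_swap]
  have hh : Integrable h π := (Lp.memLp h).integrable (by norm_num)
  have hh2 : Integrable (fun p : ℝ × E => h p.2) (ν.prod π) := by
    have := (integrable_const (1 : ℝ) (μ := ν)).mul_prod hh
    simpa using this
  refine hh2.mul_bdd (c := C) (hg.comp hφ.measurable).aestronglyMeasurable
    (Eventually.of_forall fun p => hC _)

theorem iterate_averagedKoopman_toLp (hφ : Continuous fun p : ℝ × E => φ p.1 p.2)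
    (hπ : ∀ s, MeasurePreserving (φ s) π π) {g : E → ℝ} (hg : Measurable g) {C : ℝ}
    (hC : ∀ x, |g x| ≤ C) (k : ℕ) :
    (averagedKoopman ν hφ hπ)^[k] (memLp_of_bound hg hC).toLp =
      (memLp_of_bound (measurable_iterate_transition (ν := ν) hφ.measurable hg k)
        (abs_iterate_transition_le hC k)).toLp := by
  induction k with
  | zero => rfl
  | succ k ih =>
    rw [Function.iterate_succ_apply', ih, averagedKoopman_toLp hφ hπ
      (measurable_iterate_transition (ν := ν) hφ.measurable hg k) (abs_iterate_transition_le hC k)]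
    congr 1
    exact (Function.iterate_succ_apply' _ _ _).symm

/-- Mean ergodic theorem: if only constants are invariant under all `φ_s`, `s > 0`, the Cesàro
averages converge to the mean in `π`-measure. -/
theorem tendsto_measure_cesaro (hφ : Continuous fun p : ℝ × E => φ p.1 p.2)
    (hπ : ∀ s, MeasurePreserving (φ s) π π) (hν : volume.restrict (Set.Ioi 0) ≪ ν)
    (herg : ∀ u : E → ℝ, Measurable u → (∀ s, 0 < s → u ∘ φ s =ᵐ[π] u) →
      ∃ c : ℝ, u =ᵐ[π] fun _ => c)
    {g : E → ℝ} (hg : Measurable g) {C : ℝ} (hC : ∀ x, |g x| ≤ C) {η : ℝ} (hη : 0 < η) :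
    Tendsto (fun L => π {x | η < |cesaro φ ν g L x - ∫ y, g y ∂π|}) atTop (𝓝 0) := by
  set T := averagedKoopman ν hφ hπ with hT
  set G : Lp ℝ 2 π := (memLp_of_bound hg hC).toLp with hG
  set F := T.eqLocus (1 : Lp ℝ 2 π →L[ℝ] Lp ℝ 2 π) with hF
  set p : Lp ℝ 2 π := (F.orthogonalProjectionOnto G).1 with hp
  have hlim : Tendsto (birkhoffAverage ℝ T _root_.id · G) atTop (𝓝 p) :=
    T.tendsto_birkhoffAverage_orthogonalProjection (norm_averagedKoopman_le ν hφ hπ) G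
  -- the limit is constant
  have hpF : T p = p := (F.orthogonalProjectionOnto G).2
  obtain ⟨c, hc⟩ := herg p (Lp.stronglyMeasurable p).measurable fun s hs => by
    have := koopman_coeFn hπ s p
    rw [koopman_eq_of_averagedKoopman_eq ν hφ hπ hν hpF hs] at this
    exact this.symm
  -- the constant is the mean, as the constant function `1` is fixed
  have hone : ∀ x : E, |(fun _ => (1 : ℝ)) x| ≤ 1 := fun x => by simp
  set one : Lp ℝ 2 π := (memLp_of_bound (π := π) measurable_const hone).toLp with hone'
  have honeF : one ∈ F := by
    change T one = one
    rw [hone', hT, averagedKoopman_toLp hφ hπ measurable_const hone]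
    congr 1
    ext x
    simp [transition]
  have hcmean : c = ∫ y, g y ∂π := by
    have h0 : inner ℝ one (G - p) = 0 :=
      (F.mem_orthogonal _).1 (F.sub_starProjection_mem_orthogonal G) one honeF
    rw [inner_sub_right, sub_eq_zero, L2.inner_def, L2.inner_def] at h0
    have e1 : ∫ x, inner ℝ (one x) (G x) ∂π = ∫ y, g y ∂π := by
      refine integral_congr_ae ?_
      filter_upwards [(memLp_of_bound (π := π) hg hC).coeFn_toLp,
        (memLp_of_bound (π := π) measurable_const hone).coeFn_toLp] with x h1 h2
      rw [hone', hG, h1, h2]; simp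
    have e2 : ∫ x, inner ℝ (one x) (p x) ∂π = c := by
      calc _ = ∫ x, c ∂π := by
            refine integral_congr_ae ?_
            filter_upwards [hc, (memLp_of_bound (π := π) measurable_const hone).coeFn_toLp]
              with x h1 h2
            rw [hone', h1, h2]; simp
        _ = c := by simp
    rw [e1, e2] at h0
    exact h0.symm
  have hco : ∀ L, (birkhoffAverage ℝ T _root_.id L G : Lp ℝ 2 π) =ᵐ[π] cesaro φ ν g L := by
    intro L
    have h1 : ∀ k, (T^[k] G : Lp ℝ 2 π) =ᵐ[π] (transition φ ν)^[k] g := fun k => by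
      rw [hG, hT, iterate_averagedKoopman_toLp hφ hπ hg hC]
      exact MemLp.coeFn_toLp _
    have h2 : ∀ L, (∑ k ∈ Finset.range L, T^[k] G : Lp ℝ 2 π) =ᵐ[π]
        fun x => ∑ k ∈ Finset.range L, (transition φ ν)^[k] g x := by
      intro L
      induction L with
      | zero =>
        simp only [Finset.range_zero, Finset.sum_empty]
        exact Lp.coeFn_zero ℝ 2 π
      | succ L ih =>
        rw [Finset.sum_range_succ]
        filter_upwards [Lp.coeFn_add (∑ k ∈ Finset.range L, T^[k] G) (T^[L] G), ih, h1 L]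
          with x e1 e2 e3
        rw [e1, Pi.add_apply, e2, e3, Finset.sum_range_succ]
    simp only [birkhoffAverage, birkhoffSum, id]
    filter_upwards [Lp.coeFn_smul ((L : ℝ)⁻¹) (∑ k ∈ Finset.range L, T^[k] G), h2 L] with x e1 e2
    rw [e1, Pi.smul_apply, e2, cesaro, smul_eq_mul, div_eq_inv_mul]
  have hmeas := tendstoInMeasure_of_tendsto_Lp hlim
  have := hmeas (ENNReal.ofReal η) (by simpa using hη)
  refine tendsto_of_tendsto_of_tendsto_of_le_of_le tendsto_const_nhds this (fun _ => zero_le)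
    fun L => ?_
  refine measure_mono_ae ?_
  filter_upwards [hco L, hc] with x h1 h2 hx
  change η < |cesaro φ ν g L x - ∫ y, g y ∂π| at hx
  change ENNReal.ofReal η ≤ edist _ _
  rw [h1, h2, hcmean, edist_dist, Real.dist_eq]
  exact ENNReal.ofReal_le_ofReal hx.le

end MeanErgodic

end FlipDynamics

/-! ### Flows by isometries with a flip -/

namespace FlipDynamics

/-- A linear flow `x ↦ e^{sA} x` by isometries of a Euclidean space, together with a unit vector
`v` that is cyclic for `A`. The reflection that inverts `v` plays the part of the velocity flip. -/
structure FlipSystem (E : Type*) [NormedAddCommGroup E] [InnerProductSpace ℝ E] where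
  /-- The generator of the flow. -/
  A : E →L[ℝ] E
  /-- The direction that is inverted by a flip. -/
  v : E
  skew : ∀ x y, inner ℝ (A x) y = -inner ℝ x (A y)
  norm_v : ‖v‖ = 1
  cyclic : ∀ u, (∀ k : ℕ, inner ℝ u ((A ^ k) v) = 0) → u = 0

namespace FlipSystem

variable {E : Type*} [NormedAddCommGroup E] [InnerProductSpace ℝ E] [FiniteDimensional ℝ E]
  (S : FlipSystem E)

/-- The flow as a family of continuous linear maps. -/
noncomputable def rotL (s : ℝ) : E →L[ℝ] E := NormedSpace.exp (s • S.A)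

omit [FiniteDimensional ℝ E] in
theorem rotL_zero : S.rotL 0 = 1 := by simp [rotL, NormedSpace.exp_zero]

omit [FiniteDimensional ℝ E] in
theorem A_rotL (s : ℝ) (x : E) : S.A (S.rotL s x) = S.rotL s (S.A x) := by
  have : Commute S.A (S.rotL s) := ((Commute.refl S.A).smul_right s).exp_right
  exact DFunLike.congr_fun this.eq x

theorem hasDerivAt_rotL (x : E) (s : ℝ) :
    HasDerivAt (fun s => S.rotL s x) (S.A (S.rotL s x)) s := by
  have h := (hasDerivAt_exp_smul_const' (𝕂 := ℝ) S.A s).clm_apply (hasDerivAt_const s x)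
  simpa [rotL] using h

theorem contDiff_rotL : ContDiff ℝ ⊤ S.rotL := by
  have h : ContDiff ℝ ⊤ (NormedSpace.exp : (E →L[ℝ] E) → (E →L[ℝ] E)) :=
    contDiff_iff_contDiffAt.2 fun x => (NormedSpace.exp_analytic (𝕂 := ℝ) x).contDiffAt
  exact h.comp (contDiff_id.smul contDiff_const)

theorem inner_rotL (s : ℝ) (x y : E) : inner ℝ (S.rotL s x) (S.rotL s y) = inner ℝ x y := by
  have hd : ∀ s, HasDerivAt (fun s => inner ℝ (S.rotL s x) (S.rotL s y)) 0 s := fun s => by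
    have := (S.hasDerivAt_rotL x s).inner ℝ (S.hasDerivAt_rotL y s)
    rwa [S.skew, add_neg_cancel] at this
  have := is_const_of_deriv_eq_zero (fun s => (hd s).differentiableAt) (fun s => (hd s).deriv) s 0
  simpa [rotL_zero] using this

/-- The flow as a family of linear isometries. -/
noncomputable def rot (s : ℝ) : E ≃ₗᵢ[ℝ] E :=
  LinearIsometry.toLinearIsometryEquiv
    { toLinearMap := S.rotL s
      norm_map' := fun x => by
        have := S.inner_rotL s x x
        rw [real_inner_self_eq_norm_sq, real_inner_self_eq_norm_sq] at this
        exact (sq_eq_sq₀ (norm_nonneg _) (norm_nonneg _)).1 this } rfl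

theorem rot_apply (s : ℝ) (x : E) : S.rot s x = S.rotL s x := by
  simp [rot]

theorem A_rot (s : ℝ) (x : E) : S.A (S.rot s x) = S.rot s (S.A x) := by
  simp [rot_apply, A_rotL]

theorem hasDerivAt_rot (x : E) (s : ℝ) : HasDerivAt (fun s => S.rot s x) (S.A (S.rot s x)) s := by
  simpa only [rot_apply] using S.hasDerivAt_rotL x s

/-- The flip, the reflection in the hyperplane orthogonal to `v`. -/
noncomputable def flip : E ≃ₗᵢ[ℝ] E := (ℝ ∙ S.v)ᗮ.reflection

omit [FiniteDimensional ℝ E] in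
theorem flip_apply (x : E) : S.flip x = x - (2 * inner ℝ S.v x) • S.v := by
  rw [flip, Submodule.reflection_orthogonal_apply, Submodule.reflection_singleton_apply,
    S.norm_v]
  simp [two_smul, two_mul, add_smul]

/-- One step of the dynamics: the flow for the time `s`, then a flip. -/
noncomputable def stepIso (s : ℝ) : E ≃ₗᵢ[ℝ] E := (S.rot s).trans S.flip

/-- The map underlying `stepIso`. -/
noncomputable def step (s : ℝ) (x : E) : E := S.stepIso s x

theorem step_eq (s : ℝ) (x : E) : S.step s x = S.flip (S.rot s x) := rfl

theorem contDiff_rot : ContDiff ℝ ⊤ fun p : ℝ × E => S.rot p.1 p.2 := by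
  simp only [rot_apply]
  exact (S.contDiff_rotL.comp contDiff_fst).clm_apply contDiff_snd

theorem contDiff_step : ContDiff ℝ ⊤ fun p : ℝ × E => S.step p.1 p.2 :=
  (S.flip.toContinuousLinearEquiv.contDiff (n := ⊤)).comp S.contDiff_rot

theorem norm_step (s : ℝ) (x : E) : ‖S.step s x‖ = ‖x‖ := (S.stepIso s).norm_map x

/-- A vector orthogonal to `e^{-sA} v` for `s` in an open interval is zero: all the derivatives
of `s ↦ ⟪u, e^{-sA} v⟫` vanish. -/
theorem eq_zero_of_eventually {u : E} {s₀ : ℝ} (h : ∀ᶠ s in 𝓝 s₀, inner ℝ (S.rot s u) S.v = 0) :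
    u = 0 := by
  have hk : ∀ k : ℕ, ∀ᶠ s in 𝓝 s₀, inner ℝ ((S.A ^ k) (S.rot s u)) S.v = 0 := by
    intro k
    induction k with
    | zero => simpa using h
    | succ k ih =>
      have := eventually_eventually_nhds.2 ih
      filter_upwards [this] with s hs
      have hd : HasDerivAt (fun s => inner ℝ ((S.A ^ k) (S.rot s u)) S.v)
          (inner ℝ ((S.A ^ k) (S.A (S.rot s u))) S.v) s := by
        have h1 := ((S.A ^ k).hasFDerivAt.comp_hasDerivAt s (S.hasDerivAt_rot u s))
        simpa using h1.inner ℝ (hasDerivAt_const s S.v)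
      have hs' : (fun s => inner ℝ ((S.A ^ k) (S.rot s u)) S.v) =ᶠ[𝓝 s] fun _ => 0 := hs
      rw [pow_succ]
      change inner ℝ ((S.A ^ k) (S.A (S.rot s u))) S.v = 0
      rw [← hd.deriv, hs'.deriv_eq, deriv_const]
  have hadj : ∀ k : ℕ, ∀ x y, inner ℝ ((S.A ^ k) x) y = (-1) ^ k * inner ℝ x ((S.A ^ k) y) := by
    intro k
    induction k with
    | zero => simp
    | succ k ih =>
      intro x y
      have e1 : (S.A ^ (k + 1)) x = (S.A ^ k) (S.A x) := by rw [pow_succ]; rfl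
      have e2 : (S.A ^ (k + 1)) y = S.A ((S.A ^ k) y) := by rw [pow_succ']; rfl
      rw [e1, e2, ih, S.skew]
      ring
  have h0 : S.rot s₀ u = 0 := S.cyclic _ fun k => by
    have h1 := (hk k).self_of_nhds
    rw [hadj] at h1
    exact (mul_eq_zero.1 h1).resolve_left (by simp)
  exact (map_eq_zero_iff _ (S.rot s₀).injective).1 h0

/-- The two-form `⟪A x, w⟫` on a pair of independent vectors is nonzero, or becomes nonzero after
one step. If it vanished after each step, the functions `a(s) = ⟪v, e^{sA} x⟫` and
`b(s) = ⟪v, e^{sA} w⟫` would have Wronskian zero, hence would be proportional. -/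
theorem exists_inner_step_ne_zero {x w : E} (hx : x ≠ 0) (hw : w ≠ 0) (hxw : inner ℝ x w = 0) :
    inner ℝ (S.A x) w ≠ 0 ∨ ∃ s, 0 < s ∧ inner ℝ (S.A (S.step s x)) (S.step s w) ≠ 0 := by
  by_contra! hcon
  obtain ⟨h0, h1⟩ := hcon
  set a : ℝ → ℝ := fun s => inner ℝ (S.rot s x) S.v with ha
  set b : ℝ → ℝ := fun s => inner ℝ (S.rot s w) S.v with hb
  have hda : ∀ s, HasDerivAt a (inner ℝ (S.A (S.rot s x)) S.v) s := fun s => by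
    simpa using (S.hasDerivAt_rot x s).inner ℝ (hasDerivAt_const s S.v)
  have hdb : ∀ s, HasDerivAt b (inner ℝ (S.A (S.rot s w)) S.v) s := fun s => by
    simpa using (S.hasDerivAt_rot w s).inner ℝ (hasDerivAt_const s S.v)
  have hAv : inner ℝ (S.A S.v) S.v = 0 := by
    have := S.skew S.v S.v
    rw [real_inner_comm (S.A S.v) S.v] at this
    linarith
  have hwr : ∀ s, 0 < s → b s * inner ℝ (S.A (S.rot s x)) S.v =
      a s * inner ℝ (S.A (S.rot s w)) S.v := by
    intro s hs
    have h := h1 s hs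
    have e0 : inner ℝ (S.A (S.rot s x)) (S.rot s w) = 0 := by
      rw [A_rot, LinearIsometryEquiv.inner_map_map, h0]
    have e1 : inner ℝ (S.A S.v) (S.rot s w) = -inner ℝ (S.A (S.rot s w)) S.v := by
      rw [S.skew, real_inner_comm]
    rw [step_eq, step_eq, flip_apply, flip_apply] at h
    simp only [map_sub, map_smul, inner_sub_left, inner_sub_right, real_inner_smul_left,
      real_inner_smul_right, e0, e1, hAv] at h
    simp only [ha, hb]
    rw [real_inner_comm S.v (S.rot s w), real_inner_comm S.v (S.rot s x)]
    linarith
  obtain ⟨s₀, hs₀, has₀⟩ : ∃ s₀, 0 < s₀ ∧ a s₀ ≠ 0 := by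
    by_contra! hcon
    refine hx (S.eq_zero_of_eventually (s₀ := 1) ?_)
    filter_upwards [lt_mem_nhds one_pos] with s hs using hcon s hs
  have hca : Continuous a := continuous_iff_continuousAt.2 fun s => (hda s).continuousAt
  obtain ⟨δ, hδ, hball⟩ : ∃ δ > 0, ∀ s ∈ Metric.ball s₀ δ, 0 < s ∧ a s ≠ 0 :=
    Metric.eventually_nhds_iff_ball.1
      ((lt_mem_nhds hs₀).and (hca.continuousAt.eventually_ne has₀))
  have hr : ∀ s ∈ Metric.ball s₀ δ, HasDerivAt (fun s => b s / a s) 0 s := fun s hs => by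
    have h := (hdb s).div (hda s) (hball s hs).2
    have e : inner ℝ (S.A (S.rot s w)) S.v * a s - b s * inner ℝ (S.A (S.rot s x)) S.v = 0 := by
      rw [hwr s (hball s hs).1]; ring
    rwa [e, zero_div] at h
  set c := b s₀ / a s₀ with hc
  have hconst : ∀ s ∈ Metric.ball s₀ δ, b s / a s = c := fun s hs =>
    Metric.isOpen_ball.is_const_of_deriv_eq_zero (convex_ball s₀ δ).isPreconnected
      (fun s hs => (hr s hs).differentiableAt.differentiableWithinAt)
      (fun s hs => (hr s hs).deriv) hs (Metric.mem_ball_self hδ)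
  have hwc : w - c • x = 0 := by
    refine S.eq_zero_of_eventually (s₀ := s₀) ?_
    filter_upwards [Metric.ball_mem_nhds s₀ hδ] with s hs
    have := hconst s hs
    rw [div_eq_iff (hball s hs).2] at this
    simp only [map_sub, map_smul, inner_sub_left, real_inner_smul_left]
    simp only [ha, hb] at this
    linarith
  rw [sub_eq_zero] at hwc
  rw [hwc, real_inner_smul_right, real_inner_self_eq_norm_sq] at hxw
  have : c = 0 := (mul_eq_zero.1 hxw).resolve_right (by simpa using hx)
  rw [this, zero_smul] at hwc
  exact hw hwc

/-! ### Rank of the composed steps -/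

theorem contDiff_wordMap (n : ℕ) :
    ContDiff ℝ ⊤ fun p : (Fin n → ℝ) × E => wordMap S.step n p.1 p.2 := by
  induction n with
  | zero => exact contDiff_snd
  | succ n ih =>
    have h1 : ContDiff ℝ ⊤ fun p : (Fin (n + 1) → ℝ) × E =>
        wordMap S.step n (fun i => p.1 i.castSucc) p.2 :=
      ih.comp (ContDiff.prodMk
        (contDiff_pi.2 fun i => (contDiff_apply ℝ ℝ i.castSucc).comp contDiff_fst) contDiff_snd)
    have h2 : ContDiff ℝ ⊤ fun p : (Fin (n + 1) → ℝ) × E => p.1 (Fin.last n) :=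
      (contDiff_apply ℝ ℝ (Fin.last n)).comp contDiff_fst
    simp only [wordMap]
    exact ContDiff.comp (g := fun p : ℝ × E => S.step p.1 p.2)
      (f := fun p : (Fin (n + 1) → ℝ) × E =>
        (p.1 (Fin.last n), wordMap S.step n (fun i => p.1 i.castSucc) p.2))
      S.contDiff_step (h2.prodMk h1)

theorem differentiable_wordMap (n : ℕ) (x : E) :
    Differentiable ℝ fun s : Fin n → ℝ => wordMap S.step n s x :=
  ((S.contDiff_wordMap n).comp (contDiff_id.prodMk contDiff_const)).differentiable (by simp)

theorem norm_wordMap (n : ℕ) (s : Fin n → ℝ) (x : E) : ‖wordMap S.step n s x‖ = ‖x‖ := by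
  induction n with
  | zero => rfl
  | succ n ih => simp only [wordMap, norm_step, ih]

theorem fderiv_step (s : ℝ) (x : E) (σ : ℝ) (z : E) :
    fderiv ℝ (fun p : ℝ × E => S.step p.1 p.2) (s, x) (σ, z) =
      σ • S.stepIso s (S.A x) + S.stepIso s z := by
  set F := fderiv ℝ (fun p : ℝ × E => S.step p.1 p.2) (s, x) with hF
  have hd : HasFDerivAt (fun p : ℝ × E => S.step p.1 p.2) F (s, x) :=
    (S.contDiff_step.differentiable (by simp) _).hasFDerivAt
  have h1 : F (1, 0) = S.stepIso s (S.A x) := by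
    have e1 : HasDerivAt (fun t : ℝ => S.step t x) (F (1, 0)) s :=
      hd.comp_hasDerivAt (f := fun t : ℝ => (t, x)) s
        ((hasDerivAt_id s).prodMk (hasDerivAt_const s x))
    have e2 : HasDerivAt (fun t : ℝ => S.step t x) (S.stepIso s (S.A x)) s := by
      have := S.flip.toContinuousLinearEquiv.hasFDerivAt.comp_hasDerivAt s (S.hasDerivAt_rot x s)
      rw [A_rot] at this
      exact this
    exact e1.unique e2
  have h2 : F (0, z) = S.stepIso s z := by
    have e1 : HasFDerivAt (fun y : E => S.step s y) (F.comp (ContinuousLinearMap.inr ℝ ℝ E)) x :=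
      hd.comp (f := fun y : E => (s, y)) x (hasFDerivAt_prodMk_right s x)
    have e2 : HasFDerivAt (fun y : E => S.step s y)
        ((S.stepIso s).toContinuousLinearEquiv : E →L[ℝ] E) x :=
      (S.stepIso s).toContinuousLinearEquiv.hasFDerivAt
    exact DFunLike.congr_fun (e1.unique e2) z
  have : ((σ, z) : ℝ × E) = σ • ((1 : ℝ), (0 : E)) + (0, z) := by simp
  rw [this, map_add, map_smul, h1, h2]

/-- The space spanned by the end point of a word and by the derivatives of the end point with
respect to the letters. -/
noncomputable def tangent (n : ℕ) (s : Fin n → ℝ) (x : E) : Submodule ℝ E :=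
  (fderiv ℝ (fun s : Fin n → ℝ => wordMap S.step n s x) s).range ⊔ ℝ ∙ wordMap S.step n s x

/-- The chain rule for a composition with one further step of time `t`. -/
theorem fderiv_wordMap_snoc (n : ℕ) (s : Fin n → ℝ) (x : E) (t : ℝ) (d : Fin n → ℝ) (σ : ℝ) :
    fderiv ℝ (fun s : Fin (n + 1) → ℝ => wordMap S.step (n + 1) s x) (Fin.snoc s t)
      (Fin.snoc d σ) =
      σ • S.stepIso t (S.A (wordMap S.step n s x)) +
        S.stepIso t (fderiv ℝ (fun s : Fin n → ℝ => wordMap S.step n s x) s d) := by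
  have h1 : HasFDerivAt (fun s : Fin n → ℝ => wordMap S.step n s x)
      (fderiv ℝ (fun s : Fin n → ℝ => wordMap S.step n s x) s) s :=
    (S.differentiable_wordMap n x s).hasFDerivAt
  set I : (Fin (n + 1) → ℝ) →L[ℝ] (Fin n → ℝ) :=
    ContinuousLinearMap.pi fun i => ContinuousLinearMap.proj i.castSucc with hI
  have hIs : I (Fin.snoc s t) = s := by ext i; simp [hI]
  have hId : I (Fin.snoc d σ) = d := by ext i; simp [hI]
  have h2 : HasFDerivAt (fun u : Fin (n + 1) → ℝ => wordMap S.step n (I u) x)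
      ((fderiv ℝ (fun s : Fin n → ℝ => wordMap S.step n s x) s).comp I) (Fin.snoc s t) :=
    HasFDerivAt.comp (g := fun s : Fin n → ℝ => wordMap S.step n s x) _
      (by rw [hIs]; exact h1) I.hasFDerivAt
  have h3 : HasFDerivAt (fun u : Fin (n + 1) → ℝ => u (Fin.last n))
      (ContinuousLinearMap.proj (R := ℝ) (φ := fun _ : Fin (n + 1) => ℝ) (Fin.last n))
      (Fin.snoc s t) :=
    (ContinuousLinearMap.proj (R := ℝ) (φ := fun _ : Fin (n + 1) => ℝ) (Fin.last n)).hasFDerivAt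
  have h4 : HasFDerivAt (fun p : ℝ × E => S.step p.1 p.2)
      (fderiv ℝ (fun p : ℝ × E => S.step p.1 p.2) (t, wordMap S.step n s x))
      (t, wordMap S.step n s x) :=
    (S.contDiff_step.differentiable (by simp) _).hasFDerivAt
  have h5 : HasFDerivAt (fun u : Fin (n + 1) → ℝ => wordMap S.step (n + 1) u x)
      ((fderiv ℝ (fun p : ℝ × E => S.step p.1 p.2) (t, wordMap S.step n s x)).comp
        ((ContinuousLinearMap.proj (Fin.last n)).prod
          ((fderiv ℝ (fun s : Fin n → ℝ => wordMap S.step n s x) s).comp I))) (Fin.snoc s t) := by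
    refine HasFDerivAt.comp (g := fun p : ℝ × E => S.step p.1 p.2)
      (f := fun u : Fin (n + 1) → ℝ => (u (Fin.last n), wordMap S.step n (I u) x)) _ ?_
      (h3.prodMk h2)
    rw [hIs]
    simpa using h4
  rw [h5.fderiv]
  simp only [ContinuousLinearMap.comp_apply, ContinuousLinearMap.prod_apply, hId]
  rw [fderiv_step]
  simp

/-- A further step carries the tangent space into the new tangent space. -/
theorem step_mem_tangent_snoc (n : ℕ) (s : Fin n → ℝ) (x : E) (t : ℝ) {z : E}
    (hz : z ∈ S.tangent n s x) : S.stepIso t z ∈ S.tangent (n + 1) (Fin.snoc s t) x := by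
  have hle : S.tangent n s x ≤
      (S.tangent (n + 1) (Fin.snoc s t) x).comap (S.stepIso t).toLinearEquiv.toLinearMap := by
    refine sup_le ?_ ?_
    · rintro _ ⟨d, rfl⟩
      refine Submodule.mem_sup_left ⟨Fin.snoc d 0, ?_⟩
      have := S.fderiv_wordMap_snoc n s x t d 0
      rw [zero_smul, zero_add] at this
      exact this
    · rw [Submodule.span_singleton_le_iff_mem]
      refine Submodule.mem_sup_right (Submodule.mem_span_singleton.2 ⟨1, ?_⟩)
      simp only [one_smul, wordMap, Fin.snoc_last, Fin.snoc_castSucc]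
      rfl
  exact hle hz

/-- The derivative with respect to the time of the last step. -/
theorem step_A_mem_tangent_snoc (n : ℕ) (s : Fin n → ℝ) (x : E) (t : ℝ) :
    S.stepIso t (S.A (wordMap S.step n s x)) ∈ S.tangent (n + 1) (Fin.snoc s t) x := by
  refine Submodule.mem_sup_left ⟨Fin.snoc 0 1, ?_⟩
  have := S.fderiv_wordMap_snoc n s x t 0 1
  rw [one_smul, map_zero, map_zero, add_zero] at this
  exact this

/-- If an isometry `g` maps `F` into `F'`, and `F'` contains a vector that is not orthogonal to the
image of some `w ⊥ F`, then `F'` is larger than `F`. -/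
theorem finrank_lt_of_isometry {F F' : Submodule ℝ E} (g : E ≃ₗᵢ[ℝ] E)
    (hg : ∀ z ∈ F, g z ∈ F') {w z : E} (hw : ∀ y ∈ F, inner ℝ y w = 0) (hz : z ∈ F')
    (hzw : inner ℝ z (g w) ≠ 0) : Module.finrank ℝ F < Module.finrank ℝ F' := by
  set G := F.map g.toLinearEquiv.toLinearMap with hG
  have h1 : Module.finrank ℝ G = Module.finrank ℝ F := LinearEquiv.finrank_map_eq g.toLinearEquiv F
  rw [← h1]
  refine Submodule.finrank_lt_finrank_of_lt (lt_of_le_of_ne ?_ ?_)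
  · rintro _ ⟨y, hy, rfl⟩
    exact hg y hy
  · intro h
    rw [← h] at hz
    obtain ⟨y, hy, rfl⟩ := hz
    apply hzw
    change inner ℝ (g y) (g w) = 0
    rw [g.inner_map_map]
    exact hw y hy

/-- Some composition of steps with positive times is a submersion onto the sphere: as long as the
rank is not full, one or two further steps raise it. -/
theorem exists_tangent_eq_top {x : E} (hx : x ≠ 0) :
    ∃ (n : ℕ) (s : Fin n → ℝ), (∀ i, 0 < s i) ∧ S.tangent n s x = ⊤ := by
  by_contra! hcon
  have hpos : ∀ (n : ℕ) (s : Fin n → ℝ), (∀ i, 0 < s i) → ∀ t, 0 < t →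
      ∀ i, 0 < (Fin.snoc s t : Fin (n + 1) → ℝ) i := by
    intro n s hs t ht i
    refine Fin.lastCases ?_ (fun i => ?_) i <;> simp [ht, hs]
  have key : ∀ k : ℕ, ∃ (n : ℕ) (s : Fin n → ℝ), (∀ i, 0 < s i) ∧
      k ≤ Module.finrank ℝ (S.tangent n s x) := by
    intro k
    induction k with
    | zero => exact ⟨0, Fin.elim0, fun i => i.elim0, Nat.zero_le _⟩
    | succ k ih =>
      obtain ⟨n, s, hs, hk⟩ := ih
      set y := wordMap S.step n s x with hy
      have hy0 : y ≠ 0 := fun h => hx (by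
        rw [← norm_eq_zero, ← S.norm_wordMap n s x, ← hy, h, norm_zero])
      have hbot : (S.tangent n s x)ᗮ ≠ ⊥ := fun h =>
        hcon n s hs ((Submodule.orthogonal_eq_bot_iff).1 h)
      obtain ⟨w, hw, hw0⟩ := Submodule.exists_mem_ne_zero_of_ne_bot hbot
      have hwT : ∀ z ∈ S.tangent n s x, inner ℝ z w = 0 := fun z hz => hw z hz
      have hyw : inner ℝ y w = 0 :=
        hwT y (Submodule.mem_sup_right (Submodule.mem_span_singleton_self _))
      rcases S.exists_inner_step_ne_zero hy0 hw0 hyw with h | ⟨t, ht, h⟩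
      · refine ⟨n + 1, Fin.snoc s 1, hpos n s hs 1 one_pos, ?_⟩
        have := finrank_lt_of_isometry (S.stepIso 1)
          (fun z hz => S.step_mem_tangent_snoc n s x 1 hz) hwT (S.step_A_mem_tangent_snoc n s x 1)
          (by rwa [LinearIsometryEquiv.inner_map_map])
        omega
      · refine ⟨n + 1 + 1, Fin.snoc (Fin.snoc s t) 1, hpos _ _ (hpos n s hs t ht) 1 one_pos, ?_⟩
        have := finrank_lt_of_isometry ((S.stepIso t).trans (S.stepIso 1))
          (fun z hz => S.step_mem_tangent_snoc _ _ x 1 (S.step_mem_tangent_snoc n s x t hz)) hwT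
          (S.step_A_mem_tangent_snoc (n + 1) (Fin.snoc s t) x 1) (by
            rw [LinearIsometryEquiv.trans_apply, LinearIsometryEquiv.inner_map_map]
            simp only [wordMap, Fin.snoc_last, Fin.snoc_castSucc]
            exact h)
        omega
  obtain ⟨n, s, _, hk⟩ := key (Module.finrank ℝ E + 1)
  have := Submodule.finrank_le (S.tangent n s x)
  omega

/-- The map `(r, s) ↦ r φ(s_{n-1}, ·) ⋯ φ(s_0, y)`; the factor `r` makes it open as a map into
the whole space. -/
noncomputable def coneMap (n : ℕ) (y : E) (z : ℝ × (Fin n → ℝ)) : E := z.1 • wordMap S.step n z.2 y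

theorem contDiff_coneMap (n : ℕ) :
    ContDiff ℝ ⊤ fun p : E × (ℝ × (Fin n → ℝ)) => S.coneMap n p.1 p.2 :=
  (contDiff_fst.comp contDiff_snd).smul ((S.contDiff_wordMap n).comp
    ((contDiff_snd.comp contDiff_snd).prodMk contDiff_fst))

/-- With the radial direction added, the submersion onto the sphere is a submersion onto `E`. -/
theorem exists_coneMap_surjective {x : E} (hx : x ≠ 0) :
    ∃ (n : ℕ) (s : Fin n → ℝ), (∀ i, 0 < s i) ∧
      (fderiv ℝ (S.coneMap n x) (1, s)).range = ⊤ := by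
  obtain ⟨n, s, hs, h⟩ := S.exists_tangent_eq_top hx
  refine ⟨n, s, hs, ?_⟩
  rw [eq_top_iff, ← h]
  have h1 : HasFDerivAt (fun s : Fin n → ℝ => wordMap S.step n s x)
      (fderiv ℝ (fun s : Fin n → ℝ => wordMap S.step n s x) s) s :=
    (S.differentiable_wordMap n x s).hasFDerivAt
  have h2 : HasFDerivAt (S.coneMap n x) _ ((1 : ℝ), s) :=
    (hasFDerivAt_fst (𝕜 := ℝ) (p := ((1 : ℝ), s))).smul
      (HasFDerivAt.comp (g := fun s : Fin n → ℝ => wordMap S.step n s x) ((1 : ℝ), s)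
        h1 hasFDerivAt_snd)
  rw [h2.fderiv]
  refine sup_le ?_ ?_
  · rintro _ ⟨d, rfl⟩
    exact ⟨(0, d), by simp⟩
  · rw [Submodule.span_singleton_le_iff_mem]
    exact ⟨(1, 0), by simp⟩

end FlipSystem

end FlipDynamics

/-! ### The rotation invariant measure on a sphere and the Doeblin condition -/

namespace FlipDynamics

/-- The `ε`-`δ` form of absolute continuity for a finite measure. -/
theorem exists_pos_forall_measure_lt {α : Type*} [MeasurableSpace α] {m μ : Measure α}
    [IsFiniteMeasure m] [SigmaFinite μ] (h : m ≪ μ) {ε : ENNReal} (hε : ε ≠ 0) :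
    ∃ δ > 0, ∀ s, μ s < δ → m s < ε := by
  have hfin : ∫⁻ x, m.rnDeriv μ x ∂μ ≠ ⊤ := by
    rw [Measure.lintegral_rnDeriv h]; exact measure_ne_top _ _
  obtain ⟨δ, hδ, H⟩ := exists_pos_setLIntegral_lt_of_measure_lt hfin hε
  refine ⟨δ, hδ, fun s hs => ?_⟩
  have := H s hs
  rwa [Measure.setLIntegral_rnDeriv h] at this

theorem pi_absolutelyContinuous {ν : Measure ℝ} [IsProbabilityMeasure ν] (hν : ν ≪ volume)
    (n : ℕ) : (Measure.pi fun _ : Fin n => ν) ≪ volume := by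
  induction n with
  | zero =>
    rw [volume_pi, Measure.pi_of_empty (fun _ : Fin 0 => ν),
      Measure.pi_of_empty (fun _ : Fin 0 => (volume : Measure ℝ))]
  | succ n ih =>
    have h1 := measurePreserving_piFinSuccAbove (fun _ : Fin (n + 1) => ν) 0
    have h2 := volume_preserving_piFinSuccAbove (fun _ : Fin (n + 1) => ℝ) 0
    intro s hs
    set e := MeasurableEquiv.piFinSuccAbove (fun _ : Fin (n + 1) => ℝ) 0
    have hs' : s = e ⁻¹' (e.symm ⁻¹' s) := by
      rw [← Set.preimage_comp]; simp
    rw [hs'] at hs ⊢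
    rw [h2.measure_preimage_equiv] at hs
    rw [h1.measure_preimage_equiv]
    exact (hν.prod ih) hs

theorem pi_ball_ne_zero {ν : Measure ℝ} [IsProbabilityMeasure ν]
    (hν : volume.restrict (Set.Ioi 0) ≪ ν) {n : ℕ} {s : Fin n → ℝ} (hs : ∀ i, 0 < s i) {r : ℝ}
    (hr : 0 < r) : (Measure.pi fun _ : Fin n => ν) (Metric.ball s r) ≠ 0 := by
  rw [ball_pi _ hr, Measure.pi_pi, Finset.prod_ne_zero_iff]
  intro i _ h0
  have h1 := hν h0
  rw [Measure.restrict_apply Metric.isOpen_ball.measurableSet] at h1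
  exact ((Metric.isOpen_ball.inter isOpen_Ioi).measure_pos volume
    ⟨s i, Metric.mem_ball_self hr, hs i⟩).ne' h1

section Rays

variable {E : Type*} [NormedAddCommGroup E] [InnerProductSpace ℝ E] [FiniteDimensional ℝ E]
  [MeasurableSpace E] [BorelSpace E]

/-- The radial projection onto the sphere of radius `R`. -/
noncomputable def sphereProj (R : ℝ) (x : E) : E := (R / ‖x‖) • x

/-- The image of Lebesgue measure on a ball under radial projection to the sphere of radius `R`,
a multiple of the surface measure. The ball of radius `2 R` contains a neighbourhood of the sphere,
which is convenient for local arguments. -/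
noncomputable def rayMeasure (R : ℝ) : Measure E :=
  (volume.restrict (Metric.ball (0 : E) (2 * R))).map (sphereProj R)

/-- The uniform probability measure on the sphere of radius `R`. -/
noncomputable def rayProb (R : ℝ) : Measure E :=
  (rayMeasure (E := E) R Set.univ)⁻¹ • rayMeasure R

theorem measurable_sphereProj (R : ℝ) : Measurable (sphereProj (E := E) R) :=
  (measurable_const.div measurable_norm).smul measurable_id

omit [FiniteDimensional ℝ E] [MeasurableSpace E] [BorelSpace E] in
theorem sphereProj_smul {R r : ℝ} (hr : 0 < r) (x : E) : sphereProj R (r • x) = sphereProj R x := by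
  rw [sphereProj, sphereProj, norm_smul, Real.norm_of_nonneg hr.le, smul_smul]
  congr 1
  rcases eq_or_ne ‖x‖ 0 with h | h
  · simp [h]
  · field_simp

omit [FiniteDimensional ℝ E] [MeasurableSpace E] [BorelSpace E] in
theorem sphereProj_of_norm_eq {R : ℝ} (hR : 0 < R) {x : E} (hx : ‖x‖ = R) : sphereProj R x = x := by
  rw [sphereProj, hx, div_self hR.ne', one_smul]

omit [FiniteDimensional ℝ E] [MeasurableSpace E] [BorelSpace E] in
theorem sphereProj_isometry (R : ℝ) (g : E ≃ₗᵢ[ℝ] E) (x : E) :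
    sphereProj R (g x) = g (sphereProj R x) := by
  simp [sphereProj]

theorem rayMeasure_apply (R : ℝ) {B : Set E} (hB : MeasurableSet B) :
    rayMeasure R B = volume {x | x ∈ Metric.ball (0 : E) (2 * R) ∧ sphereProj R x ∈ B} := by
  rw [rayMeasure, Measure.map_apply (measurable_sphereProj R) hB,
    Measure.restrict_apply (measurable_sphereProj R hB)]
  congr 1
  ext x
  simp [and_comm]

theorem rayMeasure_univ (R : ℝ) :
    rayMeasure R (Set.univ : Set E) = volume (Metric.ball (0 : E) (2 * R)) := by
  rw [rayMeasure_apply R MeasurableSet.univ]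
  simp only [Set.mem_univ, and_true, Set.ofPred_mem_eq]

theorem rayMeasure_univ_ne_zero {R : ℝ} (hR : 0 < R) : rayMeasure R (Set.univ : Set E) ≠ 0 := by
  rw [rayMeasure_univ]
  exact (Metric.measure_ball_pos _ _ (by positivity)).ne'

theorem rayMeasure_univ_ne_top (R : ℝ) : rayMeasure R (Set.univ : Set E) ≠ ⊤ := by
  rw [rayMeasure_univ]
  exact measure_ball_lt_top.ne

theorem isProbabilityMeasure_rayProb {R : ℝ} (hR : 0 < R) :
    IsProbabilityMeasure (rayProb (E := E) R) := by
  constructor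
  rw [rayProb, Measure.smul_apply, smul_eq_mul]
  exact ENNReal.inv_mul_cancel (rayMeasure_univ_ne_zero hR) (rayMeasure_univ_ne_top R)

theorem rayMeasure_eq_mul_rayProb {R : ℝ} (hR : 0 < R) (B : Set E) :
    rayMeasure R B = volume (Metric.ball (0 : E) (2 * R)) * rayProb R B := by
  rw [rayProb, Measure.smul_apply, smul_eq_mul, ← mul_assoc, ← rayMeasure_univ,
    ENNReal.mul_inv_cancel (rayMeasure_univ_ne_zero hR) (rayMeasure_univ_ne_top R), one_mul]

theorem measurePreserving_rayProb (R : ℝ) (g : E ≃ₗᵢ[ℝ] E) :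
    MeasurePreserving g (rayProb (E := E) R) (rayProb R) := by
  have hg : MeasurePreserving g (volume : Measure E) volume := g.measurePreserving
  have h1 : (rayMeasure (E := E) R).map g = rayMeasure R := by
    ext B hB
    rw [Measure.map_apply hg.measurable hB, rayMeasure_apply R (hg.measurable hB),
      rayMeasure_apply R hB]
    have hm : MeasurableSet {x | x ∈ Metric.ball (0 : E) (2 * R) ∧ sphereProj R x ∈ B} :=
      Metric.isOpen_ball.measurableSet.inter (measurable_sphereProj R hB)
    rw [← hg.measure_preimage hm.nullMeasurableSet]
    congr 1
    ext x
    simp [sphereProj_isometry]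
  refine ⟨hg.measurable, ?_⟩
  rw [rayProb, Measure.map_smul, h1]

/-- A scale invariant property that holds almost everywhere on a ball holds almost everywhere. -/
theorem ae_of_ae_restrict_ball {p : E → Prop} (hp : ∀ r : ℝ, 0 < r → ∀ x, p (r • x) → p x)
    {ρ : ℝ} (hρ : 0 < ρ) (h : ∀ᵐ x ∂(volume.restrict (Metric.ball (0 : E) ρ)), p x) :
    ∀ᵐ x : E, p x := by
  rw [ae_restrict_iff' Metric.isOpen_ball.measurableSet, ae_iff] at h
  rw [ae_iff]
  set N := {x : E | ¬(x ∈ Metric.ball 0 ρ → p x)} with hN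
  have hsub : {x : E | ¬p x} ⊆ ⋃ n : ℕ, (fun x => ((n : ℝ) + 1) • x) '' N := by
    intro x hx
    obtain ⟨n, hn⟩ := exists_nat_gt (‖x‖ / ρ)
    refine Set.mem_iUnion.2 ⟨n, ?_⟩
    have hn1 : (0 : ℝ) < (n : ℝ) + 1 := by positivity
    refine ⟨((n : ℝ) + 1)⁻¹ • x, ?_, smul_inv_smul₀ hn1.ne' x⟩
    simp only [hN, Set.mem_ofPred_eq, Classical.not_imp, mem_ball_zero_iff]
    refine ⟨?_, fun h => hx (hp _ (inv_pos.2 hn1) _ h)⟩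
    rw [norm_smul, Real.norm_of_nonneg (inv_pos.2 hn1).le, inv_mul_lt_iff₀ hn1]
    rw [div_lt_iff₀ hρ] at hn
    nlinarith
  refine measure_mono_null hsub (measure_iUnion_null fun n => ?_)
  have := Measure.addHaar_smul (volume : Measure E) ((n : ℝ) + 1) N
  rw [h, mul_zero] at this
  exact this

/-- A property holds almost everywhere on the sphere if and only if it holds along almost all rays. -/
theorem ae_rayProb_iff {R : ℝ} (hR : 0 < R) {p : E → Prop} (hp : MeasurableSet {x | p x}) :
    (∀ᵐ x ∂(rayProb (E := E) R), p x) ↔ ∀ᵐ x : E, p (sphereProj R x) := by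
  rw [rayProb, Measure.ae_ennreal_smul_measure_iff
    (ENNReal.inv_ne_zero.2 (rayMeasure_univ_ne_top R)), rayMeasure,
    ae_map_iff (measurable_sphereProj R).aemeasurable hp]
  refine ⟨fun h => ae_of_ae_restrict_ball (fun r hr x hx => ?_) (by positivity) h,
    fun h => ae_restrict_of_ae h⟩
  rwa [sphereProj_smul hr] at hx

end Rays

namespace FlipSystem

variable {E : Type*} [NormedAddCommGroup E] [InnerProductSpace ℝ E] [FiniteDimensional ℝ E]
  (S : FlipSystem E)

/-- The local form of the submersion: `coneMap` is a linear surjection composed with a map that is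
close to the identity, uniformly in the base point. -/
theorem exists_near_identity {x : E} {n : ℕ} {s : Fin n → ℝ}
    (hsurj : (fderiv ℝ (S.coneMap n x) (1, s)).range = ⊤) {c : NNReal} (hc : 0 < c) :
    ∃ (T : ℝ × (Fin n → ℝ) →L[ℝ] E) (F : E × (ℝ × (Fin n → ℝ)) → ℝ × (Fin n → ℝ)),
      Function.Surjective T ∧ (∀ y z, T (F (y, z)) = S.coneMap n y z) ∧
      ∃ z₀ : ℝ × (Fin n → ℝ), ∃ N ∈ 𝓝 (x, ((1 : ℝ), s)), (∀ p ∈ N, F p ∈ Metric.ball z₀ 1) ∧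
        ∀ y, ApproximatesLinearOn (fun z => F (y, z)) (ContinuousLinearMap.id ℝ _)
          {z | (y, z) ∈ N} c := by
  set T := fderiv ℝ (S.coneMap n x) (1, s) with hT
  obtain ⟨J, hJ⟩ := (T : ℝ × (Fin n → ℝ) →ₗ[ℝ] E).exists_rightInverse_of_surjective hsurj
  have hTJ : ∀ e, T (J e) = e := fun e => DFunLike.congr_fun hJ e
  set J' : E →L[ℝ] ℝ × (Fin n → ℝ) := LinearMap.toContinuousLinearMap J with hJ'
  have hJ'J : ∀ e, J' e = J e := fun e => rfl
  set F : E × (ℝ × (Fin n → ℝ)) → ℝ × (Fin n → ℝ) := fun p =>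
    p.2 + J' (S.coneMap n p.1 p.2 - T p.2) with hF
  have hFc : ContDiff ℝ ⊤ F :=
    contDiff_snd.add (J'.contDiff.comp ((S.contDiff_coneMap n).sub (T.contDiff.comp contDiff_snd)))
  have hFd : HasStrictFDerivAt F (fderiv ℝ F (x, (1, s))) (x, (1, s)) :=
    hFc.contDiffAt.hasStrictFDerivAt (by simp)
  -- the partial derivative of `F` at the base point is the identity
  have hF' : ∀ w, fderiv ℝ F (x, (1, s)) (0, w) = w := by
    intro w
    have e1 : HasFDerivAt (fun z => F (x, z))
        ((fderiv ℝ F (x, (1, s))).comp (ContinuousLinearMap.inr ℝ E _)) (1, s) :=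
      hFd.hasFDerivAt.comp (f := fun z => (x, z)) _ (hasFDerivAt_prodMk_right x ((1 : ℝ), s))
    have hTd : HasFDerivAt (S.coneMap n x) T (1, s) :=
      (((S.contDiff_coneMap n).comp (contDiff_const.prodMk contDiff_id)).differentiable
        (by simp) _).hasFDerivAt
    have e2 : HasFDerivAt (fun z => F (x, z))
        (ContinuousLinearMap.id ℝ _ + J'.comp (T - T)) (1, s) :=
      (hasFDerivAt_id _).add (J'.hasFDerivAt.comp _ (hTd.sub T.hasFDerivAt))
    have := DFunLike.congr_fun (e1.unique e2) w
    simpa using this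
  obtain ⟨N, hN, happ⟩ := hFd.approximates_deriv_on_nhds (c := c) (Or.inr hc)
  refine ⟨T, F, LinearMap.range_eq_top.1 hsurj, fun y z => ?_, F (x, (1, s)),
    N ∩ F ⁻¹' Metric.ball (F (x, (1, s))) 1, ?_, fun p hp => hp.2, fun y z hz z' hz' => ?_⟩
  · simp only [hF, map_add, hJ'J, hTJ]
    abel
  · exact inter_mem hN (hFc.continuous.continuousAt.preimage_mem_nhds
      (Metric.ball_mem_nhds _ one_pos))
  · have := happ (x := (y, z)) hz.1 (y := (y, z')) hz'.1
    have e : ((y, z) : E × (ℝ × (Fin n → ℝ))) - (y, z') = (0, z - z') := by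
      rw [Prod.mk_sub_mk, sub_self]
    rw [e, hF'] at this
    refine this.trans (le_of_eq ?_)
    rw [Prod.norm_mk, norm_zero, max_eq_right (norm_nonneg _)]

variable [MeasurableSpace E] [BorelSpace E]

/-- Near each point of the sphere, the chain avoids small sets with a probability that is bounded
below after a fixed number of steps. -/
theorem exists_local_doeblin {ν : Measure ℝ} [IsProbabilityMeasure ν]
    (hν : volume.restrict (Set.Ioi 0) ≪ ν) (hν' : ν ≪ volume) {R : ℝ} (hR : 0 < R) {x : E}
    (hx : ‖x‖ = R) :
    ∃ (n : ℕ) (ε : ℝ) (δ : ENNReal), 0 < ε ∧ 0 < δ ∧ ∀ᶠ y in 𝓝 x, ‖y‖ = R →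
      ∀ B : Set E, MeasurableSet B → rayProb R B ≤ δ →
        (Measure.pi fun _ : Fin n => ν).real {s | wordMap S.step n s y ∈ B} ≤ 1 - ε := by
  obtain ⟨n, s, hs, hsurj⟩ := S.exists_coneMap_surjective
    (x := x) (norm_ne_zero_iff.1 (by rw [hx]; exact hR.ne'))
  set μ := Measure.pi fun _ : Fin n => ν with hμ
  have : (volume : Measure (ℝ × (Fin n → ℝ))).IsAddHaarMeasure := by
    rw [Measure.volume_eq_prod]; infer_instance
  obtain ⟨c, hc, hc0⟩ := (((mul_le_addHaar_image_of_lt_det (volume : Measure (ℝ × (Fin n → ℝ)))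
    (ContinuousLinearMap.id ℝ _) (m := 1 / 2) (by
      simp [ContinuousLinearMap.det]
      )).and self_mem_nhdsWithin)).exists
  obtain ⟨T, F, hTs, hTF, z₀, N, hN, hNb, hNa⟩ := S.exists_near_identity hsurj hc0
  obtain ⟨W, hW, Z, hZ, hWZ⟩ := mem_nhds_prod_iff.1 hN
  -- a ball of letters around `s` and an interval of radii around `1`
  have hZ' : ∀ᶠ z : ℝ × (Fin n → ℝ) in 𝓝 ((1 : ℝ), s), z ∈ Z ∧ 0 < z.1 ∧ z.1 < 2 := by
    refine (eventually_mem_set.2 hZ).and ?_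
    have : ∀ᶠ r : ℝ in 𝓝 1, 0 < r ∧ r < 2 :=
      (lt_mem_nhds one_pos).and (gt_mem_nhds one_lt_two)
    exact (continuous_fst.tendsto ((1 : ℝ), s)).eventually this
  obtain ⟨ρ, hρ, hball⟩ := Metric.eventually_nhds_iff_ball.1 hZ'
  have hball' : ∀ r ∈ Metric.ball (1 : ℝ) ρ, ∀ t ∈ Metric.ball s ρ, (r, t) ∈ Z ∧ 0 < r ∧ r < 2 :=
    fun r hr t ht => hball (r, t) (by rw [← ball_prod_same]; exact ⟨hr, ht⟩)
  set U := Metric.ball s ρ with hU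
  set I := Metric.ball (1 : ℝ) ρ with hI
  have hq0 : μ U ≠ 0 := pi_ball_ne_zero hν hs hρ
  have hq1 : μ U ≠ ⊤ := measure_ne_top _ _
  obtain ⟨δ₁, hδ₁, H₁⟩ := exists_pos_forall_measure_lt (pi_absolutelyContinuous hν' n)
    (ENNReal.half_pos hq0).ne'
  have hIpos : volume I ≠ 0 := (Metric.measure_ball_pos volume _ hρ).ne'
  -- the image of Lebesgue measure on a ball under the surjection `T`
  set m : Measure E := (volume.restrict (Metric.ball z₀ 1)).map T with hm
  have : IsFiniteMeasure (volume.restrict (Metric.ball z₀ 1)) :=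
    ⟨by rw [Measure.restrict_apply_univ]; exact measure_ball_lt_top⟩
  have hmac : m ≪ volume := by
    obtain ⟨a, -, ha⟩ := (T : ℝ × (Fin n → ℝ) →ₗ[ℝ] E).exists_map_addHaar_eq_smul_addHaar
      volume volume hTs
    have h1 : m ≪ (volume : Measure (ℝ × (Fin n → ℝ))).map T :=
      Measure.AbsolutelyContinuous.map Measure.restrict_le_self.absolutelyContinuous T.measurable
    refine h1.trans ?_
    have ha' : (volume : Measure (ℝ × (Fin n → ℝ))).map T = a • volume := ha
    rw [ha']
    exact Measure.smul_absolutelyContinuous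
  obtain ⟨δ₂, hδ₂, H₂⟩ := exists_pos_forall_measure_lt hmac
    (ε := 2⁻¹ * (volume I * δ₁)) (mul_ne_zero (by simp) (mul_ne_zero hIpos hδ₁.ne'))
  set b := volume (Metric.ball (0 : E) (2 * R)) with hb
  have hb0 : b ≠ 0 := (Metric.measure_ball_pos volume _ (by positivity)).ne'
  have hb1 : b ≠ ⊤ := measure_ball_lt_top.ne
  have hδmin : 0 < min δ₂ 1 := lt_min hδ₂ one_pos
  refine ⟨n, (μ U).toReal / 2, b⁻¹ * (min δ₂ 1 / 2), half_pos (ENNReal.toReal_pos hq0 hq1),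
    ENNReal.mul_pos (ENNReal.inv_ne_zero.2 hb1) (ENNReal.half_pos hδmin.ne').ne', ?_⟩
  filter_upwards [hW] with y hyW hy B hB hBδ
  have hw : Measurable fun t : Fin n → ℝ => wordMap S.step n t y :=
    ((S.contDiff_wordMap n).continuous.comp (Continuous.prodMk_left y)).measurable
  set V := {t | t ∈ U ∧ wordMap S.step n t y ∈ B} with hV
  have hVm : MeasurableSet V := Metric.isOpen_ball.measurableSet.inter (hw hB)
  set C := {e | e ∈ Metric.ball (0 : E) (2 * R) ∧ sphereProj R e ∈ B} with hC
  have hCm : MeasurableSet C :=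
    Metric.isOpen_ball.measurableSet.inter (measurable_sphereProj R hB)
  have hCsmall : volume C < δ₂ := by
    rw [← rayMeasure_apply R hB, rayMeasure_eq_mul_rayProb hR]
    calc b * rayProb R B ≤ b * (b⁻¹ * (min δ₂ 1 / 2)) := by gcongr
      _ = min δ₂ 1 / 2 := by rw [← mul_assoc, ENNReal.mul_inv_cancel hb0 hb1, one_mul]
      _ < min δ₂ 1 :=
          ENNReal.half_lt_self hδmin.ne' (ne_top_of_le_ne_top (by simp) (min_le_right _ _))
      _ ≤ δ₂ := min_le_left _ _
  -- scaling by a factor in `(0, 2)` moves the end points of the words in `V` into the cone `C`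
  have himg : (fun z => F (y, z)) '' (I ×ˢ V) ⊆ T ⁻¹' C ∩ Metric.ball z₀ 1 := by
    rintro _ ⟨⟨r, t⟩, ⟨hr, htU, htB⟩, rfl⟩
    obtain ⟨h1, h2, h3⟩ := hball' r hr t htU
    refine ⟨?_, hNb _ (hWZ ⟨hyW, h1⟩)⟩
    have hn : ‖wordMap S.step n t y‖ = R := by rw [norm_wordMap, hy]
    simp only [Set.mem_preimage, hTF, coneMap, hC, Set.mem_ofPred_eq]
    refine ⟨?_, ?_⟩
    · rw [mem_ball_zero_iff, norm_smul, hn, Real.norm_of_nonneg h2.le]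
      nlinarith
    · rwa [sphereProj_smul h2, sphereProj_of_norm_eq hR hn]
  have happ : ApproximatesLinearOn (fun z => F (y, z)) (ContinuousLinearMap.id ℝ _) (I ×ˢ V) c := by
    refine (hNa y).mono_set ?_
    rintro ⟨r, t⟩ ⟨hr, htU, -⟩
    exact hWZ ⟨hyW, (hball' r hr t htU).1⟩
  -- `F (y, ·)` at most halves volumes, so a large `V` would give a large cone `C`
  have hVsmall : volume V < δ₁ := by
    by_contra! hcon
    have h1 := hc _ _ happ
    have h2 : volume ((fun z => F (y, z)) '' (I ×ˢ V)) ≤ m C := by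
      rw [hm, Measure.map_apply T.measurable hCm,
        Measure.restrict_apply (T.measurable hCm)]
      exact measure_mono himg
    have h3 := (h1.trans h2).trans_lt (H₂ C hCsmall)
    rw [Measure.volume_eq_prod, Measure.prod_prod] at h3
    refine absurd h3 (not_lt.2 ?_)
    have : ((1 / 2 : NNReal) : ENNReal) = 2⁻¹ := by simp
    rw [this]
    gcongr
  have hle : μ {t | wordMap S.step n t y ∈ B} ≤ μ V + μ Uᶜ := by
    refine (measure_mono ?_).trans (measure_union_le _ _)
    intro t ht
    by_cases h : t ∈ U
    · exact Or.inl ⟨h, ht⟩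
    · exact Or.inr h
  have hreal : μ.real {t | wordMap S.step n t y ∈ B} ≤ μ.real V + μ.real Uᶜ := by
    have := ENNReal.toReal_mono (by finiteness) hle
    rwa [ENNReal.toReal_add (by finiteness) (by finiteness)] at this
  have hVr : μ.real V ≤ (μ U).toReal / 2 := by
    have := ENNReal.toReal_mono (by finiteness) (H₁ V hVsmall).le
    simpa [Measure.real] using this
  rw [probReal_compl_eq_one_sub Metric.isOpen_ball.measurableSet] at hreal
  have : μ.real U = (μ U).toReal := rfl
  linarith

/-- The local statement, made uniform over the sphere by compactness. -/
theorem exists_doeblin {ν : Measure ℝ} [IsProbabilityMeasure ν]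
    (hν : volume.restrict (Set.Ioi 0) ≪ ν) (hν' : ν ≪ volume) {R : ℝ} (hR : 0 < R) :
    ∃ (nmax : ℕ) (ε : ℝ) (δ : ENNReal), 0 < ε ∧ 0 < δ ∧ ∀ y ∈ Metric.sphere (0 : E) R,
      ∃ n ≤ nmax, ∀ B : Set E, MeasurableSet B → rayProb R B ≤ δ →
        (Measure.pi fun _ : Fin n => ν).real {s | wordMap S.step n s y ∈ B} ≤ 1 - ε := by
  refine (isCompact_sphere (0 : E) R).induction_on
    (p := fun K => ∃ (nmax : ℕ) (ε : ℝ) (δ : ENNReal), 0 < ε ∧ 0 < δ ∧ ∀ y ∈ K,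
      ∃ n ≤ nmax, ∀ B : Set E, MeasurableSet B → rayProb R B ≤ δ →
        (Measure.pi fun _ : Fin n => ν).real {s | wordMap S.step n s y ∈ B} ≤ 1 - ε) ?_ ?_ ?_ ?_
  · exact ⟨0, 1, 1, one_pos, one_pos, by simp⟩
  · rintro K K' hKK' ⟨nmax, ε, δ, hε, hδ, h⟩
    exact ⟨nmax, ε, δ, hε, hδ, fun y hy => h y (hKK' hy)⟩
  · rintro K K' ⟨n₁, ε₁, δ₁, hε₁, hδ₁, h₁⟩ ⟨n₂, ε₂, δ₂, hε₂, hδ₂, h₂⟩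
    refine ⟨max n₁ n₂, min ε₁ ε₂, min δ₁ δ₂, lt_min hε₁ hε₂, lt_min hδ₁ hδ₂, ?_⟩
    rintro y (hy | hy)
    · obtain ⟨n, hn, h⟩ := h₁ y hy
      refine ⟨n, hn.trans (le_max_left _ _), fun B hB hBδ => ?_⟩
      have := h B hB (hBδ.trans (min_le_left _ _))
      linarith [min_le_left ε₁ ε₂]
    · obtain ⟨n, hn, h⟩ := h₂ y hy
      refine ⟨n, hn.trans (le_max_right _ _), fun B hB hBδ => ?_⟩
      have := h B hB (hBδ.trans (min_le_right _ _))
      linarith [min_le_right ε₁ ε₂]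
  · intro x hx
    obtain ⟨n, ε, δ, hε, hδ, h⟩ := S.exists_local_doeblin hν hν' hR (mem_sphere_zero_iff_norm.1 hx)
    refine ⟨{y | ‖y‖ = R → ∀ B : Set E, MeasurableSet B → rayProb R B ≤ δ →
        (Measure.pi fun _ : Fin n => ν).real {s | wordMap S.step n s y ∈ B} ≤ 1 - ε} ∩
        Metric.sphere 0 R,
      inter_mem (mem_nhdsWithin_of_mem_nhds h) self_mem_nhdsWithin, n, ε, δ, hε, hδ, ?_⟩
    rintro y ⟨hy, hy'⟩
    exact ⟨n, le_rfl, hy (mem_sphere_zero_iff_norm.1 hy')⟩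

end FlipSystem

end FlipDynamics

/-! ### Ergodicity -/

namespace FlipDynamics

namespace FlipSystem

variable {E : Type*} [NormedAddCommGroup E] [InnerProductSpace ℝ E] [FiniteDimensional ℝ E]
  (S : FlipSystem E)

theorem wordMap_invariant {c : E → ℝ} (hc : ∀ s, 0 < s → ∀ x, c (S.step s x) = c x) (n : ℕ)
    {s : Fin n → ℝ} (hs : ∀ i, 0 < s i) (x : E) : c (wordMap S.step n s x) = c x := by
  induction n with
  | zero => rfl
  | succ n ih => rw [wordMap, hc _ (hs _), ih fun i => hs _]

/-- A scale invariant function that is invariant under all steps is constant: it is locally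
constant because compositions of steps are submersions. -/
theorem eq_of_invariant (hdim : 1 < Module.finrank ℝ E) {c : E → ℝ}
    (hc : ∀ s, 0 < s → ∀ x, c (S.step s x) = c x) (hr : ∀ r : ℝ, 0 < r → ∀ x, c (r • x) = c x)
    {x y : E} (hx : x ≠ 0) (hy : y ≠ 0) : c y = c x := by
  have hloc : ∀ x : E, x ≠ 0 → ∀ᶠ w in 𝓝 x, c w = c x := by
    intro x hx
    obtain ⟨n, s, hs, hsurj⟩ := S.exists_coneMap_surjective hx
    have hd : HasStrictFDerivAt (S.coneMap n x) (fderiv ℝ (S.coneMap n x) (1, s)) (1, s) :=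
      ((S.contDiff_coneMap n).comp (contDiff_const.prodMk contDiff_id)).contDiffAt.hasStrictFDerivAt
        (by simp)
    have hmap := hd.map_nhds_eq_of_surj hsurj
    have h1 : ∀ᶠ z : ℝ × (Fin n → ℝ) in 𝓝 ((1 : ℝ), s), c (S.coneMap n x z) = c x := by
      have hz1 : ∀ᶠ z : ℝ × (Fin n → ℝ) in 𝓝 ((1 : ℝ), s), 0 < z.1 :=
        (continuous_fst.tendsto ((1 : ℝ), s)).eventually (lt_mem_nhds one_pos)
      have hz2 : ∀ᶠ z : ℝ × (Fin n → ℝ) in 𝓝 ((1 : ℝ), s), ∀ i, 0 < z.2 i :=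
        eventually_all.2 fun i => (((continuous_apply i).comp continuous_snd).tendsto
          ((1 : ℝ), s)).eventually (lt_mem_nhds (hs i))
      filter_upwards [hz1, hz2] with z h1 h2
      rw [coneMap, hr _ h1, S.wordMap_invariant hc n h2]
    have h2 : ∀ᶠ w in 𝓝 (S.coneMap n x (1, s)), c w = c x := by
      rw [← hmap]; exact h1
    have hcont : Continuous fun w : E => wordMap S.step n s w :=
      (S.contDiff_wordMap n).continuous.comp (Continuous.prodMk_right s)
    rw [coneMap, one_smul] at h2
    filter_upwards [hcont.continuousAt.eventually h2] with w hw
    rwa [S.wordMap_invariant hc n hs] at hw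
  have hconn : IsPreconnected ({0}ᶜ : Set E) := by
    refine (isConnected_compl_singleton_of_one_lt_rank ?_ 0).isPreconnected
    rw [← Module.finrank_eq_rank]
    exact_mod_cast hdim
  set u := {w : E | w ≠ 0 ∧ c w = c x} with hu
  set v := {w : E | w ≠ 0 ∧ c w ≠ c x} with hv
  have huo : IsOpen u := isOpen_iff_mem_nhds.2 fun w ⟨hw, hcw⟩ => by
    filter_upwards [hloc w hw, isOpen_ne.mem_nhds hw] with z hz hz0
    exact ⟨hz0, hz.trans hcw⟩
  have hvo : IsOpen v := isOpen_iff_mem_nhds.2 fun w ⟨hw, hcw⟩ => by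
    filter_upwards [hloc w hw, isOpen_ne.mem_nhds hw] with z hz hz0
    exact ⟨hz0, by rwa [hz]⟩
  have hsub := hconn.subset_left_of_subset_union huo hvo
    (Set.disjoint_left.2 fun w h1 h2 => h2.2 h1.2)
    (fun w hw => by
      by_cases h : c w = c x
      · exact Or.inl ⟨hw, h⟩
      · exact Or.inr ⟨hw, h⟩) ⟨x, hx, hx, rfl⟩
  exact (hsub hy).2

variable [MeasurableSpace E] [BorelSpace E]

open scoped Pointwise in
/-- Ergodicity. The averages of an invariant function over the balls `B(x, r ‖x‖)` are invariant
everywhere, hence constant; by Lebesgue's differentiation theorem so is the function. -/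
theorem ae_eq_const_of_invariant (hdim : 1 < Module.finrank ℝ E) {R : ℝ} (hR : 0 < R) {u : E → ℝ}
    (hu : Measurable u) (hinv : ∀ s, 0 < s → u ∘ S.step s =ᵐ[rayProb R] u) :
    ∃ c : ℝ, u =ᵐ[rayProb R] fun _ => c := by
  -- the arctangent makes the function bounded, hence locally integrable
  set U : E → ℝ := fun x => Real.arctan (u (sphereProj R x)) with hU
  have hUm : Measurable U := Real.measurable_arctan.comp (hu.comp (measurable_sphereProj R))
  have hUb : ∀ x, |U x| ≤ Real.pi / 2 := fun x => abs_le.2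
    ⟨(Real.neg_pi_div_two_lt_arctan _).le, (Real.arctan_lt_pi_div_two _).le⟩
  have hUi : LocallyIntegrable U volume :=
    (MeasureTheory.locallyIntegrable_const (Real.pi / 2)).mono hUm.aestronglyMeasurable
      (Eventually.of_forall fun x => by
        rw [Real.norm_eq_abs, Real.norm_eq_abs, abs_of_pos Real.pi_div_two_pos]; exact hUb x)
  have hUr : ∀ r : ℝ, 0 < r → ∀ x, U (r • x) = U x := fun r hr x => by
    simp only [hU, sphereProj_smul hr]
  have hUs : ∀ s, 0 < s → ∀ᵐ x, U (S.stepIso s x) = U x := by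
    intro s hs
    have hm : Measurable (S.step s) := (S.stepIso s).continuous.measurable
    have h := (ae_rayProb_iff hR (p := fun x => u (S.step s x) = u x)
      (measurableSet_eq_fun (hu.comp hm) hu)).1 (hinv s hs)
    filter_upwards [h] with x hx
    simp only [hU, sphereProj_isometry]
    congr 1
  set avg : ℝ → E → ℝ := fun r x => ⨍ y in Metric.closedBall x (r * ‖x‖), U y with havg
  have havg_step : ∀ r s, 0 < s → ∀ x, avg r (S.step s x) = avg r x := by
    intro r s hs x
    have hmp : MeasurePreserving (S.stepIso s) (volume : Measure E) volume :=
      (S.stepIso s).measurePreserving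
    have hpre : S.stepIso s ⁻¹' Metric.closedBall (S.stepIso s x) (r * ‖x‖) =
        Metric.closedBall x (r * ‖x‖) := by
      ext y; simp
    simp only [havg, norm_step]
    change ⨍ y in Metric.closedBall (S.stepIso s x) (r * ‖x‖), U y = _
    rw [setAverage_eq, setAverage_eq, Measure.real, Measure.real,
      Measure.addHaar_closedBall_center, Measure.addHaar_closedBall_center volume x,
      ← hmp.setIntegral_preimage_emb (S.stepIso s).toHomeomorph.measurableEmbedding, hpre]
    congr 1
    exact integral_congr_ae (ae_restrict_of_ae (hUs s hs))
  have havg_smul : ∀ r, ∀ a : ℝ, 0 < a → ∀ x, avg r (a • x) = avg r x := by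
    intro r a ha x
    have hball : a • Metric.closedBall x (r * ‖x‖) = Metric.closedBall (a • x) (r * ‖a • x‖) := by
      rw [smul_closedBall' ha.ne', norm_smul, Real.norm_of_nonneg ha.le]
      congr 1; ring
    have h1 := Measure.setIntegral_comp_smul_of_pos (volume : Measure E) U
      (Metric.closedBall x (r * ‖x‖)) ha
    simp only [hUr a ha] at h1
    simp only [havg]
    have hpos : (0 : ℝ) < a ^ Module.finrank ℝ E := by positivity
    rw [setAverage_eq, setAverage_eq, h1, ← hball, Measure.real, Measure.real,
      Measure.addHaar_smul, ENNReal.toReal_mul, abs_of_pos hpos,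
      ENNReal.toReal_ofReal hpos.le, smul_smul, mul_inv, mul_comm]
  obtain ⟨x₀, hx₀⟩ : ∃ x : E, x ≠ 0 := by
    have : Nontrivial E := Module.finrank_pos_iff.1 (by omega : 0 < Module.finrank ℝ E)
    exact exists_ne 0
  have havg_const : ∀ r, ∀ x : E, x ≠ 0 → avg r x = avg r x₀ := fun r x hx =>
    S.eq_of_invariant hdim (havg_step r) (havg_smul r) hx₀ hx
  have hlim : ∀ᵐ x : E, x ≠ 0 →
      Tendsto (fun n : ℕ => avg (1 / ((n : ℝ) + 1)) x₀) atTop (𝓝 (U x)) := by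
    filter_upwards [IsUnifLocDoublingMeasure.ae_tendsto_average volume hUi 1] with x hx hx0
    have hn : 0 < ‖x‖ := norm_pos_iff.2 hx0
    have := hx (l := atTop) (fun _ : ℕ => x) (fun n : ℕ => 1 / ((n : ℝ) + 1) * ‖x‖) ?_
      (Eventually.of_forall fun n => Metric.mem_closedBall_self (by positivity))
    · refine this.congr fun n => ?_
      exact havg_const _ x hx0
    · refine tendsto_nhdsWithin_iff.2 ⟨?_, Eventually.of_forall fun n => ?_⟩
      · simpa using tendsto_one_div_add_atTop_nhds_zero_nat.mul_const ‖x‖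
      · exact Set.mem_Ioi.2 (by positivity)
  have hne : ∀ᵐ x : E, x ≠ 0 := by
    have : Nontrivial E := ⟨x₀, 0, hx₀⟩
    rw [ae_iff]
    simp
  obtain ⟨x₁, h1⟩ := (hlim.and hne).exists
  refine ⟨Real.tan (U x₁), (ae_rayProb_iff hR (p := fun x => u x = Real.tan (U x₁))
    (measurableSet_eq_fun hu measurable_const)).2 ?_⟩
  filter_upwards [hlim, hne] with x h2 h3
  have := tendsto_nhds_unique (h1.1 h1.2) (h2 h3)
  rw [this]
  exact (Real.tan_arctan _).symm

section Strong

variable {ν : Measure ℝ} [IsProbabilityMeasure ν] {Ω : Type*} [MeasurableSpace Ω] {P : Measure Ω}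
  [IsProbabilityMeasure P] {τ : ℕ → Ω → ℝ}

omit [MeasurableSpace E] [BorelSpace E] in
theorem step_mem_sphere {R : ℝ} (s : ℝ) (x : E) (hx : x ∈ Metric.sphere (0 : E) R) :
    S.step s x ∈ Metric.sphere (0 : E) R := by
  rw [mem_sphere_zero_iff_norm] at hx ⊢
  rw [norm_step, hx]

/-- The strong law of large numbers for the chain of flip states, from every starting point. -/
theorem ae_tendsto_average (hdim : 1 < Module.finrank ℝ E)
    (hν : volume.restrict (Set.Ioi 0) ≪ ν) (hν' : ν ≪ volume)
    (hτ : ∀ n, Measurable (τ n)) (hind : iIndepFun τ P) (hlaw : ∀ n, P.map (τ n) = ν)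
    {R : ℝ} (hR : 0 < R) {x : E} (hx : ‖x‖ = R) {G : E × ℝ → ℝ} (hG : Measurable G) {C : ℝ}
    (hC : ∀ p, |G p| ≤ C) :
    ∀ᵐ ω ∂P, Tendsto (fun n : ℕ =>
      (∑ i ∈ Finset.range n, G (chain S.step (fun i => τ i ω) x i, τ i ω)) / n) atTop
      (𝓝 (∫ y, ∫ s, G (y, s) ∂ν ∂(rayProb R))) := by
  have := isProbabilityMeasure_rayProb (E := E) hR
  have : ProperSpace E := FiniteDimensional.proper ℝ E
  have hstep := S.contDiff_step.continuous
  obtain ⟨nmax, ε, δ, hε, hδ, hD⟩ := S.exists_doeblin hν hν' hR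
  have hgm : Measurable fun y => ∫ s, G (y, s) ∂ν :=
    (StronglyMeasurable.integral_prod_right (f := fun y s => G (y, s))
      hG.stronglyMeasurable).measurable
  have hgb : ∀ y, |∫ s, G (y, s) ∂ν| ≤ C := fun y => abs_integral_le_of_bound fun s => hC _
  refine ae_tendsto_average_pair_of_cesaro hstep.measurable S.step_mem_sphere hτ hind hlaw
    (mem_sphere_zero_iff_norm.2 hx) hG hC fun η hη => ?_
  refine exists_cesaro_uniform hstep.measurable S.step_mem_sphere hε hδ hD hgm hgb
    (fun η hη => ?_) hη
  exact tendsto_measure_cesaro hstep (fun s => measurePreserving_rayProb R (S.stepIso s)) hν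
    (fun u hu hinv => S.ae_eq_const_of_invariant hdim hR hu hinv) hgm hgb hη

end Strong

end FlipSystem

end FlipDynamics

/-! ### Time averages -/

namespace FlipDynamics

section Renewal

/-- From averages over complete cycles to averages over time: the cycle that contains `T` is
incomplete, but its length is negligible because `t n / n` converges. -/
theorem tendsto_timeAverage {t : ℕ → ℝ} (ht0 : t 0 = 0) (ht : StrictMono t) {m : ℝ} (hm : 0 < m)
    (htm : Tendsto (fun n : ℕ => t n / n) atTop (𝓝 m)) {g : ℝ → ℝ} {C : ℝ}
    (hC : ∀ s, 0 ≤ s → |g s| ≤ C) (hint : ∀ n, IntervalIntegrable g volume 0 (t n)) {c : ℝ}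
    (hc : Tendsto (fun n : ℕ => (∫ s in (0 : ℝ)..t n, g s) / n) atTop (𝓝 (m * c))) :
    Tendsto (fun T : ℝ => T⁻¹ * ∫ s in (0 : ℝ)..T, g s) atTop (𝓝 c) := by
  have htop : Tendsto t atTop atTop := by
    have h1 : Tendsto (fun n : ℕ => (t n / n) * (n : ℝ)) atTop atTop :=
      htm.pos_mul_atTop hm tendsto_natCast_atTop_atTop
    refine h1.congr' ?_
    filter_upwards [eventually_gt_atTop 0] with n hn
    have : (n : ℝ) ≠ 0 := by exact_mod_cast hn.ne'
    field_simp
  have hex : ∀ T : ℝ, ∃ n, 0 ≤ T → t n ≤ T ∧ T < t (n + 1) := by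
    intro T
    by_cases hT : 0 ≤ T
    · classical
      have hE : ∃ n, T < t n := (htop.eventually_gt_atTop T).exists
      have h0 : Nat.find hE ≠ 0 := fun h => by
        have := Nat.find_spec hE
        rw [h, ht0] at this
        linarith
      obtain ⟨k, hk⟩ := Nat.exists_eq_succ_of_ne_zero h0
      refine ⟨k, fun _ => ⟨?_, ?_⟩⟩
      · exact not_lt.1 (Nat.find_min hE (by omega))
      · have := Nat.find_spec hE
        rwa [hk] at this
    · exact ⟨0, fun h => absurd h hT⟩
  choose n hn using hex
  have hntop : Tendsto n atTop atTop := by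
    refine tendsto_atTop.2 fun b => ?_
    filter_upwards [eventually_ge_atTop (t b), eventually_ge_atTop 0] with T hT hT0
    have := ht.lt_iff_lt.1 (hT.trans_lt (hn T hT0).2)
    omega
  have hn1 : ∀ᶠ T in atTop, 0 < n T := hntop.eventually_gt_atTop 0
  have hsucc : Tendsto (fun k : ℕ => t (k + 1) / k) atTop (𝓝 m) := by
    have h1 := (htm.comp (tendsto_add_atTop_nat 1)).mul
      ((tendsto_natCast_div_add_atTop (1 : ℝ)).inv₀ one_ne_zero)
    rw [inv_one, mul_one] at h1
    refine h1.congr' ?_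
    filter_upwards [eventually_gt_atTop 0] with k hk
    have : (k : ℝ) ≠ 0 := by exact_mod_cast hk.ne'
    simp only [Function.comp_apply, Nat.cast_add, Nat.cast_one]
    field_simp
  have hT : Tendsto (fun T : ℝ => T / n T) atTop (𝓝 m) := by
    refine tendsto_of_tendsto_of_tendsto_of_le_of_le' (htm.comp hntop) (hsucc.comp hntop) ?_ ?_
    · filter_upwards [eventually_ge_atTop 0] with T hT
      exact div_le_div_of_nonneg_right (hn T hT).1 (Nat.cast_nonneg _)
    · filter_upwards [eventually_ge_atTop 0] with T hT
      exact div_le_div_of_nonneg_right (hn T hT).2.le (Nat.cast_nonneg _)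
  have hdiff : Tendsto (fun T : ℝ => C * (T / n T - t (n T) / n T)) atTop (𝓝 0) := by
    have := (hT.sub (htm.comp hntop)).const_mul C
    simpa using this
  have hrem : Tendsto (fun T : ℝ => (∫ s in t (n T)..T, g s) / n T) atTop (𝓝 0) := by
    refine squeeze_zero_norm' ?_ hdiff
    filter_upwards [eventually_ge_atTop 0, hn1] with T hT hnT
    have h1 := (hn T hT).1
    have h0 : 0 ≤ t (n T) := ht0 ▸ ht.monotone (Nat.zero_le _)
    have h2 : ‖∫ s in t (n T)..T, g s‖ ≤ C * |T - t (n T)| := by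
      refine intervalIntegral.norm_integral_le_of_norm_le_const fun s hs => ?_
      rw [Set.uIoc_of_le h1] at hs
      exact hC s (h0.trans hs.1.le)
    rw [norm_div, Real.norm_natCast, ← sub_div, ← mul_div_assoc]
    rw [abs_of_nonneg (sub_nonneg.2 h1)] at h2
    exact div_le_div_of_nonneg_right h2 (Nat.cast_nonneg _)
  have hsum := (hc.comp hntop).add hrem
  have hquot := hsum.div hT hm.ne'
  rw [add_zero, mul_div_cancel_left₀ _ hm.ne'] at hquot
  refine hquot.congr' ?_
  filter_upwards [eventually_gt_atTop 0, hn1] with T hT hnT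
  have hn' : (n T : ℝ) ≠ 0 := by exact_mod_cast hnT.ne'
  obtain ⟨h1, h2⟩ := hn T hT.le
  have h0 : 0 ≤ t (n T) := ht0 ▸ ht.monotone (Nat.zero_le _)
  have hi : IntervalIntegrable g volume (t (n T)) T := by
    refine (hint (n T + 1)).mono_set ?_
    rw [Set.uIcc_of_le h1, Set.uIcc_of_le (h0.trans (h1.trans h2.le))]
    exact Set.Icc_subset_Icc h0 h2.le
  simp only [Function.comp_apply, Pi.div_apply]
  rw [← add_div, intervalIntegral.integral_add_adjacent_intervals (hint _) hi]
  field_simp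

/-- Removing a truncation: `a K n` are averages of truncated quantities, and the truncation error
is dominated by that of the averages `b K n` of truncated gaps. -/
theorem tendsto_of_truncation {a : ℕ → ℕ → ℝ} {a' : ℕ → ℝ} {b : ℕ → ℕ → ℝ} {b' : ℕ → ℝ}
    {mK : ℕ → ℝ} {m c C : ℝ} (hmK : Tendsto mK atTop (𝓝 m))
    (ha : ∀ K, Tendsto (a K) atTop (𝓝 (mK K * c))) (hb : ∀ K, Tendsto (b K) atTop (𝓝 (mK K)))
    (hb' : Tendsto b' atTop (𝓝 m)) (hle : ∀ K n, |a' n - a K n| ≤ C * (b' n - b K n)) :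
    Tendsto a' atTop (𝓝 (m * c)) := by
  rw [Metric.tendsto_atTop]
  intro ε hε
  have h1 : Tendsto (fun K => C * (m - mK K)) atTop (𝓝 0) := by
    simpa using ((tendsto_const_nhds (x := m)).sub hmK).const_mul C
  have h2 : Tendsto (fun K => |mK K * c - m * c|) atTop (𝓝 0) := by
    simpa using ((hmK.mul_const c).sub_const (m * c)).abs
  obtain ⟨K, hK1, hK2⟩ := ((h1.eventually_lt_const (show (0 : ℝ) < ε / 3 by positivity)).and
    (h2.eventually_lt_const (show (0 : ℝ) < ε / 3 by positivity))).exists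
  have h3 : ∀ᶠ n in atTop, C * (b' n - b K n) < ε / 3 :=
    ((hb'.sub (hb K)).const_mul C).eventually_lt_const hK1
  have h4 : ∀ᶠ n in atTop, |a K n - mK K * c| < ε / 3 := by
    have := ((ha K).sub_const (mK K * c)).abs
    rw [sub_self, abs_zero] at this
    exact this.eventually_lt_const (by positivity)
  obtain ⟨n₀, hn₀⟩ := eventually_atTop.1 (h3.and h4)
  refine ⟨n₀, fun n hn => ?_⟩
  obtain ⟨h5, h6⟩ := hn₀ n hn
  have h7 := hle K n
  rw [Real.dist_eq]
  have e : a' n - m * c = (a' n - a K n) + (a K n - mK K * c) + (mK K * c - m * c) := by ring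
  rw [e]
  have h8 := abs_add_three (a' n - a K n) (a K n - mK K * c) (mK K * c - m * c)
  linarith

end Renewal

namespace FlipSystem

variable {E : Type*} [NormedAddCommGroup E] [InnerProductSpace ℝ E] [FiniteDimensional ℝ E]
  (S : FlipSystem E) [MeasurableSpace E] [BorelSpace E]

omit [MeasurableSpace E] [BorelSpace E] in
theorem continuous_rot_comp {X : Type*} [TopologicalSpace X] {a : X → ℝ} {b : X → E}
    (ha : Continuous a) (hb : Continuous b) : Continuous fun q => S.rot (a q) (b q) :=
  Continuous.comp (g := fun p : ℝ × E => S.rot p.1 p.2) (f := fun q => (a q, b q))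
    S.contDiff_rot.continuous (ha.prodMk hb)

/-- The integral of `f` along the flow during the time `s`, that is `∫₀ˢ f(e^{uA} x) du`, written
as an integral over a fixed interval. -/
noncomputable def cycleIntegral (f : E → ℝ) (x : E) (s : ℝ) : ℝ :=
  s * ∫ u in Set.Ioc (0 : ℝ) 1, f (S.rot (s * u) x)

omit [MeasurableSpace E] [BorelSpace E] in
theorem cycleIntegral_eq (f : E → ℝ) (x : E) (s : ℝ) :
    S.cycleIntegral f x s = ∫ u in (0 : ℝ)..s, f (S.rot u x) := by
  have := intervalIntegral.smul_integral_comp_mul_left (a := 0) (b := 1)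
    (fun u => f (S.rot u x)) s
  rw [mul_zero, mul_one, smul_eq_mul, intervalIntegral.integral_of_le zero_le_one] at this
  exact this

variable {f : E → ℝ} {C : ℝ}

theorem measurable_flow_comp (hf : Measurable f) (x : E) : Measurable fun u => f (S.rot u x) :=
  hf.comp (S.continuous_rot_comp continuous_id continuous_const).measurable

theorem intervalIntegrable_flow_comp (hf : Measurable f) (hC : ∀ x, |f x| ≤ C) (x : E) (a b : ℝ) :
    IntervalIntegrable (fun u => f (S.rot u x)) volume a b :=
  (intervalIntegrable_const (c := C)).mono_fun (S.measurable_flow_comp hf x).aestronglyMeasurable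
    (Eventually.of_forall fun u => (hC _).trans (le_abs_self C))

theorem measurable_cycleIntegral (hf : Measurable f) :
    Measurable fun p : E × ℝ => S.cycleIntegral f p.1 p.2 := by
  have h : Measurable fun q : (E × ℝ) × ℝ => f (S.rot (q.1.2 * q.2) q.1.1) := by
    have : Continuous fun q : (E × ℝ) × ℝ => S.rot (q.1.2 * q.2) q.1.1 :=
      S.continuous_rot_comp (by fun_prop) (by fun_prop)
    exact hf.comp this.measurable
  exact measurable_snd.mul (StronglyMeasurable.integral_prod_right
    (ν := volume.restrict (Set.Ioc (0 : ℝ) 1))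
    (f := fun (p : E × ℝ) u => f (S.rot (p.2 * u) p.1)) h.stronglyMeasurable).measurable

theorem abs_cycleIntegral_sub_le (hf : Measurable f) (hC : ∀ x, |f x| ≤ C) (x : E) (s t : ℝ) :
    |S.cycleIntegral f x s - S.cycleIntegral f x t| ≤ C * |s - t| := by
  rw [cycleIntegral_eq, cycleIntegral_eq, intervalIntegral.integral_interval_sub_left
    (S.intervalIntegrable_flow_comp hf hC x _ _) (S.intervalIntegrable_flow_comp hf hC x _ _)]
  exact intervalIntegral.norm_integral_le_of_norm_le_const (f := fun u => f (S.rot u x))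
    fun u _ => hC _

/-- The flow preserves the uniform measure, so a cycle of length `s` contributes `s` times the mean
of `f`. -/
theorem integral_cycleIntegral {R : ℝ} (hR : 0 < R) (hf : Measurable f) (hC : ∀ x, |f x| ≤ C)
    (s : ℝ) : ∫ y, S.cycleIntegral f y s ∂(rayProb R) = s * ∫ y, f y ∂(rayProb R) := by
  have := isProbabilityMeasure_rayProb (E := E) hR
  simp only [cycleIntegral]
  rw [integral_const_mul, integral_integral_swap]
  · have h : ∀ u : ℝ, ∫ y, f (S.rot (s * u) y) ∂(rayProb R) = ∫ y, f y ∂(rayProb R) := fun u =>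
      (measurePreserving_rayProb R (S.rot (s * u))).integral_comp
        (S.rot (s * u)).toHomeomorph.measurableEmbedding f
    simp [h]
  · refine Integrable.of_bound ?_ C (Eventually.of_forall fun q => hC _)
    have : Continuous fun q : E × ℝ => S.rot (s * q.2) q.1 :=
      S.continuous_rot_comp (by fun_prop) (by fun_prop)
    exact (hf.comp this.measurable).aestronglyMeasurable

variable {ν : Measure ℝ} [IsProbabilityMeasure ν] {Ω : Type*} [MeasurableSpace Ω] {P : Measure Ω}
  [IsProbabilityMeasure P] {τ : ℕ → Ω → ℝ}

/-- Averages of the cycle integrals. The gaps are truncated at a fixed level, and the error is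
controlled by the strong law for the gaps. -/
theorem ae_tendsto_average_cycleIntegral (hdim : 1 < Module.finrank ℝ E)
    (hν : volume.restrict (Set.Ioi 0) ≪ ν) (hν' : ν ≪ volume)
    (hτ : ∀ n, Measurable (τ n)) (hind : iIndepFun τ P) (hlaw : ∀ n, P.map (τ n) = ν)
    (hpos : ∀ᵐ ω ∂P, ∀ n, 0 < τ n ω) (hmean : Integrable (τ 0) P)
    {R : ℝ} (hR : 0 < R) {x : E} (hx : ‖x‖ = R) (hf : Measurable f) (hC : ∀ x, |f x| ≤ C) :
    ∀ᵐ ω ∂P,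
      Tendsto (fun n : ℕ => (∑ i ∈ Finset.range n, τ i ω) / n) atTop (𝓝 (∫ ω, τ 0 ω ∂P)) ∧
      Tendsto (fun n : ℕ => (∑ i ∈ Finset.range n,
        S.cycleIntegral f (chain S.step (fun i => τ i ω) x i) (τ i ω)) / n) atTop
        (𝓝 ((∫ ω, τ 0 ω ∂P) * ∫ y, f y ∂(rayProb R))) := by
  have := isProbabilityMeasure_rayProb (E := E) hR
  have hC0 : 0 ≤ C := (abs_nonneg _).trans (hC 0)
  set clamp : ℕ → ℝ → ℝ := fun K s => max 0 (min s K) with hclamp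
  have hcm : ∀ K, Measurable (clamp K) := fun K =>
    measurable_const.max (measurable_id.min measurable_const)
  have hc0 : ∀ K s, 0 ≤ clamp K s := fun K s => le_max_left _ _
  have hcK : ∀ K s, clamp K s ≤ K := fun K s => max_le (Nat.cast_nonneg K) (min_le_right _ _)
  have hcs : ∀ K s, 0 ≤ s → clamp K s ≤ s := fun K s hs => max_le hs (min_le_left _ _)
  have hlln : ∀ᵐ ω ∂P, Tendsto (fun n : ℕ => (∑ i ∈ Finset.range n, τ i ω) / n) atTop
      (𝓝 (∫ ω, τ 0 ω ∂P)) :=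
    strong_law_ae_real τ hmean (fun i j hij => hind.indepFun hij) fun i =>
      ⟨(hτ i).aemeasurable, (hτ 0).aemeasurable, by rw [hlaw, hlaw]⟩
  have hcl : ∀ᵐ ω ∂P, ∀ K, Tendsto (fun n : ℕ => (∑ i ∈ Finset.range n, clamp K (τ i ω)) / n) atTop
      (𝓝 (∫ s, clamp K s ∂ν)) := by
    refine ae_all_iff.2 fun K => ?_
    have := S.ae_tendsto_average hdim hν hν' hτ hind hlaw hR hx (G := fun p => clamp K p.2)
      ((hcm K).comp measurable_snd) (C := K) fun p => by
        rw [abs_of_nonneg (hc0 _ _)]; exact hcK _ _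
    simpa using this
  have hFb : ∀ y s, |S.cycleIntegral f y s| ≤ C * |s| := fun y s => by
    have := S.abs_cycleIntegral_sub_le hf hC y s 0
    simpa [cycleIntegral] using this
  have hF : ∀ᵐ ω ∂P, ∀ K, Tendsto (fun n : ℕ => (∑ i ∈ Finset.range n,
      S.cycleIntegral f (chain S.step (fun i => τ i ω) x i) (clamp K (τ i ω))) / n) atTop
      (𝓝 ((∫ s, clamp K s ∂ν) * ∫ y, f y ∂(rayProb R))) := by
    refine ae_all_iff.2 fun K => ?_
    have hGm : Measurable fun p : E × ℝ => S.cycleIntegral f p.1 (clamp K p.2) :=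
      (S.measurable_cycleIntegral hf).comp
        (measurable_fst.prodMk ((hcm K).comp measurable_snd))
    have hGb : ∀ p : E × ℝ, |S.cycleIntegral f p.1 (clamp K p.2)| ≤ C * K := fun p =>
      (hFb _ _).trans (mul_le_mul_of_nonneg_left
        (by rw [abs_of_nonneg (hc0 _ _)]; exact hcK _ _) hC0)
    have h := S.ae_tendsto_average hdim hν hν' hτ hind hlaw hR hx hGm hGb
    have e : ∫ y, ∫ s, S.cycleIntegral f y (clamp K s) ∂ν ∂(rayProb R) =
        (∫ s, clamp K s ∂ν) * ∫ y, f y ∂(rayProb R) := by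
      rw [integral_integral_swap (Integrable.of_bound hGm.aestronglyMeasurable (C * K)
        (Eventually.of_forall hGb))]
      simp_rw [S.integral_cycleIntegral hR hf hC]
      rw [integral_mul_const]
    rw [e] at h
    exact h
  -- the truncated means converge
  have hmK : Tendsto (fun K : ℕ => ∫ s, clamp K s ∂ν) atTop (𝓝 (∫ ω, τ 0 ω ∂P)) := by
    have e : ∀ K, ∫ s, clamp K s ∂ν = ∫ ω, clamp K (τ 0 ω) ∂P := fun K => by
      rw [← hlaw 0, integral_map (hτ 0).aemeasurable (hcm K).aestronglyMeasurable]
    simp_rw [e]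
    refine tendsto_integral_of_dominated_convergence (fun ω => |τ 0 ω|)
      (fun K => ((hcm K).comp (hτ 0)).aestronglyMeasurable) hmean.abs (fun K => ?_) ?_
    · filter_upwards [hpos] with ω hω
      rw [Real.norm_of_nonneg (hc0 _ _)]
      exact (hcs K _ (hω 0).le).trans (le_abs_self _)
    · filter_upwards [hpos] with ω hω
      refine tendsto_const_nhds.congr' ?_
      obtain ⟨K₀, hK₀⟩ := exists_nat_ge (τ 0 ω)
      filter_upwards [eventually_ge_atTop K₀] with K hK
      have : τ 0 ω ≤ K := hK₀.trans (by exact_mod_cast hK)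
      simp only [hclamp]
      rw [min_eq_left this, max_eq_right (hω 0).le]
  filter_upwards [hlln, hcl, hF, hpos] with ω h1 h2 h3 h4
  refine ⟨h1, tendsto_of_truncation hmK h3 h2 h1 (C := C) fun K n => ?_⟩
  rw [← sub_div, ← sub_div, ← Finset.sum_sub_distrib, ← Finset.sum_sub_distrib, abs_div,
    Nat.abs_cast, ← mul_div_assoc, Finset.mul_sum]
  refine div_le_div_of_nonneg_right ((Finset.abs_sum_le_sum_abs _ _).trans
    (Finset.sum_le_sum fun i _ => ?_)) (Nat.cast_nonneg n)
  refine (S.abs_cycleIntegral_sub_le hf hC _ _ _).trans (le_of_eq ?_)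
  rw [abs_of_nonneg (sub_nonneg.2 (hcs K _ (h4 i).le))]

/-- Time averages along the piecewise deterministic trajectory `ψ`. -/
theorem ae_tendsto_timeAverage (hdim : 1 < Module.finrank ℝ E)
    (hν : volume.restrict (Set.Ioi 0) ≪ ν) (hν' : ν ≪ volume)
    (hτ : ∀ n, Measurable (τ n)) (hind : iIndepFun τ P) (hlaw : ∀ n, P.map (τ n) = ν)
    (hpos : ∀ᵐ ω ∂P, ∀ n, 0 < τ n ω) (hmean : Integrable (τ 0) P)
    {R : ℝ} (hR : 0 < R) {x : E} (hx : ‖x‖ = R) (hf : Measurable f) (hC : ∀ x, |f x| ≤ C)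
    {ψ : Ω → ℝ → E} (hψ : ∀ᵐ ω ∂P, ∀ m t, flipTime (fun i => τ i ω) m ≤ t →
      t < flipTime (fun i => τ i ω) (m + 1) →
      ψ ω t = S.rot (t - flipTime (fun i => τ i ω) m) (chain S.step (fun i => τ i ω) x m)) :
    ∀ᵐ ω ∂P, Tendsto (fun T : ℝ => T⁻¹ * ∫ t in (0 : ℝ)..T, f (ψ ω t)) atTop
      (𝓝 (∫ y, f y ∂(rayProb R))) := by
  have hm : 0 < ∫ ω, τ 0 ω ∂P := by
    rw [integral_pos_iff_support_of_nonneg_ae (hpos.mono fun ω h => (h 0).le) hmean]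
    have : Function.support (τ 0) =ᵐ[P] Set.univ := by
      filter_upwards [hpos] with ω hω
      exact propext ⟨fun _ => trivial, fun _ => (hω 0).ne'⟩
    rw [measure_congr this]
    simp
  filter_upwards [S.ae_tendsto_average_cycleIntegral hdim hν hν' hτ hind hlaw hpos hmean hR hx hf hC,
    hpos, hψ] with ω h1 h2 h3
  set t := flipTime fun i => τ i ω with ht
  set X := chain S.step (fun i => τ i ω) x with hX
  have hsucc : ∀ n, t (n + 1) = t n + τ n ω := fun n => by
    simp only [ht, flipTime, Finset.sum_range_succ]
  have hmono : StrictMono t := strictMono_nat_of_lt_succ fun n => by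
    rw [hsucc]; linarith [h2 n]
  have hcyc : ∀ n, IntervalIntegrable (fun s => f (ψ ω s)) volume (t n) (t (n + 1)) ∧
      ∫ s in t n..t (n + 1), f (ψ ω s) = S.cycleIntegral f (X n) (τ n ω) := by
    intro n
    have heq : Set.EqOn (fun s => f (S.rot (s - t n) (X n))) (fun s => f (ψ ω s))
        (Set.uIoo (t n) (t (n + 1))) := by
      intro s hs
      rw [Set.uIoo_of_le (hmono (Nat.lt_succ_self n)).le] at hs
      simp only
      rw [h3 n s hs.1.le hs.2]
    have hii : IntervalIntegrable (fun s => f (S.rot (s - t n) (X n))) volume (t n) (t (n + 1)) := by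
      have := (S.intervalIntegrable_flow_comp hf hC (X n) 0 (τ n ω)).comp_sub_right (t n)
      rw [zero_add, add_comm, ← hsucc] at this
      exact this
    refine ⟨hii.congr_uIoo heq, ?_⟩
    rw [← intervalIntegral.integral_congr_uIoo heq,
      intervalIntegral.integral_comp_sub_right (fun s => f (S.rot s (X n))), sub_self, hsucc,
      add_sub_cancel_left, cycleIntegral_eq]
  have ht0 : t 0 = 0 := by simp [ht, flipTime]
  have hint : ∀ n, IntervalIntegrable (fun s => f (ψ ω s)) volume 0 (t n) := fun n => by
    rw [← ht0]
    exact IntervalIntegrable.trans_iterate fun k _ => (hcyc k).1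
  have hsum : ∀ n, ∫ s in (0 : ℝ)..t n, f (ψ ω s) =
      ∑ i ∈ Finset.range n, S.cycleIntegral f (X i) (τ i ω) := fun n => by
    rw [← ht0, ← intervalIntegral.sum_integral_adjacent_intervals fun k _ => (hcyc k).1]
    exact Finset.sum_congr rfl fun i _ => (hcyc i).2
  refine tendsto_timeAverage ht0 hmono hm h1.1 (fun s _ => hC _) hint ?_
  simp_rw [hsum]
  exact h1.2

end FlipSystem

end FlipDynamics

/-! ### Comparison of surface measures and volumes -/

namespace FlipDynamics

open scoped NNReal ENNReal Pointwise

section Within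

/-- The numbers `a` and `b` agree up to the factor `k`. -/
def Within (k a b : ℝ≥0∞) : Prop := a ≤ k * b ∧ b ≤ k * a

theorem Within.symm {k a b : ℝ≥0∞} (h : Within k a b) : Within k b a := ⟨h.2, h.1⟩

theorem Within.trans {k l a b c : ℝ≥0∞} (h : Within k a b) (h' : Within l b c) :
    Within (k * l) a c :=
  ⟨h.1.trans (by rw [mul_assoc]; gcongr; exact h'.1),
    h'.2.trans (by rw [mul_comm k l, mul_assoc]; gcongr; exact h.2)⟩

theorem Within.mul_left {k a b : ℝ≥0∞} (h : Within k a b) (c : ℝ≥0∞) :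
    Within k (c * a) (c * b) :=
  ⟨by rw [mul_left_comm]; gcongr; exact h.1, by rw [mul_left_comm]; gcongr; exact h.2⟩

/-- Two measures that agree locally, up to each factor larger than one, agree: for a fixed factor
the local comparisons add up over a countable cover, and then the factor tends to one. -/
theorem measure_eq_of_locally_within {X : Type*} [TopologicalSpace X] [SecondCountableTopology X]
    [MeasurableSpace X] [OpensMeasurableSpace X] {μ ν : Measure X} {S : Set X} (n : ℕ)
    (h : ∀ k : ℝ≥0, 1 < k → ∀ x ∈ S, ∃ U ∈ 𝓝 x, ∀ B, MeasurableSet B → B ⊆ S → B ⊆ U →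
      Within ((k : ℝ≥0∞) ^ n) (μ B) (ν B))
    {B : Set X} (hB : MeasurableSet B) (hBS : B ⊆ S) : μ B = ν B := by
  have key : ∀ k : ℝ≥0, 1 < k → Within ((k : ℝ≥0∞) ^ n) (μ B) (ν B) := by
    intro k hk
    choose! U hU hW using h k hk
    obtain ⟨t, hts, htc, hcov⟩ := TopologicalSpace.countable_cover_nhdsWithin
      (f := fun x => interior (U x)) (s := S)
      (fun x hx => mem_nhdsWithin_of_mem_nhds (interior_mem_nhds.2 (hU x hx)))
    rcases t.eq_empty_or_nonempty with rfl | hne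
    · have hB0 : B = ∅ := Set.subset_empty_iff.1 (hBS.trans (by simpa using hcov))
      simp [hB0, Within]
    obtain ⟨e, rfl⟩ := htc.exists_eq_range hne
    have heS : ∀ i, e i ∈ S := fun i => hts ⟨i, rfl⟩
    set s : ℕ → Set X := fun i => interior (U (e i)) with hs
    have hsm : ∀ i, MeasurableSet (disjointed s i) := fun i =>
      MeasurableSet.disjointed (fun i => isOpen_interior.measurableSet) i
    have hBU : B = ⋃ i, B ∩ disjointed s i := by
      rw [← Set.inter_iUnion, iUnion_disjointed, eq_comm, Set.inter_eq_left]
      refine hBS.trans (hcov.trans ?_)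
      rw [Set.biUnion_range]
    have hdisj : Pairwise (Function.onFun Disjoint fun i => B ∩ disjointed s i) := fun i j hij =>
      (disjoint_disjointed s hij).mono Set.inter_subset_right Set.inter_subset_right
    have hpiece : ∀ i, Within ((k : ℝ≥0∞) ^ n) (μ (B ∩ disjointed s i)) (ν (B ∩ disjointed s i)) :=
      fun i => hW (e i) (heS i) _ (hB.inter (hsm i)) (Set.inter_subset_left.trans hBS)
        (Set.inter_subset_right.trans ((disjointed_subset s i).trans interior_subset))
    have hsum : ∀ κ : Measure X, κ B = ∑' i, κ (B ∩ disjointed s i) := fun κ => by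
      conv_lhs => rw [hBU]
      exact measure_iUnion hdisj fun i => hB.inter (hsm i)
    rw [hsum μ, hsum ν]
    exact ⟨by rw [← ENNReal.tsum_mul_left]; exact ENNReal.tsum_le_tsum fun i => (hpiece i).1,
      by rw [← ENNReal.tsum_mul_left]; exact ENNReal.tsum_le_tsum fun i => (hpiece i).2⟩
  have hlim : ∀ c : ℝ≥0∞, Tendsto (fun k : ℝ≥0 => (k : ℝ≥0∞) ^ n * c) (𝓝[>] 1) (𝓝 c) := by
    intro c
    have h1 : Tendsto (fun k : ℝ≥0 => (k : ℝ≥0∞) ^ n) (𝓝[>] 1) (𝓝 1) := by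
      have : Continuous fun k : ℝ≥0 => ((k ^ n : ℝ≥0) : ℝ≥0∞) :=
        ENNReal.continuous_coe.comp (continuous_pow n)
      simpa using this.continuousWithinAt (s := Set.Ioi 1) (x := 1) |>.tendsto
    simpa using ENNReal.Tendsto.mul_const h1 (Or.inl one_ne_zero) (b := c)
  apply le_antisymm
  · exact ge_of_tendsto (hlim _) (by filter_upwards [self_mem_nhdsWithin] with k hk using (key k hk).1)
  · exact ge_of_tendsto (hlim _) (by filter_upwards [self_mem_nhdsWithin] with k hk using (key k hk).2)

end Within

section NearIdentity

variable {E : Type*} [NormedAddCommGroup E]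

theorem euclideanHausdorffMeasure_image_le {X Y : Type*} [MetricSpace X] [MeasurableSpace X]
    [BorelSpace X] [MetricSpace Y] [MeasurableSpace Y] [BorelSpace Y] {f : X → Y} {s : Set X}
    {k : ℝ≥0} (hf : LipschitzOnWith k f s) (d : ℕ) :
    (μHE[d] : Measure Y) (f '' s) ≤ (k : ℝ≥0∞) ^ d * (μHE[d] : Measure X) s := by
  rw [Measure.euclideanHausdorffMeasure_def, Measure.euclideanHausdorffMeasure_def,
    Measure.smul_apply, Measure.smul_apply, ENNReal.smul_def, ENNReal.smul_def, smul_eq_mul,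
    smul_eq_mul, mul_left_comm]
  gcongr
  have := hf.hausdorffMeasure_image_le (d := d) (by positivity)
  simpa using this

/-- A map that changes distances at most by the factor `k` changes the `d`-dimensional Hausdorff
measure at most by the factor `k ^ d`. -/
theorem within_euclideanHausdorffMeasure_image [MeasurableSpace E] [BorelSpace E] {f : E → E} {s : Set E} {k : ℝ≥0}
    (hf : LipschitzOnWith k f s)
    (hf' : ∀ x ∈ s, ∀ y ∈ s, ‖x - y‖ ≤ k * ‖f x - f y‖) (d : ℕ) :
    Within ((k : ℝ≥0∞) ^ d) ((μHE[d] : Measure E) (f '' s)) (μHE[d] s) := by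
  refine ⟨euclideanHausdorffMeasure_image_le hf d, ?_⟩
  rcases s.eq_empty_or_nonempty with rfl | ⟨x₀, -⟩
  · simp
  have : Nonempty E := ⟨x₀⟩
  have hinj : Set.InjOn f s := fun x hx y hy hxy => by
    have := hf' x hx y hy
    rw [hxy, sub_self, norm_zero, mul_zero] at this
    exact sub_eq_zero.1 (norm_le_zero_iff.1 this)
  have hg : LipschitzOnWith k (Function.invFunOn f s) (f '' s) := by
    refine LipschitzOnWith.of_dist_le_mul ?_
    rintro _ ⟨x, hx, rfl⟩ _ ⟨y, hy, rfl⟩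
    rw [hinj.leftInvOn_invFunOn hx, hinj.leftInvOn_invFunOn hy, dist_eq_norm, dist_eq_norm]
    exact hf' x hx y hy
  have := euclideanHausdorffMeasure_image_le hg d
  rwa [hinj.leftInvOn_invFunOn.image_image] at this

/-- A map whose derivative at a point is the identity is, near the point, Lipschitz with
Lipschitz inverse, with constants close to one. -/
theorem exists_nhds_biLipschitz [NormedSpace ℝ E] {f : E → E} {x : E}
    (hf : HasStrictFDerivAt f (ContinuousLinearMap.id ℝ E) x) {k : ℝ≥0} (hk : 1 < k) :
    ∃ U ∈ 𝓝 x, LipschitzOnWith k f U ∧ ∀ y ∈ U, ∀ z ∈ U, ‖y - z‖ ≤ k * ‖f y - f z‖ := by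
  have hk' : (1 : ℝ) < k := by exact_mod_cast hk
  set c : ℝ≥0 := 1 - k⁻¹ with hc
  have hcr : (c : ℝ) = 1 - (k : ℝ)⁻¹ := by
    rw [hc, NNReal.coe_sub (inv_le_one_of_one_le₀ hk.le)]; simp
  have hki : (k : ℝ)⁻¹ < 1 := inv_lt_one_of_one_lt₀ hk'
  have hc0 : 0 < c := by rw [← NNReal.coe_pos, hcr]; linarith
  obtain ⟨U, hU, hfU⟩ := hf.approximates_deriv_on_nhds (Or.inr hc0)
  have hkk : (k : ℝ) * (k : ℝ)⁻¹ = 1 := mul_inv_cancel₀ (by linarith)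
  refine ⟨U, hU, LipschitzOnWith.of_dist_le_mul fun y hy z hz => ?_, fun y hy z hz => ?_⟩
  · have h1 := hfU y hy z hz
    rw [hcr] at h1
    simp only [ContinuousLinearMap.coe_id', id_eq] at h1
    rw [dist_eq_norm, dist_eq_norm]
    have h2 : ‖f y - f z‖ ≤ ‖f y - f z - (y - z)‖ + ‖y - z‖ := by
      simpa using norm_add_le (f y - f z - (y - z)) (y - z)
    have h3 : 1 - (k : ℝ)⁻¹ + 1 ≤ k := by nlinarith [sq_nonneg ((k : ℝ) - 1)]
    nlinarith [norm_nonneg (y - z)]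
  · have h1 := hfU y hy z hz
    rw [hcr] at h1
    simp only [ContinuousLinearMap.coe_id', id_eq] at h1
    have h2 : ‖y - z‖ ≤ ‖f y - f z‖ + ‖f y - f z - (y - z)‖ := by
      simpa using norm_sub_le (f y - f z) (f y - f z - (y - z))
    have h3 : (k : ℝ)⁻¹ * ‖y - z‖ ≤ ‖f y - f z‖ := by linarith
    calc ‖y - z‖ = k * ((k : ℝ)⁻¹ * ‖y - z‖) := by rw [← mul_assoc, hkk, one_mul]
      _ ≤ k * ‖f y - f z‖ := by gcongr

end NearIdentity

section PlaneCone

variable {E : Type*} [NormedAddCommGroup E] [InnerProductSpace ℝ E] [FiniteDimensional ℝ E]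
  [MeasurableSpace E] [BorelSpace E]

/-- The volume of a truncated cone over a subset `D` of the hyperplane `⟪n, x⟫ = w`, by Fubini's
theorem: the slice at height `t` is `t • D`, and the distance of the hyperplane from the origin is
`w / ‖n‖`. -/
theorem volume_planeCone {n : E} (hn : n ≠ 0) {w a : ℝ} (hw : 0 < w) (ha : 0 < a) (ha1 : a < 1)
    {D : Set E} (hD : MeasurableSet D) (hDw : ∀ x ∈ D, inner ℝ n x = w) :
    volume {x | ∃ t ∈ Set.Ico a 1, ∃ y ∈ D, x = t • y} =
      ENNReal.ofReal (w / ‖n‖ * ((1 - a ^ Module.finrank ℝ E) / Module.finrank ℝ E)) *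
        μHE[Module.finrank ℝ E - 1] D := by
  set d := Module.finrank ℝ E with hd
  have hd0 : 0 < d := Module.finrank_pos_iff_exists_ne_zero.2 ⟨n, hn⟩
  have hn' : 0 < ‖n‖ := norm_pos_iff.2 hn
  set v : E := (w / ‖n‖ ^ 2) • n with hv
  have hc : 0 < w / ‖n‖ ^ 2 := by positivity
  have hv0 : v ≠ 0 := smul_ne_zero hc.ne' hn
  have hvn : ‖v‖ = w / ‖n‖ := by
    rw [hv, norm_smul, Real.norm_of_nonneg hc.le]; field_simp
  set C := {x : E | ∃ t ∈ Set.Ico a 1, ∃ y ∈ D, x = t • y} with hC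
  have hCeq : C = {x | inner ℝ n x / w ∈ Set.Ico a 1} ∩ (fun x => (w / inner ℝ n x) • x) ⁻¹' D := by
    ext x
    constructor
    · rintro ⟨t, ht, y, hy, rfl⟩
      have ht0 : t ≠ 0 := (ha.trans_le ht.1).ne'
      have e : inner ℝ n (t • y) = t * w := by rw [inner_smul_right, hDw y hy]
      refine ⟨?_, ?_⟩
      · rw [Set.mem_ofPred_eq, e, mul_div_assoc, div_self hw.ne', mul_one]; exact ht
      · rw [Set.mem_preimage, e, smul_smul]
        have : w / (t * w) * t = 1 := by field_simp
        rwa [this, one_smul]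
    · rintro ⟨h1, h2⟩
      refine ⟨_, h1, _, h2, ?_⟩
      have h3 : 0 < inner ℝ n x / w := ha.trans_le h1.1
      have h4 : inner ℝ n x ≠ 0 := fun h => by simp [h] at h3
      rw [smul_smul]
      have : inner ℝ n x / w * (w / inner ℝ n x) = 1 := by field_simp
      rw [this, one_smul]
  have hCm : MeasurableSet C := by
    rw [hCeq]
    refine MeasurableSet.inter ?_ ?_
    · exact measurableSet_Ico.preimage (by fun_prop : Measurable fun x : E => inner ℝ n x / w)
    · exact hD.preimage (by fun_prop)
  rw [← InnerProductSpace.euclideanHausdorffMeasure_eq_volume,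
    EuclideanGeometry.euclideanHausdorffMeasure_eq_lintegral (0 : E) hv0 hCm, ← hd]
  have hslice : ∀ x : ℝ, (μHE[d - 1] : Measure E)
      (C ∩ AffineSubspace.mk' (x • v +ᵥ (0 : E)) (ℝ ∙ v)ᗮ) =
      (Set.Ico a 1).indicator (fun x => ENNReal.ofReal (x ^ (d - 1)) * μHE[d - 1] D) x := by
    intro x
    have hmem : ∀ y : E, y ∈ (AffineSubspace.mk' (x • v +ᵥ (0 : E)) (ℝ ∙ v)ᗮ : Set E) ↔
        inner ℝ n y = x * w := by
      intro y
      rw [SetLike.mem_coe, AffineSubspace.mem_mk', Submodule.mem_orthogonal_singleton_iff_inner_right]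
      simp only [vadd_eq_add, add_zero, vsub_eq_sub, hv, inner_sub_right, inner_smul_left,
        inner_smul_right, real_inner_self_eq_norm_sq]
      simp only [conj_trivial]
      constructor
      · intro h
        field_simp at h
        nlinarith
      · intro h
        rw [h]; field_simp; ring
    by_cases hx : x ∈ Set.Ico a 1
    · have hx0 : 0 < x := ha.trans_le hx.1
      rw [Set.indicator_of_mem hx]
      have : C ∩ AffineSubspace.mk' (x • v +ᵥ (0 : E)) (ℝ ∙ v)ᗮ = x • D := by
        ext y
        rw [Set.mem_inter_iff, hmem, Set.mem_smul_set]
        constructor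
        · rintro ⟨⟨t, ht, z, hz, rfl⟩, h⟩
          rw [inner_smul_right, hDw z hz] at h
          rw [← mul_right_cancel₀ hw.ne' h]
          exact ⟨z, hz, rfl⟩
        · rintro ⟨z, hz, rfl⟩
          exact ⟨⟨x, hx, z, hz, rfl⟩, by rw [inner_smul_right, hDw z hz]⟩
      rw [this, Measure.euclideanHausdorffMeasure_smul₀ _ hx0.ne', ENNReal.ofReal_pow hx0.le,
        ENNReal.smul_def, smul_eq_mul, ENNReal.coe_pow, ← Real.enorm_of_nonneg hx0.le]
      rfl
    · rw [Set.indicator_of_notMem hx]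
      have : C ∩ AffineSubspace.mk' (x • v +ᵥ (0 : E)) (ℝ ∙ v)ᗮ = ∅ := by
        rw [Set.eq_empty_iff_forall_notMem]
        rintro y ⟨⟨t, ht, z, hz, rfl⟩, h⟩
        rw [hmem, inner_smul_right, hDw z hz] at h
        rw [mul_right_cancel₀ hw.ne' h] at ht
        exact hx ht
      rw [this, measure_empty]
  simp only [hslice]
  rw [lintegral_indicator measurableSet_Ico, lintegral_mul_const _ (by fun_prop), ← mul_assoc]
  congr 1
  have hint : ∫⁻ x in Set.Ico a 1, ENNReal.ofReal (x ^ (d - 1)) =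
      ENNReal.ofReal ((1 - a ^ d) / d) := by
    rw [← ofReal_integral_eq_lintegral_ofReal]
    · rw [integral_Ico_eq_integral_Ioc, ← intervalIntegral.integral_of_le ha1.le, integral_pow]
      congr 2
      · rw [Nat.sub_add_cancel hd0, one_pow]
      · rw [Nat.cast_sub hd0]; simp
    · exact ((continuous_pow (d - 1)).integrableOn_Icc (a := a) (b := 1)).mono_set
        Set.Ico_subset_Icc_self
    · filter_upwards [ae_restrict_mem measurableSet_Ico] with x hx
      exact pow_nonneg (ha.le.trans hx.1) _
  rw [hint, ← hvn, ENNReal.ofReal_mul (norm_nonneg v), ofReal_norm]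

end PlaneCone

end FlipDynamics

/-! ### Energy functions that are homogeneous of degree two -/

namespace FlipDynamics

open scoped NNReal ENNReal Pointwise

variable {E : Type*} [NormedAddCommGroup E] [InnerProductSpace ℝ E]

/-- A positive definite energy function that is homogeneous of degree two. -/
structure QuadraticEnergy (H : E → ℝ) : Prop where
  contDiff : ContDiff ℝ 1 H
  map_smul : ∀ (t : ℝ) x, H (t • x) = t ^ 2 * H x
  pos : ∀ x, x ≠ 0 → 0 < H x

/-- The radial projection to the energy surface `{H = h}`. -/
noncomputable def energyProj (H : E → ℝ) (h : ℝ) (x : E) : E := (√(H x / h))⁻¹ • x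

/-- The cone measure on the energy surface `{H = h}`: the measure of a set `B` is the volume of the
cone with base `B` and vertex `0`. -/
noncomputable def coneMeasure [MeasureSpace E] (H : E → ℝ) (h : ℝ) : Measure E :=
  (volume.restrict {x | H x < h}).map (energyProj H h)

/-- The surface measure on `{H = h}` divided by the norm of the gradient of `H`. -/
noncomputable def gradientMeasure [MeasurableSpace E] [BorelSpace E] [FiniteDimensional ℝ E]
    (H : E → ℝ) (h : ℝ) : Measure E :=
  ((μHE[Module.finrank ℝ E - 1] : Measure E).restrict {x | H x = h}).withDensity
    fun x => ENNReal.ofReal ‖gradient H x‖⁻¹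

namespace QuadraticEnergy

variable {H : E → ℝ} (hH : QuadraticEnergy H) {h : ℝ}
include hH

theorem continuous : Continuous H := hH.contDiff.continuous

theorem map_zero : H 0 = 0 := by simpa using hH.map_smul 0 0

theorem ne_zero_of_eq (hh : 0 < h) {x : E} (hx : H x = h) : x ≠ 0 := by
  rintro rfl
  rw [hH.map_zero] at hx
  exact hh.ne hx

theorem apply_energyProj (hh : 0 < h) {x : E} (hx : x ≠ 0) : H (energyProj H h x) = h := by
  have := hH.pos x hx
  rw [energyProj, hH.map_smul, inv_pow, Real.sq_sqrt (by positivity)]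
  field_simp

theorem energyProj_smul (hh : 0 < h) {t : ℝ} (ht : 0 < t) {x : E} (hx : H x = h) :
    energyProj H h (t • x) = x := by
  rw [energyProj, hH.map_smul, hx, mul_div_assoc, div_self hh.ne', mul_one, Real.sqrt_sq ht.le,
    smul_smul, inv_mul_cancel₀ ht.ne', one_smul]

theorem sqrt_smul_energyProj (hh : 0 < h) {x : E} (hx : x ≠ 0) :
    √(H x / h) • energyProj H h x = x := by
  have := hH.pos x hx
  have h1 : √(H x / h) ≠ 0 := (Real.sqrt_pos.2 (by positivity)).ne'
  rw [energyProj, smul_smul, mul_inv_cancel₀ h1, one_smul]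

section Gradient

variable [CompleteSpace E]

theorem hasStrictFDerivAt (x : E) : HasStrictFDerivAt H (innerSL ℝ (gradient H x)) x := by
  have h1 := (hH.contDiff.contDiffAt (x := x)).hasStrictFDerivAt one_ne_zero
  have h2 : innerSL ℝ (gradient H x) = fderiv ℝ H x :=
    (InnerProductSpace.toDual ℝ E).apply_symm_apply (fderiv ℝ H x)
  rwa [h2]

theorem continuous_gradient : Continuous (gradient H) :=
  (InnerProductSpace.toDual ℝ E).symm.continuous.comp (hH.contDiff.continuous_fderiv one_ne_zero)

/-- Euler's identity for homogeneous functions of degree two. -/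
theorem inner_gradient_self (x : E) : inner ℝ (gradient H x) x = 2 * H x := by
  have h1 : HasDerivAt (fun t : ℝ => H (t • x)) (inner ℝ (gradient H x) x) 1 := by
    have h2 : HasDerivAt (fun t : ℝ => t • x) x 1 := by
      simpa using (hasDerivAt_id (1 : ℝ)).smul_const x
    have h3 : HasFDerivAt H (innerSL ℝ (gradient H x)) ((1 : ℝ) • x) := by
      rw [one_smul]; exact (hH.hasStrictFDerivAt x).hasFDerivAt
    exact h3.comp_hasDerivAt (1 : ℝ) h2
  have h2 : HasDerivAt (fun t : ℝ => H (t • x)) (2 * H x) 1 := by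
    simp only [hH.map_smul]
    simpa using (hasDerivAt_pow 2 (1 : ℝ)).mul_const (H x)
  exact h1.unique h2

end Gradient

/-- The radial map of the energy surface to its tangent plane at `x₀`, extended to be homogeneous
of degree one, has derivative the identity at `x₀`. -/
theorem hasStrictFDerivAt_tangentMap [CompleteSpace E] (hh : 0 < h) {x₀ : E} (hx₀ : H x₀ = h) :
    HasStrictFDerivAt
      (fun x => (√(H x / h) * (inner ℝ (gradient H x₀) x / (2 * h))⁻¹) • x)
      (ContinuousLinearMap.id ℝ E) x₀ := by
  set n := gradient H x₀ with hn
  have hE : inner ℝ n x₀ = 2 * h := by rw [hn, hH.inner_gradient_self, hx₀]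
  have h1 : HasStrictFDerivAt (fun x => H x / h) (h⁻¹ • innerSL ℝ n) x₀ := by
    simpa only [div_eq_mul_inv, mul_comm] using (hH.hasStrictFDerivAt x₀).const_mul h⁻¹
  have h2 := h1.sqrt (by rw [hx₀, div_self hh.ne']; exact one_ne_zero)
  have h3 : HasStrictFDerivAt (fun x => inner ℝ n x / (2 * h)) ((2 * h)⁻¹ • innerSL ℝ n) x₀ := by
    simpa only [div_eq_mul_inv, mul_comm, innerSL_apply_apply] using
      ((innerSL ℝ n).hasStrictFDerivAt (x := x₀)).const_mul (2 * h)⁻¹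
  have h4 := (hasStrictDerivAt_inv (x := inner ℝ n x₀ / (2 * h))
    (by rw [hE, div_self (by positivity)]; exact one_ne_zero)).comp_hasStrictFDerivAt x₀ h3
  have h5 := (h2.mul h4).smul (hasStrictFDerivAt_id x₀)
  refine h5.congr_fderiv ?_
  ext y
  simp [hE, hx₀, hh.ne']
  left
  field_simp
  ring

section Volume

variable [FiniteDimensional ℝ E] [MeasurableSpace E] [BorelSpace E]

theorem measurable_energyProj : Measurable (energyProj H h) := by
  have := hH.continuous.measurable
  unfold energyProj
  fun_prop

/-- The sublevel sets are bounded, because `H` has a positive minimum on the unit sphere. -/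
theorem volume_sublevel_ne_top (h : ℝ) : volume {x : E | H x < h} ≠ ⊤ := by
  obtain ⟨c, hc, hcH⟩ : ∃ c, 0 < c ∧ ∀ x, c * ‖x‖ ^ 2 ≤ H x := by
    rcases (Metric.sphere (0 : E) 1).eq_empty_or_nonempty with he | hne
    · refine ⟨1, one_pos, fun x => ?_⟩
      have hx : x = 0 := by
        by_contra hx
        have : ‖x‖⁻¹ • x ∈ Metric.sphere (0 : E) 1 := by
          rw [mem_sphere_zero_iff_norm, norm_smul, norm_inv, norm_norm,
            inv_mul_cancel₀ (norm_ne_zero_iff.2 hx)]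
        rw [he] at this
        exact this
      simp [hx, hH.map_zero]
    · obtain ⟨z, hz, hmin⟩ := (isCompact_sphere (0 : E) 1).exists_isMinOn hne
        hH.continuous.continuousOn
      refine ⟨H z, hH.pos z (fun h0 => by simp [h0] at hz), fun x => ?_⟩
      by_cases hx : x = 0
      · simp [hx, hH.map_zero]
      have hx' : ‖x‖ ≠ 0 := norm_ne_zero_iff.2 hx
      have h1 : ‖x‖⁻¹ • x ∈ Metric.sphere (0 : E) 1 := by
        rw [mem_sphere_zero_iff_norm, norm_smul, norm_inv, norm_norm, inv_mul_cancel₀ hx']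
      have h2 : H z ≤ H (‖x‖⁻¹ • x) := hmin h1
      rw [hH.map_smul] at h2
      calc H z * ‖x‖ ^ 2 ≤ (‖x‖⁻¹ ^ 2 * H x) * ‖x‖ ^ 2 := by gcongr
        _ = H x := by field_simp
  have hsub : {x : E | H x < h} ⊆ Metric.ball 0 (√(h / c)) := by
    intro x hx
    rw [mem_ball_zero_iff]
    apply Real.lt_sqrt_of_sq_lt
    rw [lt_div_iff₀ hc, mul_comm]
    exact (hcH x).trans_lt hx
  exact ((measure_mono hsub).trans_lt Metric.isBounded_ball.measure_lt_top).ne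

/-- The volume of a truncated cone over a subset of the energy surface: the difference of the full
cone and of its image under scaling by `a`. -/
theorem volume_truncatedCone (hh : 0 < h) {a : ℝ} (ha : 0 < a) (ha1 : a < 1) {B : Set E}
    (hB : MeasurableSet B) (hBh : ∀ x ∈ B, H x = h) :
    volume {x | ∃ t ∈ Set.Ico a 1, ∃ y ∈ B, x = t • y} =
      ENNReal.ofReal (1 - a ^ Module.finrank ℝ E) * coneMeasure H h B := by
  set C₀ := {x : E | ∃ t ∈ Set.Ioo (0 : ℝ) 1, ∃ y ∈ B, x = t • y} with hC₀
  set C := {x : E | ∃ t ∈ Set.Ico a 1, ∃ y ∈ B, x = t • y} with hC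
  have hHt : ∀ (t : ℝ), ∀ y ∈ B, H (t • y) = t ^ 2 * h := fun t y hy => by
    rw [hH.map_smul, hBh y hy]
  have hC₀eq : C₀ = energyProj H h ⁻¹' B ∩ {x | H x < h} := by
    ext x
    constructor
    · rintro ⟨t, ht, y, hy, rfl⟩
      refine ⟨?_, ?_⟩
      · rw [Set.mem_preimage, hH.energyProj_smul hh ht.1 (hBh y hy)]; exact hy
      · rw [Set.mem_ofPred_eq, hHt t y hy]
        have : t ^ 2 < 1 := pow_lt_one₀ ht.1.le ht.2 two_ne_zero
        nlinarith
    · rintro ⟨h1, h2⟩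
      have hx : x ≠ 0 := by
        rintro rfl
        have := hBh _ h1
        rw [energyProj, smul_zero, hH.map_zero] at this
        exact hh.ne this
      have hp := hH.pos x hx
      refine ⟨√(H x / h), ⟨Real.sqrt_pos.2 (by positivity), ?_⟩, _, h1,
        (hH.sqrt_smul_energyProj hh hx).symm⟩
      rw [Real.sqrt_lt' one_pos, one_pow, div_lt_one hh]
      exact h2
  have hsub : MeasurableSet {x : E | H x < h} :=
    measurableSet_lt hH.continuous.measurable measurable_const
  have hcone : coneMeasure H h B = volume C₀ := by
    rw [coneMeasure, Measure.map_apply hH.measurable_energyProj hB,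
      Measure.restrict_apply (hH.measurable_energyProj hB), hC₀eq]
  have hC₀m : MeasurableSet C₀ := by
    rw [hC₀eq]; exact (hH.measurable_energyProj hB).inter hsub
  have hfin : volume C₀ ≠ ⊤ := by
    rw [hC₀eq]
    exact ((measure_mono Set.inter_subset_right).trans_lt
      (hH.volume_sublevel_ne_top h).lt_top).ne
  have hsplit : C = C₀ \ (a • C₀) := by
    ext x
    constructor
    · rintro ⟨t, ht, y, hy, rfl⟩
      refine ⟨⟨t, ⟨ha.trans_le ht.1, ht.2⟩, y, hy, rfl⟩, ?_⟩
      rintro ⟨_, ⟨s, hs, z, hz, rfl⟩, he⟩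
      have h1 := congrArg H he
      simp only [smul_smul] at h1
      rw [hHt _ z hz, hHt _ y hy] at h1
      have h2 := mul_right_cancel₀ hh.ne' h1
      have h3 : a * s = t := (sq_eq_sq₀ (by have := hs.1; positivity) (ha.le.trans ht.1)).1 h2
      have := ht.1
      have := hs.2
      nlinarith
    · rintro ⟨⟨t, ht, y, hy, rfl⟩, h2⟩
      refine ⟨t, ⟨?_, ht.2⟩, y, hy, rfl⟩
      by_contra! hlt
      refine h2 ⟨(a⁻¹ * t) • y, ⟨a⁻¹ * t, ⟨?_, ?_⟩, y, hy, rfl⟩, ?_⟩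
      · have := ht.1; positivity
      · rw [inv_mul_lt_iff₀ ha]; linarith
      · change a • (a⁻¹ * t) • y = t • y
        rw [smul_smul, ← mul_assoc, mul_inv_cancel₀ ha.ne', one_mul]
  have haC : a • C₀ ⊆ C₀ := by
    rintro _ ⟨_, ⟨s, hs, z, hz, rfl⟩, rfl⟩
    refine ⟨a * s, ⟨mul_pos ha hs.1, ?_⟩, z, hz, ?_⟩
    · nlinarith [hs.1, hs.2]
    · simp [smul_smul]
  have hvol : volume (a • C₀) = ENNReal.ofReal (a ^ Module.finrank ℝ E) * volume C₀ := by
    rw [Measure.addHaar_smul, abs_of_nonneg (by positivity)]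
  rw [hsplit, measure_sdiff haC (hC₀m.const_smul₀ a).nullMeasurableSet
    (by rw [hvol]; exact ENNReal.mul_ne_top ENNReal.ofReal_ne_top hfin), hvol, hcone,
    ENNReal.ofReal_sub _ (by positivity), ENNReal.sub_mul (fun _ _ => hfin)]
  simp

end Volume

end QuadraticEnergy

end FlipDynamics

/-! ### The Liouville measure as a cone measure -/

namespace FlipDynamics

open scoped NNReal ENNReal Pointwise

variable {E : Type*} [NormedAddCommGroup E] [InnerProductSpace ℝ E]

namespace QuadraticEnergy

variable {H : E → ℝ} (hH : QuadraticEnergy H) {h : ℝ}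
include hH

section Volume

variable [FiniteDimensional ℝ E] [MeasurableSpace E] [BorelSpace E]

omit [FiniteDimensional ℝ E] in
theorem measurableSet_energySurface (h : ℝ) : MeasurableSet {x : E | H x = h} :=
  measurableSet_eq_fun hH.continuous.measurable measurable_const

/-- Near a point of the energy surface the weight `1 / ‖∇H‖` is almost constant. -/
theorem within_gradientMeasure {x₀ : E} (hx₀ : gradient H x₀ ≠ 0) {k : ℝ≥0} (hk : 1 < k) :
    ∃ U ∈ 𝓝 x₀, ∀ B, MeasurableSet B → B ⊆ {x | H x = h} → B ⊆ U →
      Within k (ENNReal.ofReal ‖gradient H x₀‖⁻¹ * μHE[Module.finrank ℝ E - 1] B)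
        (gradientMeasure H h B) := by
  have hk' : (1 : ℝ) < k := by exact_mod_cast hk
  set r := ‖gradient H x₀‖⁻¹ with hr
  have hr0 : 0 < r := inv_pos.2 (norm_pos_iff.2 hx₀)
  have hcont : ContinuousAt (fun x => ‖gradient H x‖⁻¹) x₀ :=
    hH.continuous_gradient.norm.continuousAt.inv₀ (norm_ne_zero_iff.2 hx₀)
  have h1 : ∀ᶠ x in 𝓝 x₀, ‖gradient H x‖⁻¹ < k * r :=
    hcont.eventually_lt_const (by change r < k * r; nlinarith)
  have h2 : ∀ᶠ x in 𝓝 x₀, r < k * ‖gradient H x‖⁻¹ :=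
    (hcont.const_mul (k : ℝ)).eventually_const_lt (by change r < k * r; nlinarith)
  refine ⟨_, h1.and h2, fun B hB hBS hBU => ?_⟩
  have hval : gradientMeasure H h B =
      ∫⁻ x in B, ENNReal.ofReal ‖gradient H x‖⁻¹ ∂(μHE[Module.finrank ℝ E - 1] : Measure E) := by
    rw [gradientMeasure, withDensity_apply _ hB, Measure.restrict_restrict hB,
      Set.inter_eq_left.2 hBS]
  have hc : ∀ c : ℝ≥0∞, c * μHE[Module.finrank ℝ E - 1] B =
      ∫⁻ x in B, c ∂(μHE[Module.finrank ℝ E - 1] : Measure E) := fun c => by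
    rw [setLIntegral_const]
  have hkof : (k : ℝ≥0∞) = ENNReal.ofReal k := (ENNReal.ofReal_coe_nnreal).symm
  have hm : Measurable fun x => ENNReal.ofReal ‖gradient H x‖⁻¹ :=
    (hH.continuous_gradient.measurable.norm.inv).ennreal_ofReal
  rw [hval]
  constructor
  · rw [← lintegral_const_mul _ hm, hc]
    refine setLIntegral_mono (hm.const_mul _) fun x hx => ?_
    rw [hkof, ← ENNReal.ofReal_mul k.coe_nonneg]
    exact ENNReal.ofReal_le_ofReal (hBU hx).2.le
  · rw [← mul_assoc, hc]
    refine setLIntegral_mono measurable_const fun x hx => ?_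
    rw [hkof, ← ENNReal.ofReal_mul k.coe_nonneg]
    exact ENNReal.ofReal_le_ofReal (hBU hx).1.le

/-- Near a point `x₀` of the energy surface, the cone measure agrees with a multiple of the
surface measure divided by `‖∇H‖`, up to a factor close to one: the radial map to the tangent
plane at `x₀` is close to the identity, and for cones over subsets of the plane the volume is
known. -/
theorem exists_nhds_within_coneMeasure (hh : 0 < h) {x₀ : E} (hx₀ : H x₀ = h) {k : ℝ≥0}
    (hk : 1 < k) :
    ∃ U ∈ 𝓝 x₀, ∀ B, MeasurableSet B → B ⊆ {x | H x = h} → B ⊆ U →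
      Within ((k : ℝ≥0∞) ^ (2 * Module.finrank ℝ E)) (coneMeasure H h B)
        ((ENNReal.ofReal (2 * h / Module.finrank ℝ E) • gradientMeasure H h) B) := by
  set d := Module.finrank ℝ E with hd
  have hx0 : x₀ ≠ 0 := hH.ne_zero_of_eq hh hx₀
  have hd0 : 0 < d := Module.finrank_pos_iff_exists_ne_zero.2 ⟨x₀, hx0⟩
  set n := gradient H x₀ with hn
  have hE : inner ℝ n x₀ = 2 * h := by rw [hn, hH.inner_gradient_self, hx₀]
  have hn0 : n ≠ 0 := by
    intro h0
    rw [h0, inner_zero_left] at hE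
    linarith
  set Φ : E → E := fun x => (√(H x / h) * (inner ℝ n x / (2 * h))⁻¹) • x with hΦ
  obtain ⟨U₁, hU₁, hLip, hanti⟩ :=
    exists_nhds_biLipschitz (hH.hasStrictFDerivAt_tangentMap hh hx₀) hk
  obtain ⟨U₂, hU₂, hgrad⟩ := hH.within_gradientMeasure (h := h) hn0 hk
  have hU₃ : {x | 0 < inner ℝ n x} ∈ 𝓝 x₀ :=
    (isOpen_lt continuous_const (by fun_prop)).mem_nhds (by
      rw [Set.mem_ofPred_eq, hE]; linarith)
  have hsmul : Tendsto (fun p : ℝ × E => p.1 • p.2) (𝓝 1 ×ˢ 𝓝 x₀) (𝓝 x₀) := by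
    have : ContinuousAt (fun p : ℝ × E => p.1 • p.2) (1, x₀) := by fun_prop
    simpa [ContinuousAt, nhds_prod_eq] using this
  obtain ⟨T, hT, U₄, hU₄, hTU⟩ := mem_prod_iff.1 (hsmul (inter_mem hU₁ hU₃))
  obtain ⟨a, ha0, ha1, haT⟩ : ∃ a : ℝ, 0 < a ∧ a < 1 ∧ Set.Ico a 1 ⊆ T := by
    obtain ⟨l, hl, hlT⟩ := exists_Ioc_subset_of_mem_nhds hT ⟨0, one_pos⟩
    refine ⟨(max l 0 + 1) / 2, by have := le_max_right l 0; linarith,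
      by have := max_lt hl one_pos; linarith, fun t ht => hlT ⟨?_, ht.2.le⟩⟩
    have h1 := le_max_left l 0
    have h2 := max_lt hl one_pos
    have h3 := ht.1
    linarith
  refine ⟨U₂ ∩ U₄, inter_mem hU₂ hU₄, fun B hB hBS hBU => ?_⟩
  have hB1 : ∀ b ∈ B, b ∈ U₁ ∧ 0 < inner ℝ n b := fun b hb => by
    have := hTU (Set.mk_mem_prod (mem_of_mem_nhds hT) (hBU hb).2)
    simpa using this
  set C := {x : E | ∃ t ∈ Set.Ico a 1, ∃ y ∈ B, x = t • y} with hC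
  have hCU : C ⊆ U₁ := by
    rintro _ ⟨t, ht, y, hy, rfl⟩
    exact (hTU (Set.mk_mem_prod (haT ht) (hBU hy).2)).1
  have hBU1 : B ⊆ U₁ := fun b hb => (hB1 b hb).1
  have hinj : Set.InjOn Φ U₁ := fun x hx y hy hxy => by
    have := hanti x hx y hy
    rw [show (√(H x / h) * (inner ℝ n x / (2 * h))⁻¹) • x = Φ x from rfl, hxy, sub_self,
      norm_zero, mul_zero] at this
    exact sub_eq_zero.1 (norm_le_zero_iff.1 this)
  have hD : MeasurableSet (Φ '' B) :=
    hB.image_of_continuousOn_injOn (hLip.continuousOn.mono hBU1) (hinj.mono hBU1)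
  have hDw : ∀ x ∈ Φ '' B, inner ℝ n x = 2 * h := by
    rintro _ ⟨b, hb, rfl⟩
    have hbS : H b = h := hBS hb
    have := (hB1 b hb).2
    simp only [hΦ]
    rw [inner_smul_right, hbS, div_self hh.ne', Real.sqrt_one]
    field_simp
  have hΦsmul : ∀ t : ℝ, 0 < t → ∀ x, Φ (t • x) = t • Φ x := by
    intro t ht x
    simp only [hΦ]
    rw [hH.map_smul, inner_smul_right, mul_div_assoc, Real.sqrt_mul (by positivity),
      Real.sqrt_sq ht.le, smul_smul, smul_smul]
    congr 1
    field_simp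
  have hΦC : Φ '' C = {x | ∃ t ∈ Set.Ico a 1, ∃ y ∈ Φ '' B, x = t • y} := by
    ext x
    constructor
    · rintro ⟨_, ⟨t, ht, y, hy, rfl⟩, rfl⟩
      exact ⟨t, ht, _, ⟨y, hy, rfl⟩, hΦsmul t (ha0.trans_le ht.1) y⟩
    · rintro ⟨t, ht, _, ⟨y, hy, rfl⟩, rfl⟩
      exact ⟨t • y, ⟨t, ht, y, hy, rfl⟩, hΦsmul t (ha0.trans_le ht.1) y⟩
  set c₁ := ENNReal.ofReal (1 - a ^ d) with hc₁
  have had : a ^ d < 1 := pow_lt_one₀ ha0.le ha1 hd0.ne'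
  have hc₁0 : c₁ ≠ 0 := by rw [hc₁, Ne, ENNReal.ofReal_eq_zero, not_le]; linarith
  -- the volume of the cone over `B` and that of its image, the cone over a subset of the plane
  have w1 : Within ((k : ℝ≥0∞) ^ d) (c₁ * coneMeasure H h B)
      (ENNReal.ofReal (2 * h / ‖n‖ * ((1 - a ^ d) / d)) * μHE[d - 1] (Φ '' B)) := by
    have := within_euclideanHausdorffMeasure_image (hLip.mono hCU)
      (fun x hx y hy => hanti x (hCU hx) y (hCU hy)) d
    rw [hd, InnerProductSpace.euclideanHausdorffMeasure_eq_volume, ← hd] at this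
    change Within _ (volume (Φ '' C)) _ at this
    rw [hΦC, volume_planeCone hn0 (by positivity) ha0 ha1 hD hDw,
      hH.volume_truncatedCone hh ha0 ha1 hB hBS] at this
    exact this.symm
  have w2 : Within ((k : ℝ≥0∞) ^ (d - 1)) ((μHE[d - 1] : Measure E) (Φ '' B)) (μHE[d - 1] B) :=
    within_euclideanHausdorffMeasure_image (hLip.mono hBU1)
      (fun x hx y hy => hanti x (hBU1 hx) y (hBU1 hy)) (d - 1)
  have w3 := hgrad B hB hBS (hBU.trans Set.inter_subset_left)
  have hconst : ENNReal.ofReal (2 * h / ‖n‖ * ((1 - a ^ d) / d)) =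
      c₁ * (ENNReal.ofReal (2 * h / d) * ENNReal.ofReal ‖n‖⁻¹) := by
    rw [hc₁, ← ENNReal.ofReal_mul (by positivity), ← ENNReal.ofReal_mul (by linarith)]
    congr 1
    ring
  have w4 := w1.trans ((w2.mul_left _).trans (by
    rw [hconst, mul_assoc, mul_assoc]
    exact (w3.mul_left (ENNReal.ofReal (2 * h / d))).mul_left c₁))
  have w5 := w4.mul_left c₁⁻¹
  rw [← mul_assoc c₁⁻¹, ← mul_assoc c₁⁻¹, ENNReal.inv_mul_cancel hc₁0 ENNReal.ofReal_ne_top,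
    one_mul, one_mul, ← pow_succ, Nat.sub_add_cancel hd0, ← pow_add, ← two_mul] at w5
  exact w5

/-- The surface measure divided by `‖∇H‖` is a multiple of the cone measure. -/
theorem coneMeasure_eq (hh : 0 < h) [Nontrivial E] :
    coneMeasure H h =
      ENNReal.ofReal (2 * h / Module.finrank ℝ E) • gradientMeasure H h := by
  have hS := hH.measurableSet_energySurface h
  have hlocal : ∀ B, MeasurableSet B → B ⊆ {x | H x = h} → coneMeasure H h B =
      (ENNReal.ofReal (2 * h / Module.finrank ℝ E) • gradientMeasure H h) B :=
    fun B hB hBS => measure_eq_of_locally_within (2 * Module.finrank ℝ E)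
      (fun k hk x hx => hH.exists_nhds_within_coneMeasure hh hx hk) hB hBS
  have hc : coneMeasure H h {x | H x = h}ᶜ = 0 := by
    rw [coneMeasure, Measure.map_apply hH.measurable_energyProj hS.compl]
    -- only the origin is not projected to the energy surface
    refine measure_mono_null (t := {0}) (fun x hx => ?_) (Measure.restrict_apply_eq_zero' ?_ |>.2 ?_)
    · by_contra hx0
      exact hx (hH.apply_energyProj hh hx0)
    · exact measurableSet_lt hH.continuous.measurable measurable_const
    · exact measure_mono_null Set.inter_subset_left (measure_singleton 0)
  have hg : (ENNReal.ofReal (2 * h / Module.finrank ℝ E) • gradientMeasure H h)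
      {x | H x = h}ᶜ = 0 := by
    rw [Measure.smul_apply, smul_eq_mul, gradientMeasure,
      withDensity_absolutelyContinuous _ _ (by
        rw [Measure.restrict_apply hS.compl, Set.compl_inter_self, measure_empty]), mul_zero]
  ext B hB
  rw [← measure_inter_add_sdiff B hS, ← measure_inter_add_sdiff (μ := _ • _) B hS,
    hlocal _ (hB.inter hS) Set.inter_subset_right,
    measure_mono_null (Set.sdiff_subset_compl _ _) hc,
    measure_mono_null (Set.sdiff_subset_compl _ _) hg]

end Volume

end QuadraticEnergy

end FlipDynamics

/-! ### Energy coordinates -/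

namespace FlipDynamics

section Matrices

open scoped MatrixOrder Matrix.Norms.L2Operator in
theorem exists_isUnit_conjTranspose_mul_self {n : Type*} [Fintype n] [DecidableEq n]
    {V : Matrix n n ℝ} (hV : V.PosDef) : ∃ B : Matrix n n ℝ, IsUnit B ∧ V = Bᵀ * B := by
  obtain ⟨B, hB, h⟩ := CStarAlgebra.isStrictlyPositive_iff_eq_star_mul_self.mp
    hV.isStrictlyPositive
  refine ⟨B, hB, ?_⟩
  rw [h, Matrix.star_eq_conjTranspose, Matrix.conjTranspose_eq_transpose_of_trivial]

open scoped Matrix.Norms.Operator in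
theorem toEuclideanCLM_exp {n : Type*} [Fintype n] [DecidableEq n] (X : Matrix n n ℝ) :
    Matrix.toEuclideanCLM (𝕜 := ℝ) (NormedSpace.exp X) =
      NormedSpace.exp (Matrix.toEuclideanCLM (𝕜 := ℝ) X) := by
  let : NormedAlgebra ℚ (Matrix n n ℝ) := NormedAlgebra.restrictScalars ℚ ℝ _
  let : NormedAlgebra ℚ (EuclideanSpace ℝ n →L[ℝ] EuclideanSpace ℝ n) :=
    NormedAlgebra.restrictScalars ℚ ℝ _
  exact NormedSpace.map_exp (Matrix.toEuclideanCLM (𝕜 := ℝ) (n := n))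
    (LinearMap.continuous_of_finiteDimensional
      (Matrix.toEuclideanCLM (𝕜 := ℝ) (n := n)).toAlgEquiv.toLinearMap) X

end Matrices

variable {N : ℕ}

/-- The matrix of the change `(q, p) ↦ (B q, p)` to energy coordinates. -/
def energyMatrix (B : Matrix (Fin N) (Fin N) ℝ) : Matrix (Fin N ⊕ Fin N) (Fin N ⊕ Fin N) ℝ :=
  Matrix.fromBlocks B 0 0 1

/-- The generator of the Hamiltonian flow in energy coordinates. -/
def skewGenerator (B : Matrix (Fin N) (Fin N) ℝ) : Matrix (Fin N ⊕ Fin N) (Fin N ⊕ Fin N) ℝ :=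
  Matrix.fromBlocks 0 B (-Bᵀ) 0

theorem isUnit_energyMatrix {B : Matrix (Fin N) (Fin N) ℝ} (hB : IsUnit B) :
    IsUnit (energyMatrix B) := by
  rw [Matrix.isUnit_iff_isUnit_det] at hB ⊢
  rwa [energyMatrix, Matrix.det_fromBlocks_zero₂₁, Matrix.det_one, mul_one]

theorem energyMatrix_mul_generator (B : Matrix (Fin N) (Fin N) ℝ) :
    energyMatrix B * generator (Bᵀ * B) = skewGenerator B * energyMatrix B := by
  simp [energyMatrix, generator, skewGenerator, Matrix.fromBlocks_multiply]

theorem star_skewGenerator (B : Matrix (Fin N) (Fin N) ℝ) :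
    star (skewGenerator B) = -skewGenerator B := by
  rw [Matrix.star_eq_conjTranspose, Matrix.conjTranspose_eq_transpose_of_trivial, skewGenerator,
    Matrix.fromBlocks_transpose, Matrix.fromBlocks_neg]
  simp

/-- The change to energy coordinates conjugates the Hamiltonian flow to a rotation. -/
theorem energyMatrix_mul_exp {B : Matrix (Fin N) (Fin N) ℝ} (hB : IsUnit B) (t : ℝ) :
    energyMatrix B * NormedSpace.exp (t • generator (Bᵀ * B)) =
      NormedSpace.exp (t • skewGenerator B) * energyMatrix B := by
  have hM := isUnit_energyMatrix hB
  have hdet := (Matrix.isUnit_iff_isUnit_det _).1 hM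
  have h1 : t • skewGenerator B =
      energyMatrix B * (t • generator (Bᵀ * B)) * (energyMatrix B)⁻¹ := by
    rw [Matrix.mul_smul, energyMatrix_mul_generator, Matrix.smul_mul,
      Matrix.mul_nonsing_inv_cancel_right _ _ hdet]
  rw [h1, Matrix.exp_conj _ _ hM, Matrix.nonsing_inv_mul_cancel_right _ _ hdet]

/-- The powers of the generator alternate between positions and momenta. -/
theorem generator_pow_mulVec (V : Matrix (Fin N) (Fin N) ℝ) (u : Fin N → ℝ) (k : ℕ) :
    generator V ^ (2 * k) *ᵥ Sum.elim (0 : Fin N → ℝ) u =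
      Sum.elim (0 : Fin N → ℝ) ((-1 : ℝ) ^ k • (V ^ k *ᵥ u)) ∧
    generator V ^ (2 * k + 1) *ᵥ Sum.elim (0 : Fin N → ℝ) u =
      Sum.elim ((-1 : ℝ) ^ k • (V ^ k *ᵥ u)) (0 : Fin N → ℝ) := by
  have hgen : ∀ a b : Fin N → ℝ, generator V *ᵥ Sum.elim a b = Sum.elim b (-(V *ᵥ a)) := by
    intro a b
    rw [generator, Matrix.fromBlocks_mulVec]
    simp [Matrix.neg_mulVec]
  induction k with
  | zero =>
    refine ⟨by simp, ?_⟩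
    simp [hgen]
  | succ k ih =>
    have h1 : generator V ^ (2 * (k + 1)) *ᵥ Sum.elim (0 : Fin N → ℝ) u =
        Sum.elim (0 : Fin N → ℝ) ((-1 : ℝ) ^ (k + 1) • (V ^ (k + 1) *ᵥ u)) := by
      rw [show 2 * (k + 1) = (2 * k + 1) + 1 by ring, pow_succ', ← Matrix.mulVec_mulVec, ih.2, hgen,
        pow_succ' V, ← Matrix.mulVec_mulVec, Matrix.mulVec_smul, pow_succ]
      simp
    refine ⟨h1, ?_⟩
    rw [pow_succ', ← Matrix.mulVec_mulVec, h1, hgen]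
    simp

theorem cyclicSubspace_eq_top [NeZero N] {V : Matrix (Fin N) (Fin N) ℝ}
    (hV : mixingSubspace V = Set.univ) : cyclicSubspace V = ⊤ := by
  refine Submodule.eq_top_iff'.2 fun x => ?_
  have : (WithLp.toLp 2 (Sum.elim 0 x) : PhaseSpace N) ∈ mixingSubspace V := hV ▸ Set.mem_univ _
  exact this.2

theorem eq_zero_of_forall_dotProduct [NeZero N] {V : Matrix (Fin N) (Fin N) ℝ}
    (hV : cyclicSubspace V = ⊤) {w : Fin N → ℝ}
    (hw : ∀ k : ℕ, w ⬝ᵥ (V ^ k *ᵥ (Pi.single 0 1 : Fin N → ℝ)) = 0) : w = 0 := by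
  have h1 : ∀ x ∈ cyclicSubspace V, w ⬝ᵥ x = 0 := by
    intro x hx
    induction hx using Submodule.span_induction with
    | mem x hx => obtain ⟨k, rfl⟩ := hx; exact hw k
    | zero => simp
    | add x y _ _ hx hy => rw [dotProduct_add, hx, hy, add_zero]
    | smul c x _ hx => rw [dotProduct_smul, hx, smul_zero]
  exact dotProduct_self_eq_zero.1 (h1 w (hV ▸ Submodule.mem_top))

/-- The Hamiltonian flow and the velocity flip in energy coordinates. -/
noncomputable def energySystem [NeZero N] {B : Matrix (Fin N) (Fin N) ℝ} (hB : IsUnit B)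
    (hV : cyclicSubspace (Bᵀ * B) = ⊤) : FlipSystem (PhaseSpace N) where
  A := Matrix.toEuclideanCLM (𝕜 := ℝ) (skewGenerator B)
  v := EuclideanSpace.single (Sum.inr 0) 1
  skew x y := by
    rw [← ContinuousLinearMap.adjoint_inner_right, ← ContinuousLinearMap.star_eq_adjoint,
      ← map_star, star_skewGenerator, map_neg, _root_.neg_apply, inner_neg_right]
  norm_v := by simp
  cyclic u hu := by
    -- in the original coordinates `v` is `e = (0, e₁)`, and a vector `w` that is orthogonal to all
    -- the images of `e` under powers of the generator has both halves orthogonal to all `V^k e₁`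
    set M := energyMatrix B with hM
    set e : Fin N ⊕ Fin N → ℝ := Sum.elim (0 : Fin N → ℝ) (Pi.single 0 1) with he
    have hpow : ∀ k : ℕ, skewGenerator B ^ k * M = M * generator (Bᵀ * B) ^ k := by
      intro k
      induction k with
      | zero => simp
      | succ k ih =>
        rw [pow_succ, mul_assoc, ← energyMatrix_mul_generator, ← mul_assoc, ih, mul_assoc,
          ← pow_succ]
    have hMe : M *ᵥ e = e := by
      rw [hM, energyMatrix, he, Matrix.fromBlocks_mulVec]
      simp only [Sum.elim_comp_inl, Sum.elim_comp_inr, Matrix.mulVec_zero, Matrix.zero_mulVec,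
        Matrix.one_mulVec, add_zero, zero_add]
    have hv : (EuclideanSpace.single (Sum.inr 0) 1 : PhaseSpace N) = WithLp.toLp 2 e := by
      ext i
      rcases i with i | i
      · simp [he]
      · simp [he, Pi.single_apply]
    have hdot : ∀ k : ℕ, (Mᵀ *ᵥ WithLp.ofLp u) ⬝ᵥ (generator (Bᵀ * B) ^ k *ᵥ e) = 0 := by
      intro k
      have h1 := hu k
      rw [← map_pow, hv, Matrix.toEuclideanCLM_toLp, ← hMe, Matrix.mulVec_mulVec, hpow,
        ← Matrix.mulVec_mulVec, real_inner_comm, EuclideanSpace.inner_eq_star_dotProduct] at h1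
      rw [star_trivial] at h1
      rw [Matrix.mulVec_transpose, ← Matrix.dotProduct_mulVec]
      exact h1
    set w := Mᵀ *ᵥ WithLp.ofLp u with hw
    have hsplit : ∀ a b : Fin N → ℝ,
        w ⬝ᵥ Sum.elim a b = (w ∘ Sum.inl) ⬝ᵥ a + (w ∘ Sum.inr) ⬝ᵥ b := by
      intro a b
      simp [dotProduct, Fintype.sum_sum_type]
    have hunit : ∀ k : ℕ, ((-1 : ℝ) ^ k) ≠ 0 := fun k => pow_ne_zero _ (by norm_num)
    have h1 : w ∘ Sum.inr = 0 := eq_zero_of_forall_dotProduct hV fun k => by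
      have := hdot (2 * k)
      rw [(generator_pow_mulVec _ _ k).1, hsplit, dotProduct_zero, zero_add, dotProduct_smul,
        smul_eq_mul] at this
      exact (mul_eq_zero.1 this).resolve_left (hunit k)
    have h2 : w ∘ Sum.inl = 0 := eq_zero_of_forall_dotProduct hV fun k => by
      have := hdot (2 * k + 1)
      rw [(generator_pow_mulVec _ _ k).2, hsplit, dotProduct_zero, add_zero, dotProduct_smul,
        smul_eq_mul] at this
      exact (mul_eq_zero.1 this).resolve_left (hunit k)
    have hw0 : w = 0 := by
      ext i
      rcases i with i | i
      · exact congrFun h2 i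
      · exact congrFun h1 i
    have hMt : IsUnit Mᵀ := (Matrix.isUnit_transpose (A := M)).2 (isUnit_energyMatrix hB)
    have := Matrix.mulVec_injective_of_isUnit hMt (hw0.trans (Matrix.mulVec_zero Mᵀ).symm)
    ext i
    exact congrFun this i

/-- The change to energy coordinates as a linear equivalence. -/
noncomputable def energyEquiv {B : Matrix (Fin N) (Fin N) ℝ} (hB : IsUnit B) :
    PhaseSpace N ≃L[ℝ] PhaseSpace N :=
  (LinearEquiv.ofInjectiveEndo (Matrix.toEuclideanCLM (𝕜 := ℝ) (energyMatrix B)).toLinearMap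
    (fun x y hxy => by
      have h1 := congrArg WithLp.ofLp hxy
      ext i
      exact congrFun (Matrix.mulVec_injective_of_isUnit (isUnit_energyMatrix hB) h1) i))
    |>.toContinuousLinearEquiv

theorem energyEquiv_apply {B : Matrix (Fin N) (Fin N) ℝ} (hB : IsUnit B) (ψ : PhaseSpace N) :
    energyEquiv hB ψ = WithLp.toLp 2 (energyMatrix B *ᵥ WithLp.ofLp ψ) := rfl

theorem energyEquiv_inl {B : Matrix (Fin N) (Fin N) ℝ} (hB : IsUnit B) (ψ : PhaseSpace N)
    (i : Fin N) : energyEquiv hB ψ (Sum.inl i) = (B *ᵥ pos ψ) i := by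
  rw [energyEquiv_apply, energyMatrix]
  simp [Matrix.fromBlocks_mulVec]
  rfl

theorem energyEquiv_inr {B : Matrix (Fin N) (Fin N) ℝ} (hB : IsUnit B) (ψ : PhaseSpace N)
    (i : Fin N) : energyEquiv hB ψ (Sum.inr i) = mom ψ i := by
  rw [energyEquiv_apply, energyMatrix]
  simp [Matrix.fromBlocks_mulVec]
  rfl

theorem norm_energyEquiv_sq {B : Matrix (Fin N) (Fin N) ℝ} (hB : IsUnit B) (ψ : PhaseSpace N) :
    ‖energyEquiv hB ψ‖ ^ 2 = 2 * hamiltonian (Bᵀ * B) ψ := by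
  rw [EuclideanSpace.norm_sq_eq, Fintype.sum_sum_type, hamiltonian, ← Matrix.mulVec_mulVec,
    Matrix.dotProduct_mulVec, Matrix.vecMul_transpose]
  simp only [energyEquiv_inl, energyEquiv_inr, Real.norm_eq_abs, sq_abs, dotProduct,
    ← Finset.sum_div]
  simp only [← sq]
  ring

theorem energyEquiv_flow [NeZero N] {B : Matrix (Fin N) (Fin N) ℝ} (hB : IsUnit B)
    (hV : cyclicSubspace (Bᵀ * B) = ⊤) (t : ℝ) (ψ : PhaseSpace N) :
    energyEquiv hB (flow (Bᵀ * B) t ψ) = (energySystem hB hV).rot t (energyEquiv hB ψ) := by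
  rw [FlipSystem.rot_apply, FlipSystem.rotL, energySystem, ← map_smul, ← toEuclideanCLM_exp,
    energyEquiv_apply, energyEquiv_apply, Matrix.toEuclideanCLM_toLp, flow,
    Matrix.mulVec_mulVec, Matrix.mulVec_mulVec, energyMatrix_mul_exp hB]

theorem energyEquiv_velocityFlip [NeZero N] {B : Matrix (Fin N) (Fin N) ℝ} (hB : IsUnit B)
    (hV : cyclicSubspace (Bᵀ * B) = ⊤) (ψ : PhaseSpace N) :
    energyEquiv hB (velocityFlip ψ) = (energySystem hB hV).flip (energyEquiv hB ψ) := by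
  rw [FlipSystem.flip_apply]
  have hpos : pos (velocityFlip ψ) = pos ψ := by
    ext i; simp [pos, velocityFlip]
  ext i
  rcases i with i | i
  · rw [energyEquiv_inl, hpos]
    simp [energySystem, energyEquiv_inl]
  · rw [energyEquiv_inr]
    by_cases hi : i = 0
    · subst hi
      simp [energySystem, energyEquiv_inr, mom, velocityFlip, EuclideanSpace.inner_single_left]
      ring
    · simp [energySystem, energyEquiv_inr, mom, velocityFlip, hi]

theorem energyEquiv_flipState [NeZero N] {B : Matrix (Fin N) (Fin N) ℝ} (hB : IsUnit B)
    (hV : cyclicSubspace (Bᵀ * B) = ⊤) (τ : ℕ → ℝ) (ψ₀ : PhaseSpace N) (m : ℕ) :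
    energyEquiv hB (flipState (Bᵀ * B) τ ψ₀ m) =
      chain (energySystem hB hV).step τ (energyEquiv hB ψ₀) m := by
  induction m with
  | zero => rfl
  | succ m ih =>
    rw [flipState, energyEquiv_velocityFlip hB hV, energyEquiv_flow hB hV, ih]
    rfl

end FlipDynamics

/-! ### Time averages of the harmonic system with velocity flips -/

namespace FlipDynamics

open scoped ENNReal

/-- The normalization of a measure does not depend on constant factors. -/
theorem normalize_smul {X : Type*} [MeasurableSpace X] (μ : Measure X) {c : ℝ≥0∞} (hc : c ≠ 0)
    (hc' : c ≠ ⊤) : ((c • μ) Set.univ)⁻¹ • (c • μ) = (μ Set.univ)⁻¹ • μ := by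
  rw [smul_smul, Measure.smul_apply, smul_eq_mul, ENNReal.mul_inv (Or.inl hc) (Or.inl hc'),
    mul_right_comm, ENNReal.inv_mul_cancel hc hc', one_mul]

/-- If `2 H = ‖L x‖²` for a linear equivalence `L`, the normalized surface measure divided by
`‖∇H‖` is the image of the rotation invariant probability measure of a sphere. -/
theorem normalize_gradientMeasure {E : Type*} [NormedAddCommGroup E] [InnerProductSpace ℝ E]
    [FiniteDimensional ℝ E] [MeasurableSpace E] [BorelSpace E] [Nontrivial E] {H : E → ℝ}
    (L : E ≃L[ℝ] E) (hL : ∀ x, ‖L x‖ ^ 2 = 2 * H x) {h : ℝ} (hh : 0 < h) :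
    (gradientMeasure H h Set.univ)⁻¹ • gradientMeasure H h =
      (rayProb √(2 * h)).map L.symm := by
  have hHeq : H = fun x => ‖L x‖ ^ 2 / 2 := by
    ext x; rw [hL]; ring
  have hH : QuadraticEnergy H :=
    { contDiff := by
        rw [hHeq]
        exact ((L.contDiff.norm_sq ℝ).div_const 2)
      map_smul := fun t x => by
        simp only [hHeq, L.map_smul, norm_smul, mul_pow, Real.norm_eq_abs, sq_abs]
        ring
      pos := fun x hx => by
        have : 0 < ‖L x‖ := norm_pos_iff.2 fun h0 => hx (L.map_eq_zero_iff.1 h0)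
        rw [hHeq]
        positivity }
  set R := √(2 * h) with hR
  have hR0 : 0 < R := Real.sqrt_pos.2 (by linarith)
  have hR2 : R ^ 2 = 2 * h := Real.sq_sqrt (by linarith)
  -- the cone measure is a multiple of the image of the ray measure; the factor `2` in `T` accounts
  -- for the radius `2 R` of the ball in the definition of the latter
  set T : E →ₗ[ℝ] E := (2 : ℝ) • (L.toLinearEquiv : E →ₗ[ℝ] E) with hT
  have hTapply : ∀ x, T x = (2 : ℝ) • L x := fun x => rfl
  have hdet : LinearMap.det T ≠ 0 := by
    rw [hT, LinearMap.det_smul]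
    exact mul_ne_zero (by positivity) (LinearEquiv.isUnit_det' L.toLinearEquiv).ne_zero
  have hTm : Measurable T := T.continuous_of_finiteDimensional.measurable
  have hset : {x | H x < h} = T ⁻¹' Metric.ball 0 (2 * R) := by
    ext x
    rw [Set.mem_preimage, mem_ball_zero_iff, hTapply, norm_smul, Real.norm_ofNat,
      mul_lt_mul_iff_right₀ two_pos, ← sq_lt_sq₀ (norm_nonneg _) hR0.le, hL, hR2,
      mul_lt_mul_iff_right₀ two_pos]
    rfl
  have hproj : energyProj H h = L.symm ∘ sphereProj R ∘ T := by
    ext1 x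
    have h1 : √(H x / h) = ‖L x‖ / R := by
      rw [← Real.sqrt_sq (norm_nonneg (L x)), hR, ← Real.sqrt_div (sq_nonneg _), hL]
      congr 1
      field_simp
    rw [Function.comp_apply, Function.comp_apply, hTapply, sphereProj_smul two_pos, energyProj, h1,
      sphereProj, map_smul, L.symm_apply_apply, inv_div]
  set c := ENNReal.ofReal |(LinearMap.det T)⁻¹| with hc
  have hcone : coneMeasure H h = c • (rayMeasure R).map L.symm := by
    rw [coneMeasure, hproj, hset, ← Measure.map_map L.symm.continuous.measurable
      ((measurable_sphereProj R).comp hTm), ← Measure.map_map (measurable_sphereProj R) hTm,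
      ← Measure.restrict_map hTm Metric.isOpen_ball.measurableSet,
      Measure.map_linearMap_addHaar_eq_smul_addHaar _ hdet, Measure.restrict_smul,
      Measure.map_smul, Measure.map_smul, rayMeasure]
  have hcc : ENNReal.ofReal (2 * h / Module.finrank ℝ E) ≠ 0 := by
    have : 0 < Module.finrank ℝ E := Module.finrank_pos
    rw [Ne, ENNReal.ofReal_eq_zero, not_le]
    positivity
  have hc0 : c ≠ 0 := by
    rw [hc, Ne, ENNReal.ofReal_eq_zero, not_le]
    exact abs_pos.2 (inv_ne_zero hdet)
  rw [← normalize_smul (gradientMeasure H h) hcc ENNReal.ofReal_ne_top, ← hH.coneMeasure_eq hh,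
    hcone, normalize_smul _ hc0 ENNReal.ofReal_ne_top, rayProb, Measure.map_smul,
    Measure.map_apply L.symm.continuous.measurable MeasurableSet.univ, Set.preimage_univ]

variable {N : ℕ}

theorem liouville_eq_gradientMeasure (V : Matrix (Fin N) (Fin N) ℝ) (h : ℝ) :
    liouville V h = gradientMeasure (hamiltonian V) h := by
  have : Module.finrank ℝ (PhaseSpace N) = 2 * N := by simp [two_mul]
  rw [gradientMeasure, this]
  rfl

theorem liouvilleProb_eq [NeZero N] {B : Matrix (Fin N) (Fin N) ℝ} (hB : IsUnit B) {h : ℝ}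
    (hh : 0 < h) :
    liouvilleProb (Bᵀ * B) h = (rayProb √(2 * h)).map (energyEquiv hB).symm := by
  rw [liouvilleProb, liouville_eq_gradientMeasure,
    normalize_gradientMeasure (energyEquiv hB) (norm_energyEquiv_sq hB) hh]

theorem mem_energySurface_iff_norm_energyEquiv {B : Matrix (Fin N) (Fin N) ℝ} (hB : IsUnit B) {h : ℝ} (hh : 0 < h)
    {ψ : PhaseSpace N} :
    ψ ∈ energySurface (Bᵀ * B) h ↔ ‖energyEquiv hB ψ‖ = √(2 * h) := by
  rw [eq_comm, Real.sqrt_eq_iff_eq_sq (by positivity) (norm_nonneg _), norm_energyEquiv_sq,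
    energySurface, Set.mem_ofPred_eq]
  constructor
  · intro h; rw [h]
  · intro h; linarith

theorem norm_chain_step {E : Type*} [NormedAddCommGroup E] [InnerProductSpace ℝ E]
    [FiniteDimensional ℝ E] (S : FlipSystem E) (τ : ℕ → ℝ) (x : E) (m : ℕ) :
    ‖chain S.step τ x m‖ = ‖x‖ := by
  induction m with
  | zero => rfl
  | succ m ih => rw [chain, S.norm_step, ih]

theorem trajectory_mem_energySurface [NeZero N] {B : Matrix (Fin N) (Fin N) ℝ} (hB : IsUnit B)
    (hV : cyclicSubspace (Bᵀ * B) = ⊤) {h : ℝ} (hh : 0 < h) (τ : ℕ → ℝ) {ψ₀ : PhaseSpace N}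
    (hψ₀ : ψ₀ ∈ energySurface (Bᵀ * B) h) (t : ℝ) :
    trajectory (Bᵀ * B) τ ψ₀ t ∈ energySurface (Bᵀ * B) h := by
  rw [mem_energySurface_iff_norm_energyEquiv hB hh] at hψ₀ ⊢
  rw [trajectory, energyEquiv_flow hB hV, LinearIsometryEquiv.norm_map,
    energyEquiv_flipState hB hV, norm_chain_step, hψ₀]

end FlipDynamics

theorem theorem2 {N : ℕ} [NeZero N]
    (V : Matrix (Fin N) (Fin N) ℝ)
    (hV : V ∈ FlipDynamics.VPlus N ∩ FlipDynamics.VInd N)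
    {h : ℝ} (hh : 0 < h)
    {Ω : Type*} [MeasurableSpace Ω] (P : Measure Ω) [IsProbabilityMeasure P]
    (τ : ℕ → Ω → ℝ) (hτ_meas : ∀ n, Measurable (τ n))
    (hτ_indep : iIndepFun τ P)
    (ρ : ℝ → ℝ) (hρ_meas : Measurable ρ) (hρ_pos : ∀ s, 0 < s → 0 < ρ s)
    (hτ_law : ∀ n, P.map (τ n) =
      (volume.restrict (Set.Ioi (0 : ℝ))).withDensity fun s => ENNReal.ofReal (ρ s))
    (hτ_mean : Integrable (τ 0) P)
    (ψ₀ : FlipDynamics.PhaseSpace N) (hψ₀ : ψ₀ ∈ FlipDynamics.energySurface V h)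
    (f : FlipDynamics.PhaseSpace N → ℝ)
    (hf_meas : Measurable fun ψ : FlipDynamics.energySurface V h => f ψ)
    (hf_bdd : ∃ C : ℝ, ∀ ψ ∈ FlipDynamics.energySurface V h, |f ψ| ≤ C) :
    ∀ᵐ ω ∂P, Tendsto
      (fun T : ℝ => T⁻¹ *
        ∫ t in (0 : ℝ)..T, f (FlipDynamics.trajectory V (fun n => τ n ω) ψ₀ t))
      atTop (𝓝 (∫ ψ, f ψ ∂(FlipDynamics.liouvilleProb V h))) := by
  open FlipDynamics in
  obtain ⟨hpd, hmix⟩ := hV.1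
  obtain ⟨B, hB, rfl⟩ := exists_isUnit_conjTranspose_mul_self hpd
  have hcyc := cyclicSubspace_eq_top hmix
  obtain ⟨C, hC⟩ := hf_bdd
  set S := energySystem hB hcyc with hS
  set L := energyEquiv hB with hL
  have hLm : Measurable L := L.continuous.measurable
  have hLsm : Measurable L.symm := L.symm.continuous.measurable
  have hsurf : MeasurableSet (energySurface (Bᵀ * B) h) := by
    have : energySurface (Bᵀ * B) h = L ⁻¹' Metric.sphere 0 √(2 * h) := by
      ext ψ
      rw [mem_energySurface_iff_norm_energyEquiv hB hh, Set.mem_preimage, mem_sphere_zero_iff_norm]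
    rw [this]
    exact hLm Metric.isClosed_sphere.measurableSet
  -- the function is only given on the energy surface; it is extended by zero
  set g := (energySurface (Bᵀ * B) h).indicator f with hg
  have hgm : Measurable g := by
    refine measurable_of_restrict_of_restrict_compl hsurf ?_ ?_
    · rw [hg]
      convert hf_meas using 1
      ext ψ
      exact Set.indicator_of_mem ψ.2 f
    · convert (measurable_const :
        Measurable fun _ : ((energySurface (Bᵀ * B) h)ᶜ : Set _) => (0 : ℝ)) using 1
      ext ψ
      exact Set.indicator_of_notMem ψ.2 f
  have hgC : ∀ x, |g x| ≤ |C| := fun x => by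
    by_cases hx : x ∈ energySurface (Bᵀ * B) h
    · rw [hg, Set.indicator_of_mem hx]
      exact (hC x hx).trans (le_abs_self C)
    · rw [hg, Set.indicator_of_notMem hx, abs_zero]
      exact abs_nonneg C
  set ν : Measure ℝ := (volume.restrict (Set.Ioi (0 : ℝ))).withDensity
    fun s => ENNReal.ofReal (ρ s) with hν
  have : IsProbabilityMeasure ν := by
    rw [← hτ_law 0]
    exact Measure.isProbabilityMeasure_map (hτ_meas 0).aemeasurable
  have hν1 : volume.restrict (Set.Ioi 0) ≪ ν := by
    refine withDensity_absolutelyContinuous' hρ_meas.ennreal_ofReal.aemeasurable ?_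
    filter_upwards [ae_restrict_mem measurableSet_Ioi] with s hs
    exact (ENNReal.ofReal_pos.2 (hρ_pos s hs)).ne'
  have hν2 : ν ≪ volume :=
    (withDensity_absolutelyContinuous _ _).trans Measure.absolutelyContinuous_restrict
  have hpos : ∀ᵐ ω ∂P, ∀ n, 0 < τ n ω := by
    refine ae_all_iff.2 fun n => ae_of_ae_map (hτ_meas n).aemeasurable (p := fun s => 0 < s) ?_
    rw [hτ_law n]
    exact (withDensity_absolutelyContinuous _ _).ae_le (ae_restrict_mem measurableSet_Ioi)
  have hdim : 1 < Module.finrank ℝ (PhaseSpace N) := by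
    have := NeZero.pos N
    simp
    omega
  have hR : 0 < √(2 * h) := Real.sqrt_pos.2 (by linarith)
  have hnorm : ‖L ψ₀‖ = √(2 * h) := (mem_energySurface_iff_norm_energyEquiv hB hh).1 hψ₀
  have hmain := S.ae_tendsto_timeAverage hdim hν1 hν2 hτ_meas hτ_indep hτ_law hpos hτ_mean hR hnorm
    (hgm.comp hLsm) (fun x => hgC (L.symm x))
    (ψ := fun ω t => L (trajectory (Bᵀ * B) (fun n => τ n ω) ψ₀ t)) (by
      filter_upwards [hpos] with ω hω m t h1 h2
      rw [trajectory_eq _ _ hω ψ₀ m t h1 h2, energyEquiv_flow hB hcyc,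
        energyEquiv_flipState hB hcyc])
  have hprob : liouvilleProb (Bᵀ * B) h = (rayProb √(2 * h)).map L.symm := liouvilleProb_eq hB hh
  have hlim : ∫ ψ, f ψ ∂(liouvilleProb (Bᵀ * B) h) =
      ∫ y, (g ∘ L.symm) y ∂(rayProb √(2 * h)) := by
    have h1 : ∫ ψ, f ψ ∂(liouvilleProb (Bᵀ * B) h) = ∫ ψ, g ψ ∂(liouvilleProb (Bᵀ * B) h) := by
      refine integral_congr_ae ?_
      have h2 : ∀ᵐ ψ ∂(liouvilleProb (Bᵀ * B) h), ψ ∈ energySurface (Bᵀ * B) h :=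
        Measure.ae_smul_measure ((withDensity_absolutelyContinuous _ _).ae_le
          (ae_restrict_mem hsurf)) _
      filter_upwards [h2] with ψ hψ
      exact (Set.indicator_of_mem hψ f).symm
    rw [h1, hprob, integral_map hLsm.aemeasurable hgm.aestronglyMeasurable]
    rfl
  rw [hlim]
  filter_upwards [hmain] with ω hω
  refine hω.congr fun T => ?_
  congr 2
  ext t
  rw [Function.comp_apply, L.symm_apply_apply]
  exact Set.indicator_of_mem (trajectory_mem_energySurface hB hcyc hh _ hψ₀ t) f
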